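/- Let $\ell$ be an odd prime number and let $L'\subset\mathbb{C}$ be a CM number field (a totally imaginary quadratic extension of a totally real number field) containing the $\ell$-th roots of unity. Let $L'_\infty=\bigcup_{n\ge 0}L'_n$ be its cyclotomic $\mathbb{Z}_\ell$-extension, that is, the compositum of $L'$ with the cyclotomic $\mathbb{Z}_\ell$-extension of $\mathbb{Q}$, where $L'_n$ is the unique subfield of $L'_\infty$ of degree $\ell^n$ over $L'$. For a module on which complex conjugation $\bar\tau$ acts, the imaginary component (written with the exponent $\ominus$) is the submodule on which $\bar\tau$ acts by inversion. For a number field $K$ let $\mu_K$ be its group of roots of unity and $E'_K\subset K^\times$ its group of $\ell$-units (the elements of $K^\times$ that are units at all finite places not above $\ell$); let $Cl^{[\ell]}_K$ be the subgroup of the $\ell$-group of ideal classes $\mathbb{Z}_\ell\otimes_{\mathbb{Z}}Cl_K$ generated over $\mathbb{Z}_\ell$ by the classes of the primes of $K$ above $\ell$. There are integers $n_0\ge 0$ such that the places above $\ell$ are totally ramified in $L'_\infty/L'_{n_0}$, and for each of them and each $n\ge n_0$: (i) the imaginary $\ell$-units of $L'_n$ are the products of the imaginary $\ell$-units of $L'_{n_0}$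 by the roots of unity of $L'_n$: $$E'^{\,\ominus}_{L'_n}=\mu_{L'_n}\,E'^{\,\ominus}_{L'_{n_0}};$$ (ii) the principal imaginary divisors of $L'_n$ (principal fractional ideals $\mathfrak a$ with $\bar\tau(\mathfrak a)=\mathfrak a^{-1}$) built on the places above $\ell$ are exactly the extensions to $L'_n$ of the principal imaginary divisors of $L'_{n_0}$ built on the places above $\ell$. Moreover, let $d$ be the number of places above $\ell$ of the maximal real subfield $L'^{+}_\infty$ of $L'_\infty$ that are decomposed in $L'_\infty/L'^{+}_\infty$. Then: (iii) the imaginary component of the inductive limit $\varinjlim Cl^{[\ell]}_{L'_n}$, for the extension of ideals, is a divisible $\mathbb{Z}_\ell$-module of codimension $d$, i.e. its Pontryagin dual is a free $\mathbb{Z}_\ell$-module of rank $d$; (iv) the imaginary component of the projective limit $\varprojlim Cl^{[\ell]}_{L'_n}$, for the arithmetic norm, is a free $\mathbb{Z}_\ell$-module of rank $d$. -/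

import Mathlib

open NumberField IsDedekindDomain nonZeroDivisors TensorProduct

namespace CyclotomicTower

/-! ## Functoriality of divisors and of class groups -/

section Functoriality

/-- The homomorphism on ideal classes given by extension of ideals along an injective homomorphism
`f : R → S` of domains. -/
noncomputable def classMap {R S : Type*} [CommRing R] [IsDomain R] [CommRing S] [IsDomain S]
    (f : R →+* S) (hf : Function.Injective f) : ClassGroup R →* ClassGroup S :=
  letI : Algebra R S := f.toAlgebra
  haveI : FaithfulSMul R S := (faithfulSMul_iff_algebraMap_injective R S).mpr hf
  haveI : Module.IsTorsionFree R S := inferInstance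
  ClassGroup.extendedHom R S

theorem map_mem_nonZeroDivisors {R S : Type*} [CommRing R] [IsDomain R] [CommRing S] [IsDomain S]
    (f : R →+* S) (hf : Function.Injective f) (I : (Ideal R)⁰) : I.1.map f ∈ (Ideal S)⁰ :=
  mem_nonZeroDivisors_iff_ne_zero.mpr <|
    (Ideal.map_eq_bot_iff_of_injective hf).not.mpr (mem_nonZeroDivisors_iff_ne_zero.mp I.2)

theorem classMap_mk0 {R S : Type*} [CommRing R] [IsDedekindDomain R] [CommRing S]
    [IsDedekindDomain S] (f : R →+* S) (hf : Function.Injective f) (I : (Ideal R)⁰) :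
    classMap f hf (ClassGroup.mk0 I) =
      ClassGroup.mk0 ⟨I.1.map f, map_mem_nonZeroDivisors f hf I⟩ := by
  let : Algebra R S := f.toAlgebra
  have : FaithfulSMul R S := (faithfulSMul_iff_algebraMap_injective R S).mpr hf
  have : Module.IsTorsionFree R S := inferInstance
  exact ClassGroup.extendedHom_mk0 R S I

section Norm

variable (R S : Type*) [CommRing R] [IsDedekindDomain R] [CommRing S] [IsDedekindDomain S]
  [Algebra R S] [Module.Finite R S] [Module.IsTorsionFree R S]

theorem relNorm_mem_nonZeroDivisors (I : (Ideal S)⁰) : Ideal.relNorm R I.1 ∈ (Ideal R)⁰ :=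
  mem_nonZeroDivisors_iff_ne_zero.mpr <|
    Ideal.relNorm_eq_bot_iff.not.mpr (mem_nonZeroDivisors_iff_ne_zero.mp I.2)

theorem mk0_relNorm_eq (I J : (Ideal S)⁰) (h : ClassGroup.mk0 I = ClassGroup.mk0 J) :
    ClassGroup.mk0 (⟨_, relNorm_mem_nonZeroDivisors R S I⟩ : (Ideal R)⁰) =
      ClassGroup.mk0 ⟨_, relNorm_mem_nonZeroDivisors R S J⟩ := by
  obtain ⟨x, y, hx, hy, hxy⟩ := (ClassGroup.mk0_eq_mk0_iff).mp h
  refine (ClassGroup.mk0_eq_mk0_iff).mpr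
    ⟨Algebra.intNorm R S x, Algebra.intNorm R S y, ?_, ?_, ?_⟩
  · exact Algebra.intNorm_ne_zero.mpr hx
  · exact Algebra.intNorm_ne_zero.mpr hy
  · have := congrArg (Ideal.relNorm R) hxy
    simpa [map_mul, Ideal.relNorm_singleton] using this

/-- The arithmetic norm on ideal classes: the class of `I` is sent to the class of its relative
norm. -/
noncomputable def classNorm : ClassGroup S →* ClassGroup R :=
  MonoidHom.mk' (fun c ↦ ClassGroup.mk0
      ⟨_, relNorm_mem_nonZeroDivisors R S (ClassGroup.mk0_surjective c).choose⟩) <| by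
    intro a b
    rw [← map_mul, MulMemClass.mk_mul_mk]
    have h := mk0_relNorm_eq R S (ClassGroup.mk0_surjective (a * b)).choose
      ((ClassGroup.mk0_surjective a).choose * (ClassGroup.mk0_surjective b).choose) (by
        rw [map_mul, (ClassGroup.mk0_surjective (a * b)).choose_spec,
          (ClassGroup.mk0_surjective a).choose_spec, (ClassGroup.mk0_surjective b).choose_spec])
    rw [h]
    congr 1
    ext1
    simp

theorem classNorm_mk0 (I : (Ideal S)⁰) :
    classNorm R S (ClassGroup.mk0 I) =
      ClassGroup.mk0 ⟨Ideal.relNorm R I.1, relNorm_mem_nonZeroDivisors R S I⟩ :=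
  mk0_relNorm_eq R S _ _ (ClassGroup.mk0_surjective (ClassGroup.mk0 I)).choose_spec

end Norm

variable {K M : Type*} [Field K] [Field M]

theorem mapRingHom_injective (f : K →+* M) :
    Function.Injective (RingOfIntegers.mapRingHom f) := fun x y h ↦
  RingOfIntegers.ext <| f.injective <| by
    rw [← RingOfIntegers.mapRingHom_apply, ← RingOfIntegers.mapRingHom_apply, h]

/-- The homomorphism between the class groups of the rings of integers given by extension of ideals
along a homomorphism of fields. -/
noncomputable def fieldClassMap (f : K →+* M) : ClassGroup (𝓞 K) →* ClassGroup (𝓞 M) :=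
  classMap (RingOfIntegers.mapRingHom f) (mapRingHom_injective f)

/-- The arithmetic norm between the class groups of the rings of integers for the extension of
number fields given by a homomorphism `f`. -/
noncomputable def fieldClassNorm [NumberField K] [NumberField M] (f : K →+* M) :
    ClassGroup (𝓞 M) →* ClassGroup (𝓞 K) :=
  letI : Algebra K M := f.toAlgebra
  classNorm (𝓞 K) (𝓞 M)

/-- The group of divisors of a number field: its (nonzero) fractional ideals. -/
abbrev Divisors (K : Type*) [Field K] : Type _ := (FractionalIdeal (𝓞 K)⁰ K)ˣ

/-- Extension of divisors along a homomorphism of fields. -/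
noncomputable def divisorMap [NumberField K] [NumberField M] (f : K →+* M) :
    Divisors K →* Divisors M :=
  Units.map (FractionalIdeal.extendedHom' (f := RingOfIntegers.mapRingHom f) M
    (nonZeroDivisors_le_comap_nonZeroDivisors_of_injective _
      (mapRingHom_injective f))).toMonoidHom

end Functoriality

/-! ## Complex conjugation and imaginary components -/

/-- A subfield of `ℂ` that is stable under complex conjugation. -/
class ConjStable (K : IntermediateField ℚ ℂ) : Prop where
  conj_mem : ∀ x ∈ K, starRingEnd ℂ x ∈ K

/-- Complex conjugation, as an automorphism of the field extension `ℂ / ℚ`. -/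
noncomputable def conjQ : ℂ →ₐ[ℚ] ℂ := (starRingEnd ℂ).toRatAlgHom

/-- Complex conjugation on a conjugation stable subfield of `ℂ`. -/
noncomputable def conj (K : IntermediateField ℚ ℂ) [ConjStable K] : K →+* K :=
  ((starRingEnd ℂ).comp K.val.toRingHom).codRestrict K
    (fun x ↦ ConjStable.conj_mem x.1 x.2)

theorem inclusion_comp_conj {K M : IntermediateField ℚ ℂ} [ConjStable K] [ConjStable M]
    (h : K ≤ M) : (conj M).comp (IntermediateField.inclusion h).toRingHom =
      (IntermediateField.inclusion h).toRingHom.comp (conj K) :=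
  RingHom.ext fun _ ↦ Subtype.ext rfl

section Arithmetic

variable (ℓ : ℕ) (K : IntermediateField ℚ ℂ)

/-- The finite places of a number field above `ℓ`. -/
def placesAbove (K : Type*) [Field K] [NumberField K] : Set (HeightOneSpectrum (𝓞 K)) :=
  {v | (ℓ : 𝓞 K) ∈ v.asIdeal}

variable [NumberField K] [ConjStable K]

/-- The group of imaginary `ℓ`-units of `K`: the `x ∈ Kˣ` that are units outside the places
above `ℓ` and on which complex conjugation acts by `x ↦ x⁻¹`. -/
noncomputable def imagUnits : Subgroup Kˣ :=
  (placesAbove ℓ K).unit K ⊓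
    MonoidHom.eqLocus (Units.map (conj K).toMonoidHom) (invMonoidHom : Kˣ →* Kˣ)

/-- The group of divisors of `K` built on the places above `ℓ`. -/
noncomputable def ellDivisors : Subgroup (Divisors K) :=
  Subgroup.closure {D | ∃ v ∈ placesAbove ℓ K,
    (D : FractionalIdeal (𝓞 K)⁰ K) = (v.asIdeal : FractionalIdeal (𝓞 K)⁰ K)}

/-- The group of the imaginary principal divisors of `K` built on the places above `ℓ`. -/
noncomputable def imagPrincipalDivisors : Subgroup (Divisors K) :=
  ellDivisors ℓ K ⊓ (toPrincipalIdeal (𝓞 K) K).range ⊓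
    MonoidHom.eqLocus (divisorMap (conj K)) (invMonoidHom : Divisors K →* Divisors K)

variable [Fact ℓ.Prime]

/-- The `ℓ`-group of ideal classes of `K` (that is, the `ℓ`-primary part of the class group),
written additively as the `ℤ_ℓ`-module `ℤ_ℓ ⊗ Cl(K)`. -/
abbrev EllClassGroup (K : Type*) [Field K] : Type _ :=
  ℤ_[ℓ] ⊗[ℤ] Additive (ClassGroup (𝓞 K))

/-- The `ℤ_ℓ`-linear map on `ℓ`-groups of classes induced by a homomorphism of class groups. -/
noncomputable def ellMap {K M : Type*} [Field K] [Field M]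
    (g : ClassGroup (𝓞 K) →* ClassGroup (𝓞 M)) : EllClassGroup ℓ K →ₗ[ℤ_[ℓ]] EllClassGroup ℓ M :=
  LinearMap.baseChange ℤ_[ℓ] (MonoidHom.toAdditive g).toIntLinearMap

/-- The submodule of the `ℓ`-group of classes generated by the classes of the places
above `ℓ`. -/
noncomputable def ellClasses (K : Type*) [Field K] [NumberField K] :
    Submodule ℤ_[ℓ] (EllClassGroup ℓ K) :=
  Submodule.span ℤ_[ℓ] {c | ∃ v ∈ placesAbove ℓ K,
    c = 1 ⊗ₜ Additive.ofMul (ClassGroup.mk0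
      ⟨v.asIdeal, mem_nonZeroDivisors_iff_ne_zero.mpr v.ne_bot⟩)}

theorem tmul_place_mem_ellClasses (K : Type*) [Field K] [NumberField K]
    (v : HeightOneSpectrum (𝓞 K)) (hv : v ∈ placesAbove ℓ K) :
    (1 ⊗ₜ Additive.ofMul (ClassGroup.mk0
      ⟨v.asIdeal, mem_nonZeroDivisors_iff_ne_zero.mpr v.ne_bot⟩) : EllClassGroup ℓ K) ∈
      ellClasses ℓ K :=
  Submodule.subset_span ⟨v, hv, rfl⟩

theorem tmul_mk0_mem_ellClasses (K : Type*) [Field K] [NumberField K] (I : Ideal (𝓞 K))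
    (hI : I ∈ (Ideal (𝓞 K))⁰) (hℓ : (ℓ : 𝓞 K) ∈ I) :
    (1 ⊗ₜ Additive.ofMul (ClassGroup.mk0 ⟨I, hI⟩) : EllClassGroup ℓ K) ∈ ellClasses ℓ K := by
  induction I using UniqueFactorizationMonoid.induction_on_prime with
  | h₁ => exact absurd rfl (mem_nonZeroDivisors_iff_ne_zero.mp hI)
  | h₂ I hu =>
    have h1 : (⟨I, hI⟩ : (Ideal (𝓞 K))⁰) = 1 :=
      Subtype.ext ((Ideal.isUnit_iff.mp hu).trans Ideal.one_eq_top.symm)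
    rw [h1, map_one, ofMul_one, TensorProduct.tmul_zero]
    exact zero_mem _
  | h₃ I P hI0 hP ih =>
    have hP0 : P ∈ (Ideal (𝓞 K))⁰ := mem_nonZeroDivisors_iff_ne_zero.mpr hP.ne_zero
    have hI' : I ∈ (Ideal (𝓞 K))⁰ := mem_nonZeroDivisors_iff_ne_zero.mpr hI0
    have h1 : (⟨P * I, hI⟩ : (Ideal (𝓞 K))⁰) = ⟨P, hP0⟩ * ⟨I, hI'⟩ := rfl
    rw [h1, map_mul, ofMul_mul, TensorProduct.tmul_add]
    have hle : P * I ≤ P := Ideal.mul_le_left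
    have hle' : P * I ≤ I := Ideal.mul_le_right
    have hPℓ : (ℓ : 𝓞 K) ∈ P := hle hℓ
    have hIℓ : (ℓ : 𝓞 K) ∈ I := hle' hℓ
    exact add_mem (tmul_place_mem_ellClasses ℓ K
      ⟨P, Ideal.isPrime_of_prime hP, hP.ne_zero⟩ hPℓ) (ih hI' hIℓ)

theorem ellMap_mem_ellClasses {K M : Type*} [Field K] [NumberField K] [Field M] [NumberField M]
    (f : K →+* M) (c : EllClassGroup ℓ K) (hc : c ∈ ellClasses ℓ K) :
    ellMap ℓ (fieldClassMap f) c ∈ ellClasses ℓ M := by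
  induction hc using Submodule.span_induction with
  | mem c hc =>
    obtain ⟨v, hv, rfl⟩ := hc
    have h := classMap_mk0 (RingOfIntegers.mapRingHom f) (mapRingHom_injective f)
      ⟨v.asIdeal, mem_nonZeroDivisors_iff_ne_zero.mpr v.ne_bot⟩
    have h2 : ellMap ℓ (fieldClassMap f) (1 ⊗ₜ Additive.ofMul (ClassGroup.mk0
        ⟨v.asIdeal, mem_nonZeroDivisors_iff_ne_zero.mpr v.ne_bot⟩)) =
        1 ⊗ₜ Additive.ofMul (classMap (RingOfIntegers.mapRingHom f) (mapRingHom_injective f)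
          (ClassGroup.mk0 ⟨v.asIdeal, mem_nonZeroDivisors_iff_ne_zero.mpr v.ne_bot⟩)) := rfl
    rw [h2, h]
    refine tmul_mk0_mem_ellClasses ℓ M _ _ ?_
    have := Ideal.mem_map_of_mem (RingOfIntegers.mapRingHom f) hv
    rwa [map_natCast] at this
  | zero => rw [map_zero]; exact zero_mem _
  | add x y _ _ hx hy => rw [map_add]; exact add_mem hx hy
  | smul a x _ hx => rw [map_smul]; exact Submodule.smul_mem _ a hx

/-- The map induced on the `ℓ`-classes of places above `ℓ` by a homomorphism of number fields. -/
noncomputable def ellClassesMap {K M : Type*} [Field K] [NumberField K] [Field M] [NumberField M]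
    (f : K →+* M) : ellClasses ℓ K →ₗ[ℤ_[ℓ]] ellClasses ℓ M :=
  (ellMap ℓ (fieldClassMap f)).restrict (ellMap_mem_ellClasses ℓ f)

theorem fieldClassMap_comp {K M N : Type*} [Field K] [NumberField K] [Field M] [NumberField M]
    [Field N] [NumberField N] (f : K →+* M) (g : M →+* N) :
    (fieldClassMap g).comp (fieldClassMap f) = fieldClassMap (g.comp f) := by
  ext c
  obtain ⟨I, rfl⟩ := ClassGroup.mk0_surjective c
  simp only [fieldClassMap, MonoidHom.comp_apply, classMap_mk0, Ideal.map_map]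
  rfl

theorem ellClassesMap_comp {K M N : Type*} [Field K] [NumberField K] [Field M] [NumberField M]
    [Field N] [NumberField N] (f : K →+* M) (g : M →+* N) :
    ellClassesMap ℓ g ∘ₗ ellClassesMap ℓ f = ellClassesMap ℓ (g.comp f) := by
  ext c
  have h : ellMap ℓ (fieldClassMap g) ∘ₗ ellMap ℓ (fieldClassMap f) =
      ellMap ℓ (fieldClassMap (g.comp f)) := by
    rw [← fieldClassMap_comp, ellMap, ellMap, ← LinearMap.baseChange_comp]
    rfl
  exact LinearMap.congr_fun h c.1

end Arithmetic

/-! ## The cyclotomic `ℤ_ℓ`-extension of a number field `L ⊂ ℂ` -/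

section Tower

variable (ℓ : ℕ)

/-- The subfield `ℚ(μ_N)` of `ℂ` generated by the `N`-th roots of unity. -/
noncomputable def cyclotomicSubfield (N : ℕ) : IntermediateField ℚ ℂ :=
  IntermediateField.adjoin ℚ {z : ℂ | z ^ N = 1}

/-- The `m`-th layer `ℚ_m` of the cyclotomic `ℤ_ℓ`-extension of `ℚ`, for an odd prime `ℓ`: the
largest subfield of `ℚ(μ_{ℓ^(m+1)})` of degree dividing `ℓ^m` (as `ℚ(μ_{ℓ^(m+1)}) / ℚ` is cyclic
of degree `ℓ^m (ℓ - 1)`, these subfields form a chain, whose top is the unique one of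
degree `ℓ^m`). -/
noncomputable def rationalLayer (m : ℕ) : IntermediateField ℚ ℂ :=
  sSup {K | K ≤ cyclotomicSubfield (ℓ ^ (m + 1)) ∧ Module.finrank ℚ K ∣ ℓ ^ m}

/-- The cyclotomic `ℤ_ℓ`-extension `ℚ_∞` of `ℚ`. -/
noncomputable def rationalTop : IntermediateField ℚ ℂ := ⨆ m, rationalLayer ℓ m

variable (L : IntermediateField ℚ ℂ)

/-- The cyclotomic `ℤ_ℓ`-extension `L_∞ = L ℚ_∞` of `L`. -/
noncomputable def cyclotomicExtension : IntermediateField ℚ ℂ := L ⊔ rationalTop ℓ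

/-- The `n`-th layer `L_n` of the cyclotomic `ℤ_ℓ`-extension of `L`, the unique subfield
of `L_∞` of degree `ℓ^n` over `L`. Explicitly, if `L ∩ ℚ_∞ = ℚ_c`, that is
`[L ∩ ℚ_∞ : ℚ] = ℓ^c`, then `L_n = L ℚ_{n+c}`. -/
noncomputable def layer (n : ℕ) : IntermediateField ℚ ℂ :=
  L ⊔ rationalLayer ℓ (n + padicValNat ℓ (Module.finrank ℚ (L ⊓ rationalTop ℓ : _)))

theorem cyclotomicSubfield_mono {N N' : ℕ} (h : N ∣ N') :
    cyclotomicSubfield N ≤ cyclotomicSubfield N' := by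
  refine IntermediateField.adjoin.mono _ _ _ ?_
  obtain ⟨k, rfl⟩ := h
  intro z hz
  simp only [Set.mem_ofPred_eq] at hz ⊢
  rw [pow_mul, hz, one_pow]

theorem rationalLayer_mono {m m' : ℕ} (h : m ≤ m') : rationalLayer ℓ m ≤ rationalLayer ℓ m' :=
  sSup_le_sSup fun _ hK ↦ ⟨hK.1.trans (cyclotomicSubfield_mono (pow_dvd_pow ℓ (by omega))),
    hK.2.trans (pow_dvd_pow ℓ h)⟩

theorem layer_mono {n m : ℕ} (h : n ≤ m) : layer ℓ L n ≤ layer ℓ L m :=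
  sup_le_sup_left (rationalLayer_mono ℓ (by omega)) L

/-- The inclusion of `L_n` in `L_m` for `n ≤ m`. -/
noncomputable def incl {n m : ℕ} (h : n ≤ m) : layer ℓ L n →+* layer ℓ L m :=
  (IntermediateField.inclusion (layer_mono ℓ L h)).toRingHom

theorem finiteDimensional_layer [Fact ℓ.Prime] [FiniteDimensional ℚ L] (n : ℕ) :
    FiniteDimensional ℚ (layer ℓ L n) := by
  have hle : ∀ m, rationalLayer ℓ m ≤ cyclotomicSubfield (ℓ ^ (m + 1)) := fun m ↦
    sSup_le fun K hK ↦ hK.1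
  have hfin : ∀ m, FiniteDimensional ℚ (cyclotomicSubfield (ℓ ^ (m + 1))) := by
    intro m
    have hpos : 0 < ℓ ^ (m + 1) := pow_pos (Fact.out : ℓ.Prime).pos _
    have hset : {z : ℂ | z ^ (ℓ ^ (m + 1)) = 1}.Finite := by
      refine (Polynomial.nthRootsFinset (ℓ ^ (m + 1)) (1 : ℂ)).finite_toSet.subset fun z hz ↦ ?_
      simpa [Polynomial.mem_nthRootsFinset hpos] using hz
    have := hset.to_subtype
    refine IntermediateField.finiteDimensional_adjoin fun z hz ↦ ?_
    exact IsIntegral.of_pow hpos (by rw [show z ^ _ = 1 from hz]; exact isIntegral_one)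
  have : ∀ m, FiniteDimensional ℚ (rationalLayer ℓ m) := fun m ↦
    have := hfin m
    FiniteDimensional.of_injective (IntermediateField.inclusion (hle m)).toLinearMap
      (IntermediateField.inclusion_injective (hle m))
  exact IntermediateField.finiteDimensional_sup _ _

instance [Fact ℓ.Prime] [NumberField L] (n : ℕ) : NumberField (layer ℓ L n) where
  to_charZero := inferInstance
  to_finiteDimensional := by
    have : FiniteDimensional ℚ L := NumberField.to_finiteDimensional
    exact finiteDimensional_layer ℓ L n

theorem conjStable_iff (K : IntermediateField ℚ ℂ) : ConjStable K ↔ K.map conjQ ≤ K :=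
  ⟨fun h ↦ IntermediateField.map_le_iff_le_comap.mpr fun x hx ↦ h.conj_mem x hx,
    fun h ↦ ⟨fun x hx ↦ h ⟨x, hx, rfl⟩⟩⟩

theorem conjStable_cyclotomicSubfield (N : ℕ) : ConjStable (cyclotomicSubfield N) := by
  rw [conjStable_iff, cyclotomicSubfield, IntermediateField.adjoin_map]
  refine IntermediateField.adjoin.mono _ _ _ ?_
  rintro _ ⟨z, hz, rfl⟩
  have h : conjQ z ^ N = 1 := by rw [← map_pow, show z ^ N = 1 from hz, map_one]
  exact h

theorem conjStable_rationalLayer (m : ℕ) : ConjStable (rationalLayer ℓ m) := by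
  rw [conjStable_iff, IntermediateField.map_le_iff_le_comap]
  refine sSup_le fun K hK ↦ ?_
  rw [← IntermediateField.map_le_iff_le_comap]
  refine le_sSup ⟨?_, ?_⟩
  · exact (IntermediateField.map_mono conjQ hK.1).trans
      ((conjStable_iff _).mp (conjStable_cyclotomicSubfield _))
  · have h := (K.equivMap conjQ).toLinearEquiv.finrank_eq
    rw [← h]
    exact hK.2

instance (n : ℕ) [hL : ConjStable L] : ConjStable (layer ℓ L n) := by
  rw [conjStable_iff, layer, IntermediateField.map_sup]
  exact sup_le_sup ((conjStable_iff L).mp hL)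
    ((conjStable_iff _).mp (conjStable_rationalLayer ℓ _))

instance [NumberField L] [IsCMField L] : ConjStable L where
  conj_mem x hx := by
    have h := IsCMField.complexEmbedding_complexConj L L.val.toRingHom ⟨x, hx⟩
    have h2 : L.val.toRingHom (⟨x, hx⟩ : L) = x := rfl
    rw [h2] at h
    rw [← h]
    exact (IsCMField.complexConj L ⟨x, hx⟩).2

theorem incl_comp_conj [ConjStable L] {n m : ℕ} (h : n ≤ m) :
    (conj (layer ℓ L m)).comp (incl ℓ L h) = (incl ℓ L h).comp (conj (layer ℓ L n)) :=
  inclusion_comp_conj (layer_mono ℓ L h)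

variable [Fact ℓ.Prime] [NumberField L]

/-- The places above `ℓ` are totally ramified in `L_∞ / L_{n₀}`: in each `L_m` with `m ≥ n₀`, a
place `v` of `L_{n₀}` above `ℓ` becomes the power of exponent `[L_m : L_{n₀}] = ℓ^(m - n₀)` of
a prime. -/
def TotallyRamifiedFrom (n₀ : ℕ) : Prop :=
  ∀ m (h : n₀ ≤ m), ∀ v ∈ placesAbove ℓ (layer ℓ L n₀), ∃ w : HeightOneSpectrum (𝓞 (layer ℓ L m)),
    v.asIdeal.map (RingOfIntegers.mapRingHom (incl ℓ L h)) = w.asIdeal ^ ℓ ^ (m - n₀)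

variable [ConjStable L]

/-- The inductive limit, for the extension of divisors, of the `ℓ`-groups of classes of the
fields `L_n` generated by the places above `ℓ`. -/
abbrev IndLimit : Type :=
  Module.DirectLimit (R := ℤ_[ℓ]) (fun n ↦ ellClasses ℓ (layer ℓ L n))
    (fun _ _ h ↦ ellClassesMap ℓ (incl ℓ L h))

noncomputable instance : AddCommGroup (IndLimit ℓ L) :=
  Module.DirectLimit.addCommGroup (R := ℤ_[ℓ]) (fun n ↦ ellClasses ℓ (layer ℓ L n))
    (fun _ _ h ↦ ellClassesMap ℓ (incl ℓ L h))

/-- Complex conjugation on the inductive limit. -/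
noncomputable def indLimitConj : IndLimit ℓ L →ₗ[ℤ_[ℓ]] IndLimit ℓ L :=
  Module.DirectLimit.map (fun n ↦ ellClassesMap ℓ (conj (layer ℓ L n))) fun n m h ↦ by
    rw [ellClassesMap_comp, ellClassesMap_comp, incl_comp_conj]

/-- The imaginary component of the inductive limit. -/
noncomputable def imagIndLimit : Submodule ℤ_[ℓ] (IndLimit ℓ L) :=
  LinearMap.eqLocus (indLimitConj ℓ L) (-LinearMap.id)

/-- The projective limit, for the arithmetic norm, of the `ℓ`-groups of classes of the
fields `L_n` generated by the places above `ℓ`. -/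
noncomputable def projLimit : Submodule ℤ_[ℓ] (∀ n, EllClassGroup ℓ (layer ℓ L n)) where
  carrier := {x | (∀ n, x n ∈ ellClasses ℓ (layer ℓ L n)) ∧
    ∀ n m (h : n ≤ m), ellMap ℓ (fieldClassNorm (incl ℓ L h)) (x m) = x n}
  zero_mem' := ⟨fun _ ↦ zero_mem _, fun _ _ _ ↦ map_zero _⟩
  add_mem' := fun hx hy ↦ ⟨fun n ↦ add_mem (hx.1 n) (hy.1 n), fun n m h ↦ by
    rw [Pi.add_apply, map_add, hx.2 n m h, hy.2 n m h, Pi.add_apply]⟩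
  smul_mem' := fun a x hx ↦ ⟨fun n ↦ Submodule.smul_mem _ a (hx.1 n), fun n m h ↦ by
    rw [Pi.smul_apply, map_smul, hx.2 n m h, Pi.smul_apply]⟩

/-- The imaginary component of the projective limit. -/
noncomputable def imagProjLimit : Submodule ℤ_[ℓ] (∀ n, EllClassGroup ℓ (layer ℓ L n)) :=
  projLimit ℓ L ⊓ LinearMap.eqLocus
    (LinearMap.pi fun n ↦ ellMap ℓ (fieldClassMap (conj (layer ℓ L n))) ∘ₗ LinearMap.proj n)
    (-LinearMap.id)

end Tower

/-- The number of places above `ℓ` of the maximal real subfield `K⁺` of `K` that are decomposed in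
`K / K⁺`. -/
noncomputable def numSplitPlaces (ℓ : ℕ) (K : Type*) [Field K] [CharZero K] : ℕ :=
  {p : Ideal (𝓞 (maximalRealSubfield K)) | p.IsPrime ∧ (ℓ : 𝓞 (maximalRealSubfield K)) ∈ p ∧
    (p.primesOver (𝓞 K)).Nontrivial}.ncard

/-- A `ℤ_ℓ`-module `X` is free of rank `d`. -/
def IsFreeOfRank (ℓ d : ℕ) [Fact ℓ.Prime] (X : Type*) [AddCommGroup X] [Module ℤ_[ℓ] X] : Prop :=
  Module.Free ℤ_[ℓ] X ∧ Module.Finite ℤ_[ℓ] X ∧ Module.finrank ℤ_[ℓ] X = d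

/-- A `ℤ_ℓ`-module `X` is divisible of codimension `d`: it is divisible and its Pontryagin dual
(the module of homomorphisms to `ℚ / ℤ`) is a free `ℤ_ℓ`-module of rank `d`. -/
def IsDivisibleOfCodim (ℓ d : ℕ) [Fact ℓ.Prime] (X : Type*) [AddCommGroup X]
    [Module ℤ_[ℓ] X] : Prop :=
  (∀ a : ℤ_[ℓ], a ≠ 0 → ∀ x : X, ∃ y : X, a • y = x) ∧ IsFreeOfRank ℓ d (CharacterModule X)

end CyclotomicTower

/-!
As `L` contains the `ℓ`-th roots of unity, `L_n` is `L` with the roots of unity of some order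
`ℓ^(n+c+1)` adjoined (`layer_eq_sup_cyclotomicSubfield`), so that each step of the tower is trivial
or a Kummer extension of degree `ℓ`, and every complex embedding of a layer commutes with the
conjugations (`embedding_layer_conj`).

*Ramification.* The product of the absolute norms of the places above `ℓ` increases with `n`, and is
bounded because each such place is ramified to order at least `φ(ℓ^(n+c+1))` over `ℚ`, which is of
the size of the degree. Where this product is constant, the places are totally ramified
(`exists_totallyRamifiedFrom`).

*Imaginary units.* Let `σ` generate the Galois group of a totally ramified step. It fixes the places
above `ℓ`, so for an imaginary `ℓ`-unit `x` the quotient `σ x / x` is a unit, of absolute value `1`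
at all complex places, hence a root of unity, and of norm `1`. Such a root of unity is `σ η / η` for
a root of unity `η` (`exists_map_eq_mul_of_prod_eq_one`), and then `x / η` comes from the lower
field (`exists_torsion_mul_eq_of_step`).

*Imaginary divisors.* If `D = (x)` is imaginary, `x / x̄` is an imaginary `ℓ`-unit of divisor `2 D`;
by the result on units `2 D` is extended from `L_{n₀}`, and as `ℓ` is odd and norms multiply
divisors extended from `L_{n₀}` by a power of `ℓ`, so is `D`, from a principal divisor
(`exists_eq_smul_of_classOf_eq_one`).

*Limits.* Let `F` be the `ℤ_ℓ`-module of the functions on the places of `L_{n₀}` above `ℓ` that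
complex conjugation changes to their opposites, with the submodule `P` of the relations between the
classes of these places in `L_{n₀}`. By the previous point the imaginary classes of `L_n` built on
the places above `ℓ` are `F / ℓ^(n - n₀) P` (`classHom_eq_zero_iff`); the extension of ideals is
induced by the multiplication by `ℓ` and the norm by the identity. The inductive limit is therefore
`F[1/ℓ] / P`, which is divisible with dual free of rank `rank P = rank F`
(`isDivisibleOfCodim_of_lattice`), and the projective limit is `F` itself
(`isFreeOfRank_of_bijective_limit`).

*Rank.* The rank of `F` is the number of pairs of conjugate places of `L_{n₀}` above `ℓ`. By total
ramification the primes of `L_∞` above `ℓ` correspond to the places of `L_{n₀}` above `ℓ`, and those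
above a given prime of the maximal real subfield are conjugate (`finrank_antiSub_placeConj`).
-/

namespace CyclotomicTower

/-! ### The layers as cyclotomic extensions -/

theorem cyclotomicSubfield_eq_adjoin {N : ℕ} [NeZero N] {ζ : ℂ} (hζ : IsPrimitiveRoot ζ N) :
    cyclotomicSubfield N = IntermediateField.adjoin ℚ {ζ} := by
  refine le_antisymm (IntermediateField.adjoin_le_iff.mpr fun z hz ↦ ?_)
    (IntermediateField.adjoin.mono _ _ _ fun z hz ↦ ?_)
  · obtain ⟨i, -, rfl⟩ := hζ.eq_pow_of_pow_eq_one (show z ^ N = 1 from hz)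
    exact pow_mem (IntermediateField.mem_adjoin_simple_self ℚ ζ) i
  · rw [Set.mem_singleton_iff.mp hz]
    exact hζ.pow_eq_one

theorem isCyclotomicExtension_cyclotomicSubfield (N : ℕ) [NeZero N] :
    IsCyclotomicExtension {N} ℚ (cyclotomicSubfield N) := by
  have hζ := Complex.isPrimitiveRoot_exp N (NeZero.ne N)
  have h := (IntermediateField.isCyclotomicExtension_singleton_iff_eq_adjoin N ℚ ℂ
    (cyclotomicSubfield N) hζ).mpr (cyclotomicSubfield_eq_adjoin hζ)
  convert h
  · rfl
  · exact Subsingleton.elim _ _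

theorem finiteDimensional_cyclotomicSubfield (N : ℕ) [NeZero N] :
    FiniteDimensional ℚ (cyclotomicSubfield N) :=
  have := isCyclotomicExtension_cyclotomicSubfield N
  IsCyclotomicExtension.finiteDimensional {N} ℚ _

theorem finrank_cyclotomicSubfield (N : ℕ) [NeZero N] :
    Module.finrank ℚ (cyclotomicSubfield N) = N.totient := by
  have := isCyclotomicExtension_cyclotomicSubfield N
  exact IsCyclotomicExtension.finrank _ (Polynomial.cyclotomic.irreducible_rat (NeZero.pos N))

/-- An abelian extension has a subextension of degree the largest power of `p` dividing its
degree. -/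
theorem exists_intermediateField_finrank_eq (K M : Type*) [Field K] [Field M] [Algebra K M]
    [FiniteDimensional K M] [IsAbelianGalois K M] {p m b : ℕ} [Fact p.Prime]
    (h : Module.finrank K M = p ^ m * b) (hb : ¬ p ∣ b) :
    ∃ B : IntermediateField K M, Module.finrank K B = p ^ m := by
  have hG : Nat.card Gal(M/K) = p ^ m * b := by rw [IsGalois.card_aut_eq_finrank, h]
  have hp : p.Prime := Fact.out
  have hb0 : b ≠ 0 := fun h0 ↦ hb (h0 ▸ dvd_zero p)
  let P : Sylow p Gal(M/K) := default
  have hP : Nat.card P = p ^ m := by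
    rw [P.card_eq_multiplicity, hG, Nat.factorization_mul (pow_ne_zero _ hp.ne_zero) hb0,
      hp.factorization_pow]
    simp [Nat.factorization_eq_zero_of_not_dvd hb]
  have hcomm : IsMulCommutative Gal(M/K) := inferInstance
  have hnorm : (P : Subgroup Gal(M/K)).Normal :=
    ⟨fun x hx g ↦ by rwa [hcomm.is_comm.comm g x, mul_inv_cancel_right]⟩
  have hidx : (P : Subgroup Gal(M/K)).index = b := by
    have := (P : Subgroup Gal(M/K)).card_mul_index
    rw [hG, show Nat.card (P : Subgroup Gal(M/K)) = p ^ m from hP] at this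
    exact Nat.eq_of_mul_eq_mul_left (pow_pos hp.pos m) this
  obtain ⟨H, hH⟩ := Subgroup.exists_right_complement'_of_coprime
    (N := (P : Subgroup Gal(M/K))) (by
      rw [hidx, show Nat.card (P : Subgroup Gal(M/K)) = p ^ m from hP]
      exact Nat.Coprime.pow_left m ((Nat.Prime.coprime_iff_not_dvd hp).mpr hb))
  have hHb : Nat.card H = b := hH.symm.index_eq_card.symm.trans hidx
  refine ⟨IntermediateField.fixedField H, ?_⟩
  have h1 := IntermediateField.finrank_fixedField_eq_card H
  have h2 := Module.finrank_mul_finrank K (IntermediateField.fixedField H) M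
  rw [h1, hHb, h] at h2
  exact Nat.eq_of_mul_eq_mul_right (Nat.pos_of_ne_zero hb0) h2

theorem rationalLayer_le (ℓ m : ℕ) : rationalLayer ℓ m ≤ cyclotomicSubfield (ℓ ^ (m + 1)) :=
  sSup_le fun _ hK ↦ hK.1

section PrimePower

variable {ℓ : ℕ} [Fact ℓ.Prime]

/-- The field `ℚ(μ_{ℓ^(m+1)})` is the compositum of `ℚ(μ_ℓ)`, of degree `ℓ - 1`, and of its subfield
of degree `ℓ^m`. -/
theorem cyclotomicSubfield_le_sup_rationalLayer (m : ℕ) :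
    cyclotomicSubfield (ℓ ^ (m + 1)) ≤ cyclotomicSubfield ℓ ⊔ rationalLayer ℓ m := by
  have hp : ℓ.Prime := Fact.out
  have : NeZero ℓ := ⟨hp.ne_zero⟩
  have := isCyclotomicExtension_cyclotomicSubfield (ℓ ^ (m + 1))
  have := finiteDimensional_cyclotomicSubfield (ℓ ^ (m + 1))
  have : IsAbelianGalois ℚ (cyclotomicSubfield (ℓ ^ (m + 1))) :=
    IsCyclotomicExtension.isAbelianGalois {ℓ ^ (m + 1)} ℚ _
  have hr := finrank_cyclotomicSubfield (ℓ ^ (m + 1))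
  rw [Nat.totient_prime_pow_succ hp] at hr
  have hnd : ¬ ℓ ∣ ℓ - 1 := fun h ↦ by
    have := Nat.le_of_dvd (Nat.sub_pos_of_lt hp.one_lt) h
    have := hp.one_lt
    omega
  obtain ⟨B, hB⟩ := exists_intermediateField_finrank_eq ℚ (cyclotomicSubfield (ℓ ^ (m + 1))) hr hnd
  have hBr : Module.finrank ℚ (IntermediateField.lift B) = ℓ ^ m :=
    (IntermediateField.liftAlgEquiv B).symm.toLinearEquiv.finrank_eq.trans hB
  have hBl : IntermediateField.lift B ≤ rationalLayer ℓ m :=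
    le_sSup ⟨IntermediateField.lift_le B, hBr ▸ dvd_rfl⟩
  have hle : cyclotomicSubfield ℓ ⊔ IntermediateField.lift B ≤
      cyclotomicSubfield (ℓ ^ (m + 1)) :=
    sup_le (cyclotomicSubfield_mono (dvd_pow_self ℓ (by omega))) (IntermediateField.lift_le B)
  have hfin : FiniteDimensional ℚ
      (cyclotomicSubfield ℓ ⊔ IntermediateField.lift B : IntermediateField ℚ ℂ) :=
    FiniteDimensional.of_injective (IntermediateField.inclusion hle).toLinearMap
      (IntermediateField.inclusion_injective hle)
  have hdvd : ℓ ^ m * (ℓ - 1) ∣ Module.finrank ℚ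
      (cyclotomicSubfield ℓ ⊔ IntermediateField.lift B : IntermediateField ℚ ℂ) := by
    refine Nat.Coprime.mul_dvd_of_dvd_of_dvd
      (Nat.Coprime.pow_left m ((Nat.Prime.coprime_iff_not_dvd hp).mpr hnd)) ?_ ?_
    · rw [← hBr]
      exact IntermediateField.finrank_dvd_of_le_right le_sup_right
    · rw [← Nat.totient_prime hp, ← finrank_cyclotomicSubfield ℓ]
      exact IntermediateField.finrank_dvd_of_le_right le_sup_left
  have heq := IntermediateField.eq_of_le_of_finrank_le hle
    (by rw [hr]; exact Nat.le_of_dvd Module.finrank_pos hdvd)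
  rw [← heq]
  exact sup_le_sup_left hBl _

theorem cyclotomicSubfield_le_of_isPrimitiveRoot {N : ℕ} [NeZero N] {F : IntermediateField ℚ ℂ}
    {ζ : F} (hζ : IsPrimitiveRoot ζ N) : cyclotomicSubfield N ≤ F := by
  have h : IsPrimitiveRoot (ζ : ℂ) N := hζ.map_of_injective (f := F.val) F.val.injective
  rw [cyclotomicSubfield_eq_adjoin h, IntermediateField.adjoin_simple_le_iff]
  exact ζ.2

/-- The shift `c` such that the `n`-th layer of the tower over `L` is `L ℚ_{n+c}`. -/
noncomputable def layerShift (ℓ : ℕ) (L : IntermediateField ℚ ℂ) : ℕ :=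
  padicValNat ℓ (Module.finrank ℚ (L ⊓ rationalTop ℓ : IntermediateField ℚ ℂ))

/-- As `L` contains the `ℓ`-th roots of unity, its layers are obtained by adjoining roots of unity
of order a power of `ℓ`. -/
theorem layer_eq_sup_cyclotomicSubfield {L : IntermediateField ℚ ℂ}
    (hμ : ∃ ζ : L, IsPrimitiveRoot ζ ℓ) (n : ℕ) :
    layer ℓ L n = L ⊔ cyclotomicSubfield (ℓ ^ (n + layerShift ℓ L + 1)) := by
  have : NeZero ℓ := ⟨(Fact.out : ℓ.Prime).ne_zero⟩
  obtain ⟨ζ, hζ⟩ := hμ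
  have h := cyclotomicSubfield_le_of_isPrimitiveRoot hζ
  refine le_antisymm (sup_le_sup_left (rationalLayer_le _ _) L) (sup_le le_sup_left ?_)
  exact (cyclotomicSubfield_le_sup_rationalLayer _).trans (sup_le_sup_right h _)

end PrimePower

/-! ### Complex conjugation and Kummer theory in the tower -/

theorem le_layer (ℓ : ℕ) (L : IntermediateField ℚ ℂ) (n : ℕ) : L ≤ layer ℓ L n := le_sup_left

theorem mem_cyclotomicExtension_iff {ℓ : ℕ} {L : IntermediateField ℚ ℂ} {x : ℂ} :
    x ∈ cyclotomicExtension ℓ L ↔ ∃ n, x ∈ layer ℓ L n := by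
  have h : cyclotomicExtension ℓ L = ⨆ n, layer ℓ L n := by
    refine le_antisymm (sup_le ((le_layer ℓ L 0).trans (le_iSup _ 0)) (iSup_le fun m ↦ ?_))
      (iSup_le fun n ↦ sup_le_sup_left (le_iSup (rationalLayer ℓ) _) L)
    exact (rationalLayer_mono ℓ (Nat.le_add_right m _)).trans
      (le_sup_right.trans (le_iSup (layer ℓ L) m))
  rw [h, ← SetLike.mem_coe, IntermediateField.coe_iSup_of_directed (directed_of_isDirected_le
    fun _ _ h ↦ layer_mono ℓ L h), Set.mem_iUnion]
  rfl

section Layers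

variable {ℓ : ℕ} [Fact ℓ.Prime] {L : IntermediateField ℚ ℂ}

theorem exists_isPrimitiveRoot_layer (hμ : ∃ ζ : L, IsPrimitiveRoot ζ ℓ) (n : ℕ) :
    ∃ ζ : layer ℓ L n, IsPrimitiveRoot ζ (ℓ ^ (n + layerShift ℓ L + 1)) := by
  have hζ := Complex.isPrimitiveRoot_exp (ℓ ^ (n + layerShift ℓ L + 1))
    (pow_ne_zero _ (Fact.out : ℓ.Prime).ne_zero)
  have hmem : Complex.exp (2 * Real.pi * Complex.I / (ℓ ^ (n + layerShift ℓ L + 1) : ℕ)) ∈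
      layer ℓ L n := by
    rw [layer_eq_sup_cyclotomicSubfield hμ]
    exact le_sup_right (a := L) (IntermediateField.subset_adjoin ℚ _ hζ.pow_eq_one)
  exact ⟨⟨_, hmem⟩, hζ.of_map_of_injective (f := (layer ℓ L n).val) (layer ℓ L n).val.injective⟩

/-- A layer is generated by `L` and a root of unity. -/
theorem subfield_layer_eq_top (hμ : ∃ ζ : L, IsPrimitiveRoot ζ ℓ) {n : ℕ}
    (S : Subfield (layer ℓ L n))
    (hL : ∀ x : L, IntermediateField.inclusion (le_layer ℓ L n) x ∈ S)
    {ζ : layer ℓ L n} (hζ : IsPrimitiveRoot ζ (ℓ ^ (n + layerShift ℓ L + 1))) (hζS : ζ ∈ S) :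
    S = ⊤ := by
  have : NeZero ℓ := ⟨(Fact.out : ℓ.Prime).ne_zero⟩
  let T : IntermediateField ℚ ℂ := (S.map (layer ℓ L n).val.toRingHom).toIntermediateField
    fun q ↦ ⟨algebraMap ℚ _ q, by simp, by simp⟩
  have hle : layer ℓ L n ≤ T := by
    rw [layer_eq_sup_cyclotomicSubfield hμ]
    refine sup_le (fun x hx ↦ ⟨_, hL ⟨x, hx⟩, rfl⟩) ?_
    rw [cyclotomicSubfield_eq_adjoin
      (hζ.map_of_injective (f := (layer ℓ L n).val) (layer ℓ L n).val.injective),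
      IntermediateField.adjoin_simple_le_iff]
    exact ⟨ζ, hζS, rfl⟩
  refine top_unique fun x _ ↦ ?_
  obtain ⟨y, hy, hyx⟩ := hle x.2
  rwa [← Subtype.ext hyx]

theorem conj_apply_of_pow_eq_one {K : IntermediateField ℚ ℂ} [ConjStable K] {x : K} {k : ℕ}
    (hk : k ≠ 0) (hx : x ^ k = 1) : conj K x = x⁻¹ := by
  refine Subtype.ext ?_
  have h : (x : ℂ) ^ k = 1 := by simpa using congrArg (Subtype.val) hx
  have hn : ‖(x : ℂ)‖ = 1 := Complex.norm_eq_one_of_pow_eq_one h hk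
  have : (starRingEnd ℂ) (x : ℂ) = (x : ℂ)⁻¹ := by
    rw [Complex.inv_def, Complex.normSq_eq_norm_sq, hn]; simp
  exact this

theorem conj_conj {K : IntermediateField ℚ ℂ} [ConjStable K] (x : K) : conj K (conj K x) = x :=
  Subtype.ext (Complex.conj_conj _)

variable [NumberField L] [IsCMField L]

/-- The layers are CM fields: every complex embedding intertwines the conjugations. -/
theorem embedding_layer_conj (hμ : ∃ ζ : L, IsPrimitiveRoot ζ ℓ) {n : ℕ}
    (φ : layer ℓ L n →+* ℂ) (x : layer ℓ L n) :
    φ (conj (layer ℓ L n) x) = starRingEnd ℂ (φ x) := by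
  obtain ⟨ζ, hζ⟩ := exists_isPrimitiveRoot_layer hμ n
  have hpos : ℓ ^ (n + layerShift ℓ L + 1) ≠ 0 := pow_ne_zero _ (Fact.out : ℓ.Prime).ne_zero
  have h := subfield_layer_eq_top hμ
    (RingHom.eqLocusField (φ.comp (conj (layer ℓ L n))) ((starRingEnd ℂ).comp φ)) ?_ hζ ?_
  · exact (h ▸ Subfield.mem_top x : x ∈ RingHom.eqLocusField _ _)
  · intro x
    have h1 := IsCMField.complexEmbedding_complexConj L L.val.toRingHom x
    have h2 := IsCMField.complexEmbedding_complexConj L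
      (φ.comp (IntermediateField.inclusion (le_layer ℓ L n)).toRingHom) x
    have h3 : conj (layer ℓ L n) (IntermediateField.inclusion (le_layer ℓ L n) x) =
        IntermediateField.inclusion (le_layer ℓ L n) (IsCMField.complexConj L x) :=
      Subtype.ext h1.symm
    change φ (conj _ _) = starRingEnd ℂ (φ _)
    rw [h3]
    exact h2
  · change φ (conj _ _) = starRingEnd ℂ (φ _)
    rw [conj_apply_of_pow_eq_one hpos hζ.pow_eq_one, map_inv₀]
    have h : φ ζ ^ (ℓ ^ (n + layerShift ℓ L + 1)) = 1 := by rw [← map_pow, hζ.pow_eq_one, map_one]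
    have hn := Complex.norm_eq_one_of_pow_eq_one h hpos
    rw [Complex.inv_def, Complex.normSq_eq_norm_sq, hn]; simp

end Layers

/-- A Kummer extension of prime degree: either trivial, or Galois of that degree. -/
theorem kummer_alternative {K M : Type*} [Field K] [Field M] [Algebra K M] [FiniteDimensional K M]
    {ℓ : ℕ} [Fact ℓ.Prime] {ω : K} (hω : IsPrimitiveRoot ω ℓ) {ζ : M} {a : K}
    (ha : ζ ^ ℓ = algebraMap K M a) (htop : IntermediateField.adjoin K {ζ} = ⊤)
    (hζ : ζ ∉ (algebraMap K M).range) : IsGalois K M ∧ Module.finrank K M = ℓ := by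
  have hp : ℓ.Prime := Fact.out
  have hne : (primitiveRoots ℓ K).Nonempty := ⟨ω, (mem_primitiveRoots hp.pos).mpr hω⟩
  have hirr : Irreducible (Polynomial.X ^ ℓ - Polynomial.C a) := by
    refine X_pow_sub_C_irreducible_of_prime hp fun b hb ↦ hζ ?_
    have hb' : (algebraMap K M b) ^ ℓ = ζ ^ ℓ := by rw [← map_pow, hb, ha]
    by_cases hb0 : b = 0
    · rw [hb0, map_zero, zero_pow hp.ne_zero] at hb'
      rw [pow_eq_zero_iff hp.ne_zero |>.mp hb'.symm]
      exact zero_mem _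
    · have hb1 : algebraMap K M b ≠ 0 := by simpa using hb0
      have : NeZero ℓ := ⟨hp.ne_zero⟩
      obtain ⟨i, -, hi⟩ := (hω.map_of_injective (algebraMap K M).injective).eq_pow_of_pow_eq_one
        (show (ζ / algebraMap K M b) ^ ℓ = 1 by
          rw [div_pow, hb', div_self]; rw [← hb']; exact pow_ne_zero _ hb1)
      refine ⟨ω ^ i * b, ?_⟩
      rw [map_mul, map_pow, hi, div_mul_cancel₀ _ hb1]
  have hfr : Module.finrank K M = ℓ := by
    have hint : IsIntegral K ζ := Algebra.IsIntegral.isIntegral ζ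
    have := IntermediateField.adjoin.finrank hint
    rw [htop, IntermediateField.finrank_top',
      ← minpoly.eq_of_irreducible_of_monic hirr (by simp [ha])
        (Polynomial.monic_X_pow_sub_C a hp.ne_zero), Polynomial.natDegree_X_pow_sub_C] at this
    exact this
  have hspl := isSplittingField_X_pow_sub_C_of_root_adjoin_eq_top (K := K) (L := M)
    (by rwa [hfr]) (a := a) (α := ζ) (by rwa [hfr]) htop
  rw [hfr] at hspl
  exact ⟨isGalois_of_isSplittingField_X_pow_sub_C hne hirr M, hfr⟩

/-- A generator of the Galois group of a Galois extension of prime degree. -/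
theorem exists_automorphism_of_prime_degree {K M : Type*} [Field K] [Field M] [Algebra K M]
    [FiniteDimensional K M] [IsGalois K M] {ℓ : ℕ} [Fact ℓ.Prime]
    (h : Module.finrank K M = ℓ) :
    ∃ σ : M ≃ₐ[K] M, σ ^ ℓ = 1 ∧ ∀ x, σ x = x → x ∈ (algebraMap K M).range := by
  have hp : ℓ.Prime := Fact.out
  have hc : Nat.card Gal(M/K) = ℓ := by rw [IsGalois.card_aut_eq_finrank, h]
  have := isCyclic_of_prime_card hc
  obtain ⟨σ, hσ⟩ := IsCyclic.exists_generator (α := Gal(M/K))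
  refine ⟨σ, by rw [← hc]; exact pow_card_eq_one', fun x hx ↦ ?_⟩
  have := (IsGalois.mem_bot_iff_fixed (F := K) x).mpr fun τ ↦ ?_
  · simpa [IntermediateField.mem_bot] using this
  · obtain ⟨i, rfl⟩ := Subgroup.mem_zpowers_iff.mp (hσ τ)
    have hz : (σ ^ i : Gal(M/K)) ∈ MulAction.stabilizer Gal(M/K) x :=
      zpow_mem (show σ ∈ MulAction.stabilizer Gal(M/K) x from hx) i
    exact hz

/-- A step of the tower is trivial, or cyclic of degree `ℓ`. -/
theorem kummer_step {K M : Type*} [Field K] [NumberField K] [Field M] [NumberField M]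
    (f : K →+* M) {ℓ : ℕ} [Fact ℓ.Prime] {ω : K} (hω : IsPrimitiveRoot ω ℓ) {ζ : M}
    (ha : ζ ^ ℓ ∈ f.range) (htop : ∀ S : Subfield M, f.fieldRange ≤ S → ζ ∈ S → S = ⊤) :
    Function.Surjective f ∨ (∃ σ : M ≃+* M, σ ^ ℓ = 1 ∧ (∀ x, σ (f x) = f x) ∧
      ∀ x, σ x = x → x ∈ f.range) ∧ Module.finrank ℚ M = ℓ * Module.finrank ℚ K := by
  by_cases hζ : ζ ∈ f.range
  · left
    have := htop f.fieldRange le_rfl hζ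
    exact fun x ↦ (this ▸ Subfield.mem_top x : x ∈ f.fieldRange)
  · right
    let : Algebra K M := f.toAlgebra
    have hf : FiniteDimensional K M := Module.Finite.of_restrictScalars_finite ℚ K M
    obtain ⟨a, ha⟩ := ha
    obtain ⟨hG, hr⟩ := kummer_alternative hω (a := a) ha.symm
      (IntermediateField.toSubfield_injective
        (htop _ (fun x ⟨y, hy⟩ ↦ hy ▸ IntermediateField.algebraMap_mem _ y)
          (IntermediateField.mem_adjoin_simple_self K ζ))) hζ
    refine ⟨?_, by rw [← Module.finrank_mul_finrank ℚ K M, hr, mul_comm]⟩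
    obtain ⟨σ, h1, h2⟩ := exists_automorphism_of_prime_degree hr
    have hpow (k : ℕ) (x : M) : ((σ : M ≃+* M) ^ k) x = (σ ^ k) x := by
      induction k generalizing x with
      | zero => rfl
      | succ k ih => rw [pow_succ, pow_succ]; exact ih _
    refine ⟨σ, ?_, fun x ↦ σ.commutes x, h2⟩
    ext x
    rw [hpow, h1]; rfl

theorem exists_isPrimitiveRoot_prime_layer {ℓ : ℕ} {L : IntermediateField ℚ ℂ}
    (hμ : ∃ ζ : L, IsPrimitiveRoot ζ ℓ) (n : ℕ) : ∃ ω : layer ℓ L n, IsPrimitiveRoot ω ℓ := by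
  obtain ⟨ω, hω⟩ := hμ
  exact ⟨_, hω.map_of_injective
    (IntermediateField.inclusion_injective (le_layer ℓ L n))⟩

section Layers

variable {ℓ : ℕ} [Fact ℓ.Prime] {L : IntermediateField ℚ ℂ}

/-- The step from `L_n` to `L_{n+1}` adjoins an `ℓ`-th root of a root of unity. -/
theorem layer_step (hμ : ∃ ζ : L, IsPrimitiveRoot ζ ℓ) (n : ℕ) {ζ : layer ℓ L (n + 1)}
    (hζ : IsPrimitiveRoot ζ (ℓ ^ (n + 1 + layerShift ℓ L + 1))) :
    ζ ^ ℓ ∈ (incl ℓ L (Nat.le_succ n)).range ∧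
      ∀ S : Subfield (layer ℓ L (n + 1)), (incl ℓ L (Nat.le_succ n)).fieldRange ≤ S →
        ζ ∈ S → S = ⊤ := by
  have : NeZero ℓ := ⟨(Fact.out : ℓ.Prime).ne_zero⟩
  constructor
  · obtain ⟨η, hη⟩ := exists_isPrimitiveRoot_layer hμ n
    have hη' := hη.map_of_injective (incl ℓ L (Nat.le_succ n)).injective
    obtain ⟨i, -, hi⟩ := hη'.eq_pow_of_pow_eq_one (ξ := ζ ^ ℓ) (by
      rw [← pow_mul, ← pow_succ', ← hζ.pow_eq_one]; congr 2; omega)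
    exact ⟨η ^ i, by rw [map_pow, hi]⟩
  · exact fun S hS hζS ↦ subfield_layer_eq_top hμ S (fun x ↦ hS
      ⟨IntermediateField.inclusion (le_layer ℓ L n) x, rfl⟩) hζ hζS

theorem totient_dvd_finrank_layer (hμ : ∃ ζ : L, IsPrimitiveRoot ζ ℓ) (n : ℕ) :
    (ℓ ^ (n + layerShift ℓ L + 1)).totient ∣ Module.finrank ℚ (layer ℓ L n) := by
  have : NeZero ℓ := ⟨(Fact.out : ℓ.Prime).ne_zero⟩
  obtain ⟨ζ, hζ⟩ := exists_isPrimitiveRoot_layer hμ n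
  rw [← finrank_cyclotomicSubfield]
  exact IntermediateField.finrank_dvd_of_le_right (cyclotomicSubfield_le_of_isPrimitiveRoot hζ)

variable [NumberField L]

theorem layer_succ_alternative (hμ : ∃ ζ : L, IsPrimitiveRoot ζ ℓ) (n : ℕ) :
    Function.Surjective (incl ℓ L (Nat.le_succ n)) ∨ (∃ σ : layer ℓ L (n + 1) ≃+* layer ℓ L (n + 1),
      σ ^ ℓ = 1 ∧ (∀ x, σ (incl ℓ L (Nat.le_succ n) x) = incl ℓ L (Nat.le_succ n) x) ∧
      ∀ x, σ x = x → x ∈ (incl ℓ L (Nat.le_succ n)).range) ∧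
      Module.finrank ℚ (layer ℓ L (n + 1)) = ℓ * Module.finrank ℚ (layer ℓ L n) := by
  obtain ⟨ζ, hζ⟩ := exists_isPrimitiveRoot_layer hμ (n + 1)
  obtain ⟨ω, hω⟩ := exists_isPrimitiveRoot_prime_layer hμ n
  obtain ⟨h1, h2⟩ := layer_step hμ n hζ
  exact kummer_step _ hω h1 h2

theorem finrank_layer_succ_le (hμ : ∃ ζ : L, IsPrimitiveRoot ζ ℓ) (n : ℕ) :
    Module.finrank ℚ (layer ℓ L (n + 1)) ≤ ℓ * Module.finrank ℚ (layer ℓ L n) := by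
  rcases layer_succ_alternative hμ n with h | h
  · have e := (RingEquiv.ofBijective _ ⟨(incl ℓ L (Nat.le_succ n)).injective, h⟩).toAddEquiv
    have : Module.finrank ℚ (layer ℓ L n) = Module.finrank ℚ (layer ℓ L (n + 1)) :=
      LinearEquiv.finrank_eq { e with map_smul' := fun q x ↦ map_rat_smul e q x }
    rw [← this]
    exact Nat.le_mul_of_pos_left _ (Fact.out : ℓ.Prime).pos
  · exact h.2.le

theorem finrank_layer_le (hμ : ∃ ζ : L, IsPrimitiveRoot ζ ℓ) (n k : ℕ) :
    Module.finrank ℚ (layer ℓ L (n + k)) ≤ ℓ ^ k * Module.finrank ℚ (layer ℓ L n) := by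
  induction k with
  | zero => simp
  | succ k ih =>
    refine (finrank_layer_succ_le hμ (n + k)).trans ?_
    rw [pow_succ', mul_assoc]
    exact Nat.mul_le_mul_left _ ih

end Layers

/-! ### Degrees of the layers -/

theorem exists_forall_ge_eq_of_monotone {u : ℕ → ℕ} (hu : Monotone u) {B : ℕ} (hB : ∀ n, u n ≤ B) :
    ∃ N, ∀ n, N ≤ n → u n = u N := by
  have hfin : (Set.range u).Finite := (Set.finite_Iic B).subset (by rintro _ ⟨n, rfl⟩; exact hB n)
  obtain ⟨_, ⟨N, rfl⟩, hN⟩ := hfin.exists_maximal (Set.range_nonempty u)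
  exact ⟨N, fun n hn ↦ le_antisymm (hN ⟨n, rfl⟩ (hu hn)) (hu hn)⟩

theorem exists_forall_ge_eq_of_antitone {u : ℕ → ℕ} (hu : Antitone u) :
    ∃ N, ∀ n, N ≤ n → u n = u N := by
  obtain ⟨N, hN⟩ := exists_forall_ge_eq_of_monotone (u := fun n ↦ u 0 - u n)
    (fun m n h ↦ Nat.sub_le_sub_left (hu h) _) (fun n ↦ Nat.sub_le _ _)
  refine ⟨N, fun n hn ↦ ?_⟩
  have h : u 0 - u n = u 0 - u N := hN n hn
  have h1 := hu (Nat.zero_le n)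
  have h2 := hu (Nat.zero_le N)
  omega

/-- From some layer on, the degree is multiplied by `ℓ` at each step. -/
theorem exists_finrank_layer_eq {ℓ : ℕ} [Fact ℓ.Prime] {L : IntermediateField ℚ ℂ} [NumberField L]
    (hμ : ∃ ζ : L, IsPrimitiveRoot ζ ℓ) :
    ∃ N, ∀ n, N ≤ n → ∀ k, Module.finrank ℚ (layer ℓ L (n + k)) =
      ℓ ^ k * Module.finrank ℚ (layer ℓ L n) := by
  have hp : ℓ.Prime := Fact.out
  choose s hs using totient_dvd_finrank_layer hμ
  have ht (n k : ℕ) : (ℓ ^ (n + k + layerShift ℓ L + 1)).totient =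
      ℓ ^ k * (ℓ ^ (n + layerShift ℓ L + 1)).totient := by
    rw [Nat.totient_prime_pow_succ hp, Nat.totient_prime_pow_succ hp, ← mul_assoc, ← pow_add]
    congr 2; omega
  have hpos (n : ℕ) : 0 < (ℓ ^ (n + layerShift ℓ L + 1)).totient :=
    Nat.totient_pos.mpr (pow_pos hp.pos _)
  have hanti : Antitone s := antitone_nat_of_succ_le fun n ↦ by
    have h := finrank_layer_succ_le hμ n
    rw [hs, hs, ht n 1, pow_one, mul_assoc] at h
    exact Nat.le_of_mul_le_mul_left (Nat.le_of_mul_le_mul_left h hp.pos) (hpos n)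
  obtain ⟨N, hN⟩ := exists_forall_ge_eq_of_antitone hanti
  refine ⟨N, fun n hn k ↦ ?_⟩
  rw [hs, hs, ht, hN n hn, hN (n + k) (by omega), mul_assoc]

/-! ### Primes and norms in an extension of number fields -/

section Extension

variable {K M : Type*} [Field K] [Field M] (f : K →+* M)

theorem exists_comap_eq (v : HeightOneSpectrum (𝓞 K)) : ∃ w : HeightOneSpectrum (𝓞 M),
    w.asIdeal.comap (RingOfIntegers.mapRingHom f) = v.asIdeal := by
  let : Algebra K M := f.toAlgebra
  obtain ⟨Q, -, hQ, hQv⟩ := Ideal.exists_ideal_over_prime_of_isIntegral (S := 𝓞 M) v.asIdeal ⊥ (by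
    rw [Ideal.comap_bot_of_injective _ (FaithfulSMul.algebraMap_injective (𝓞 K) (𝓞 M))]
    exact bot_le)
  refine ⟨⟨Q, hQ, ?_⟩, hQv⟩
  rintro rfl
  rw [Ideal.comap_bot_of_injective _ (FaithfulSMul.algebraMap_injective (𝓞 K) (𝓞 M))] at hQv
  exact v.ne_bot hQv.symm

theorem exists_eq_comap (w : HeightOneSpectrum (𝓞 M)) : ∃ v : HeightOneSpectrum (𝓞 K),
    w.asIdeal.comap (RingOfIntegers.mapRingHom f) = v.asIdeal := by
  let : Algebra K M := f.toAlgebra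
  exact ⟨w.under (𝓞 K), rfl⟩

theorem map_ne_bot {I : Ideal (𝓞 K)} (hI : I ≠ ⊥) :
    I.map (RingOfIntegers.mapRingHom f) ≠ ⊥ :=
  (Ideal.map_eq_bot_iff_of_injective (mapRingHom_injective f)).not.mpr hI

variable [NumberField K]

theorem map_le_iff_of_prime {v : HeightOneSpectrum (𝓞 K)} {w : HeightOneSpectrum (𝓞 M)} :
    v.asIdeal.map (RingOfIntegers.mapRingHom f) ≤ w.asIdeal ↔
      w.asIdeal.comap (RingOfIntegers.mapRingHom f) = v.asIdeal := by
  rw [Ideal.map_le_iff_le_comap]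
  refine ⟨fun h ↦ ?_, fun h ↦ h.ge⟩
  obtain ⟨v', hv'⟩ := exists_eq_comap f w
  rw [hv'] at h ⊢
  exact (v.isMaximal.eq_of_le v'.isPrime.ne_top h).symm

variable [NumberField M]

theorem mem_placesAbove_iff_of_comap {ℓ : ℕ} {v : HeightOneSpectrum (𝓞 K)}
    {w : HeightOneSpectrum (𝓞 M)} (h : w.asIdeal.comap (RingOfIntegers.mapRingHom f) = v.asIdeal) :
    v ∈ placesAbove ℓ K ↔ w ∈ placesAbove ℓ M := by
  change (ℓ : 𝓞 K) ∈ v.asIdeal ↔ (ℓ : 𝓞 M) ∈ w.asIdeal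
  rw [← h, Ideal.mem_comap, map_natCast]

theorem finite_placesAbove {ℓ : ℕ} (hℓ : ℓ ≠ 0) (K : Type*) [Field K] [NumberField K] :
    (placesAbove ℓ K).Finite := by
  have h0 : Ideal.span {(ℓ : 𝓞 K)} ≠ 0 := by simpa using hℓ
  refine (Ideal.finite_factors h0).subset fun v hv ↦ ?_
  rw [Set.mem_ofPred_eq, Ideal.dvd_span_singleton]
  exact hv

theorem absNorm_map_pow {D : ℕ} (hD : Module.finrank ℚ M = D * Module.finrank ℚ K)
    (I : Ideal (𝓞 K)) :
    Ideal.absNorm (I.map (RingOfIntegers.mapRingHom f)) = Ideal.absNorm I ^ D := by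
  let : Algebra K M := f.toAlgebra
  have h := Ideal.absNorm_algebraMap (𝓞 K) (𝓞 M) I
  have h2 : Module.finrank (𝓞 K) (𝓞 M) = D := by
    rw [← IsFractionRing.finrank_eq (𝓞 K) K (𝓞 M) M]
    have := Module.finrank_mul_finrank ℚ K M
    rw [hD, mul_comm] at this
    exact Nat.eq_of_mul_eq_mul_right Module.finrank_pos this
  rw [h2] at h
  exact h

theorem absNorm_le_of_comap {v : HeightOneSpectrum (𝓞 K)}
    {w : HeightOneSpectrum (𝓞 M)} (h : w.asIdeal.comap (RingOfIntegers.mapRingHom f) = v.asIdeal) :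
    Ideal.absNorm v.asIdeal ≤ Ideal.absNorm w.asIdeal := by
  have hw : Finite (𝓞 M ⧸ w.asIdeal) := Ideal.finiteQuotientOfFreeOfNeBot _ w.ne_bot
  rw [Ideal.absNorm_apply, Ideal.absNorm_apply, Submodule.cardQuot_apply, Submodule.cardQuot_apply]
  exact Nat.card_le_card_of_injective
    (Ideal.quotientMap w.asIdeal (RingOfIntegers.mapRingHom f) h.ge)
    (Ideal.quotientMap_injective' h.le)

theorem one_lt_absNorm (v : HeightOneSpectrum (𝓞 K)) : 1 < Ideal.absNorm v.asIdeal := by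
  have h0 : Ideal.absNorm v.asIdeal ≠ 0 := by simpa [Ideal.absNorm_eq_zero_iff] using v.ne_bot
  have h1 : Ideal.absNorm v.asIdeal ≠ 1 := by
    simpa [Ideal.absNorm_eq_one_iff] using v.isPrime.ne_top
  omega

theorem eq_pow_of_forall_dvd {I : Ideal (𝓞 K)} (hI : I ≠ ⊥) {w : HeightOneSpectrum (𝓞 K)}
    (h : ∀ v : HeightOneSpectrum (𝓞 K), I ≤ v.asIdeal → v = w) : ∃ e, I = w.asIdeal ^ e := by
  induction I using UniqueFactorizationMonoid.induction_on_prime with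
  | h₁ => exact absurd rfl hI
  | h₂ I hu =>
    exact ⟨0, by rw [pow_zero]; exact (Ideal.isUnit_iff.mp hu).trans Ideal.one_eq_top.symm⟩
  | h₃ I P hI0 hP ih =>
    obtain ⟨e, he⟩ := ih hI0 fun v hv ↦ h v (Ideal.mul_le_right.trans hv)
    have hPw := h ⟨P, Ideal.isPrime_of_prime hP, hP.ne_zero⟩ Ideal.mul_le_left
    exact ⟨e + 1, by rw [he, pow_succ', ← hPw]⟩

/-- The product of the absolute norms of the places above `ℓ`. -/
noncomputable def normProd {ℓ : ℕ} (hℓ : ℓ ≠ 0) (K : Type*) [Field K] [NumberField K] : ℕ :=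
  ∏ v ∈ (finite_placesAbove hℓ K).toFinset, Ideal.absNorm v.asIdeal

/-- The product of the norms of the places above `ℓ` increases from `K` to `M`, and it is the same
only if above each place of `K` dividing `ℓ` there is a single place of `M`, of the same norm. -/
theorem normProd_mono_and {ℓ : ℕ} (hℓ : ℓ ≠ 0) : normProd hℓ K ≤ normProd hℓ M ∧
    (normProd hℓ M ≤ normProd hℓ K → ∀ v ∈ placesAbove ℓ K, ∃ w : HeightOneSpectrum (𝓞 M),
      Ideal.absNorm w.asIdeal = Ideal.absNorm v.asIdeal ∧
      ∀ w' : HeightOneSpectrum (𝓞 M),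
        w'.asIdeal.comap (RingOfIntegers.mapRingHom f) = v.asIdeal → w' = w) := by
  classical
  -- Compare `K` to the places of `M` in the image of a section of the contraction.
  choose g hg using exists_comap_eq f
  have hinj : Function.Injective g := fun v v' h ↦ HeightOneSpectrum.ext (by rw [← hg, ← hg, h])
  set S := (finite_placesAbove hℓ K).toFinset with hS
  set T := (finite_placesAbove hℓ M).toFinset with hT
  have hST : S.image g ⊆ T := by
    intro w hw
    obtain ⟨v, hv, rfl⟩ := Finset.mem_image.mp hw
    simp only [hT, hS, Set.Finite.mem_toFinset] at hv ⊢
    exact (mem_placesAbove_iff_of_comap f (hg v)).mp hv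
  have hle1 : normProd hℓ K ≤ ∏ v ∈ S, Ideal.absNorm (g v).asIdeal :=
    Finset.prod_le_prod' fun v _ ↦ absNorm_le_of_comap f (hg v)
  have himg : ∏ w ∈ S.image g, Ideal.absNorm w.asIdeal = ∏ v ∈ S, Ideal.absNorm (g v).asIdeal :=
    Finset.prod_image hinj.injOn
  have hle2 : ∏ v ∈ S, Ideal.absNorm (g v).asIdeal ≤ normProd hℓ M := by
    rw [← himg]
    exact Finset.prod_le_prod_of_subset_of_one_le' hST fun w _ _ ↦ (one_lt_absNorm w).le
  refine ⟨hle1.trans hle2, fun h v hv ↦ ⟨g v, ?_, ?_⟩⟩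
  · by_contra hne
    have hlt : Ideal.absNorm v.asIdeal < Ideal.absNorm (g v).asIdeal :=
      lt_of_le_of_ne (absNorm_le_of_comap f (hg v)) (Ne.symm hne)
    have := Finset.prod_lt_prod (s := S)
      (fun v _ ↦ (one_lt_absNorm v).trans_le' zero_le_one) (fun v _ ↦ absNorm_le_of_comap f (hg v))
      ⟨v, (Set.Finite.mem_toFinset _).mpr hv, hlt⟩
    exact absurd (hle2.trans h) (not_le.mpr this)
  · intro w' hw'
    by_contra hne
    have hw'T : w' ∈ T := (Set.Finite.mem_toFinset _).mpr
      ((mem_placesAbove_iff_of_comap f hw').mp hv)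
    have hw'S : w' ∉ S.image g := by
      intro hmem
      obtain ⟨v', -, rfl⟩ := Finset.mem_image.mp hmem
      rw [hg v'] at hw'
      exact hne (congrArg g (HeightOneSpectrum.ext hw'))
    have := Finset.prod_le_prod_of_subset_of_one_le'
      (Finset.insert_subset hw'T hST) fun w _ _ ↦ (one_lt_absNorm w).le
    rw [Finset.prod_insert hw'S, himg] at this
    have h0 : 0 < ∏ v ∈ S, Ideal.absNorm (g v).asIdeal :=
      Finset.prod_pos fun v _ ↦ (one_lt_absNorm _).trans_le' zero_le_one
    have h1 := this.trans (h.trans hle1)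
    nlinarith [one_lt_absNorm w']

/-- If the norms of the places above `ℓ` do not grow from `K` to `M`, then these places are totally
ramified. -/
theorem exists_map_eq_pow_of_normProd_le {ℓ : ℕ} (hℓ : ℓ ≠ 0)
    (h : normProd hℓ M ≤ normProd hℓ K) {D : ℕ}
    (hD : Module.finrank ℚ M = D * Module.finrank ℚ K) (v : HeightOneSpectrum (𝓞 K))
    (hv : v ∈ placesAbove ℓ K) : ∃ w : HeightOneSpectrum (𝓞 M),
      v.asIdeal.map (RingOfIntegers.mapRingHom f) = w.asIdeal ^ D := by
  obtain ⟨w, hwn, hw⟩ := (normProd_mono_and f hℓ).2 h v hv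
  obtain ⟨e, he⟩ := eq_pow_of_forall_dvd (w := w) (map_ne_bot f v.ne_bot)
    fun w' hw' ↦ hw w' ((map_le_iff_of_prime f).mp hw')
  have := absNorm_map_pow f hD v.asIdeal
  rw [he, map_pow, hwn] at this
  exact ⟨w, by rw [he, Nat.pow_right_injective (one_lt_absNorm v) this]⟩

end Extension

/-- A place above `ℓ` of a field with the roots of unity of order `ℓ^(k+1)` is ramified to order at
least `φ(ℓ^(k+1))`: `ℓ` is the product of the `1 - μ`, for `μ` the primitive roots, which are
associated to each other. -/
theorem pow_totient_dvd_span {K : Type*} [Field K] [NumberField K] {ℓ k : ℕ} [Fact ℓ.Prime]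
    {ζ : K} (hζ : IsPrimitiveRoot ζ (ℓ ^ (k + 1))) {v : HeightOneSpectrum (𝓞 K)}
    (hv : v ∈ placesAbove ℓ K) :
    v.asIdeal ^ (ℓ ^ (k + 1)).totient ∣ Ideal.span {(ℓ : 𝓞 K)} := by
  have hp : ℓ.Prime := Fact.out
  have : NeZero (ℓ ^ (k + 1)) := ⟨pow_ne_zero _ hp.ne_zero⟩
  have hη := hζ.toInteger_isPrimitiveRoot
  have hprod : (ℓ : 𝓞 K) = ∏ μ ∈ primitiveRoots (ℓ ^ (k + 1)) (𝓞 K), (1 - μ) := by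
    have h1 := Polynomial.eval_one_cyclotomic_prime_pow (R := 𝓞 K) (p := ℓ) k
    rw [Polynomial.cyclotomic_eq_prod_X_sub_primitiveRoots hη, Polynomial.eval_prod] at h1
    simpa using h1.symm
  rw [Ideal.dvd_span_singleton, ← hη.card_primitiveRoots]
  have hv' : (ℓ : 𝓞 K) ∈ v.asIdeal := hv
  rw [hprod] at hv' ⊢
  obtain ⟨μ, hμ, hμv⟩ := v.isPrime.prod_mem_iff.mp hv'
  rw [← Finset.prod_const]
  refine Ideal.prod_mem_prod fun μ' hμ' ↦ ?_
  rw [mem_primitiveRoots (NeZero.pos _)] at hμ hμ'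
  obtain ⟨i, -, rfl⟩ := hμ.eq_pow_of_pow_eq_one hμ'.pow_eq_one
  exact v.asIdeal.mem_of_dvd (by simpa using sub_dvd_pow_sub_pow 1 μ i) hμv

theorem normProd_pow_le {K : Type*} [Field K] [NumberField K] {ℓ k : ℕ} [Fact ℓ.Prime]
    (hℓ : ℓ ≠ 0) {ζ : K} (hζ : IsPrimitiveRoot ζ (ℓ ^ (k + 1))) :
    normProd hℓ K ^ (ℓ ^ (k + 1)).totient ≤ ℓ ^ Module.finrank ℚ K := by
  have hdvd : ∏ v ∈ (finite_placesAbove hℓ K).toFinset, v.asIdeal ^ (ℓ ^ (k + 1)).totient ∣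
      Ideal.span {(ℓ : 𝓞 K)} := by
    refine Finset.prod_dvd_of_coprime (fun v _ v' _ hne ↦ ?_) fun v hv ↦
      pow_totient_dvd_span hζ ((Set.Finite.mem_toFinset _).mp hv)
    have := v.isMaximal
    have := v'.isMaximal
    exact IsCoprime.pow (Ideal.isCoprime_of_isMaximal fun h ↦ hne (HeightOneSpectrum.ext h))
  have h2 := map_dvd Ideal.absNorm hdvd
  have h3 : Ideal.absNorm (Ideal.span {(ℓ : 𝓞 K)}) = ℓ ^ Module.finrank ℚ K := by
    rw [← RingOfIntegers.rank K]
    exact Ideal.absNorm_span_natCast ℓ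
  rw [h3, map_prod] at h2
  simp only [map_pow, Finset.prod_pow] at h2
  exact Nat.le_of_dvd (pow_pos (Nat.pos_of_ne_zero hℓ) _) h2

/-- In the cyclotomic tower the places above `ℓ` are totally ramified from some layer on. -/
theorem exists_totallyRamifiedFrom {ℓ : ℕ} [Fact ℓ.Prime] {L : IntermediateField ℚ ℂ}
    [NumberField L] (hμ : ∃ ζ : L, IsPrimitiveRoot ζ ℓ) : ∃ n₀, TotallyRamifiedFrom ℓ L n₀ := by
  have hp : ℓ.Prime := Fact.out
  have hℓ := hp.ne_zero
  obtain ⟨N, hN⟩ := exists_finrank_layer_eq hμ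
  have hmono : Monotone fun n ↦ normProd hℓ (layer ℓ L n) :=
    monotone_nat_of_le_succ fun n ↦ (normProd_mono_and (incl ℓ L (Nat.le_succ n)) hℓ).1
  obtain ⟨N', hN'⟩ := exists_forall_ge_eq_of_monotone hmono
    (B := ℓ ^ Module.finrank ℚ (layer ℓ L 0)) fun n ↦ by
      obtain ⟨ζ, hζ⟩ := exists_isPrimitiveRoot_layer hμ n
      have h1 := normProd_pow_le hℓ hζ
      have h2 := finrank_layer_le hμ 0 n
      rw [zero_add] at h2
      have h0 : normProd hℓ (layer ℓ L n) ≠ 0 := Finset.prod_ne_zero_iff.mpr fun v _ ↦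
        (one_lt_absNorm v).ne_bot
      have h3 : ℓ ^ n ≤ (ℓ ^ (n + layerShift ℓ L + 1)).totient := by
        rw [Nat.totient_prime_pow_succ hp]
        exact (Nat.pow_le_pow_right hp.pos (by omega)).trans
          (Nat.le_mul_of_pos_right _ (Nat.sub_pos_of_lt hp.one_lt))
      refine le_of_pow_le_pow_left₀ (pow_ne_zero n hℓ) (Nat.zero_le _) ?_
      calc _ ≤ _ := Nat.pow_le_pow_right (Nat.pos_of_ne_zero h0) h3
        _ ≤ _ := h1
        _ ≤ ℓ ^ (ℓ ^ n * Module.finrank ℚ (layer ℓ L 0)) := Nat.pow_le_pow_right hp.pos h2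
        _ = _ := by rw [mul_comm, pow_mul]
  -- From `max N N'` on, the norms are constant and the degree is multiplied by `ℓ` at each step.
  refine ⟨max N N', fun m h v hv ↦ ?_⟩
  refine exists_map_eq_pow_of_normProd_le (incl ℓ L h) hℓ ?_ ?_ v hv
  · exact ((hN' m ((le_max_right _ _).trans h)).trans (hN' _ (le_max_right _ _)).symm).le
  · have := hN (max N N') (le_max_left _ _) (m - max N N')
    rwa [Nat.add_sub_cancel' h] at this

/-! ### Divisors -/

section Divisors

theorem valuation_eq_exp_neg_count {R K : Type*} [CommRing R] [IsDedekindDomain R] [Field K]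
    [Algebra R K] [IsFractionRing R K] (v : HeightOneSpectrum R) {x : K} (hx : x ≠ 0) :
    v.valuation K x =
      WithZero.exp (-(FractionalIdeal.count K v (FractionalIdeal.spanSingleton R⁰ x))) := by
  classical
  obtain ⟨n, d, rfl⟩ := IsLocalization.exists_mk'_eq R⁰ x
  have hd : (d : R) ≠ 0 := nonZeroDivisors.ne_zero d.2
  have hn : n ≠ 0 := by
    rintro rfl
    exact hx (IsLocalization.mk'_zero d)
  have h := FractionalIdeal.count_well_defined K v (I := FractionalIdeal.spanSingleton R⁰
    (IsLocalization.mk' K n d)) (a := d) (J := Ideal.span {n})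
    (FractionalIdeal.spanSingleton_ne_zero_iff.mpr hx) (by
      rw [FractionalIdeal.coeIdeal_span_singleton, FractionalIdeal.spanSingleton_mul_spanSingleton,
        IsFractionRing.mk'_eq_div, div_eq_inv_mul])
  rw [h, HeightOneSpectrum.valuation_of_mk', v.intValuation_if_neg hn, v.intValuation_if_neg hd,
    ← WithZero.exp_sub]
  congr 1
  ring

variable {K M : Type*} [Field K] [NumberField K] [Field M] [NumberField M]

/-- The exponent of a place in a divisor. -/
noncomputable def ord (v : HeightOneSpectrum (𝓞 K)) (D : Divisors K) : ℤ :=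
  FractionalIdeal.count K v D

theorem ord_mul (v : HeightOneSpectrum (𝓞 K)) (D E : Divisors K) :
    ord v (D * E) = ord v D + ord v E :=
  FractionalIdeal.count_mul K v D.ne_zero E.ne_zero

theorem ord_one (v : HeightOneSpectrum (𝓞 K)) : ord v (1 : Divisors K) = 0 :=
  FractionalIdeal.count_one K v

theorem ord_inv (v : HeightOneSpectrum (𝓞 K)) (D : Divisors K) : ord v D⁻¹ = -ord v D := by
  rw [eq_neg_iff_add_eq_zero, ← ord_mul, inv_mul_cancel, ord_one]

theorem ord_zpow (v : HeightOneSpectrum (𝓞 K)) (D : Divisors K) (n : ℤ) :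
    ord v (D ^ n) = n * ord v D := by
  rw [ord, Units.val_zpow_eq_zpow_val, FractionalIdeal.count_zpow]; rfl

theorem ord_prod {ι : Type*} (s : Finset ι) (v : HeightOneSpectrum (𝓞 K)) (D : ι → Divisors K) :
    ord v (∏ i ∈ s, D i) = ∑ i ∈ s, ord v (D i) := by
  classical
  induction s using Finset.induction_on with
  | empty => exact ord_one v
  | insert i s hi ih => rw [Finset.prod_insert hi, Finset.sum_insert hi, ord_mul, ih]

theorem divisors_ext {D E : Divisors K} (h : ∀ v, ord v D = ord v E) : D = E := by
  refine Units.ext ?_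
  rw [← FractionalIdeal.finprod_heightOneSpectrum_factorization' K D.ne_zero,
    ← FractionalIdeal.finprod_heightOneSpectrum_factorization' K E.ne_zero]
  exact finprod_congr fun v ↦ congrArg _ (h v)

/-- A place, as a divisor. -/
noncomputable def primeDivisor (v : HeightOneSpectrum (𝓞 K)) : Divisors K :=
  FractionalIdeal.mk0 K ⟨v.asIdeal, mem_nonZeroDivisors_iff_ne_zero.mpr v.ne_bot⟩

theorem ord_primeDivisor_self (v : HeightOneSpectrum (𝓞 K)) : ord v (primeDivisor v) = 1 :=
  FractionalIdeal.count_self K v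

theorem ord_primeDivisor_of_ne {v w : HeightOneSpectrum (𝓞 K)} (h : w ≠ v) :
    ord v (primeDivisor w) = 0 :=
  FractionalIdeal.count_maximal_coprime K v h

/-- The divisor with prescribed exponents at a finite family of places. -/
noncomputable def divOf {ι : Type*} [Fintype ι] (W : ι → HeightOneSpectrum (𝓞 K)) (a : ι → ℤ) :
    Divisors K := ∏ i, primeDivisor (W i) ^ a i

section divOf

variable {ι : Type*} [Fintype ι] {W : ι → HeightOneSpectrum (𝓞 K)}

theorem ord_divOf (hW : Function.Injective W) (a : ι → ℤ) (j : ι) :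
    ord (W j) (divOf W a) = a j := by
  rw [divOf, ord_prod, Finset.sum_eq_single j]
  · rw [ord_zpow, ord_primeDivisor_self, mul_one]
  · exact fun i _ hi ↦ by rw [ord_zpow, ord_primeDivisor_of_ne (hW.ne hi), mul_zero]
  · exact fun h ↦ absurd (Finset.mem_univ j) h

theorem ord_divOf_of_notMem (a : ι → ℤ) {v : HeightOneSpectrum (𝓞 K)} (hv : v ∉ Set.range W) :
    ord v (divOf W a) = 0 := by
  rw [divOf, ord_prod]
  exact Finset.sum_eq_zero fun i _ ↦ by
    rw [ord_zpow, ord_primeDivisor_of_ne fun h ↦ hv ⟨i, h⟩, mul_zero]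

theorem divOf_ord (hW : Function.Injective W) {D : Divisors K}
    (hD : ∀ v ∉ Set.range W, ord v D = 0) : divOf W (fun i ↦ ord (W i) D) = D := by
  refine divisors_ext fun v ↦ ?_
  by_cases hv : v ∈ Set.range W
  · obtain ⟨i, rfl⟩ := hv
    rw [ord_divOf hW]
  · rw [ord_divOf_of_notMem _ hv, hD v hv]

theorem divOf_injective (hW : Function.Injective W) : Function.Injective (divOf W) :=
  fun a b h ↦ funext fun i ↦ by rw [← ord_divOf hW a i, h, ord_divOf hW]

theorem divOf_add (a b : ι → ℤ) : divOf W (a + b) = divOf W a * divOf W b := by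
  simp only [divOf, Pi.add_apply, zpow_add, Finset.prod_mul_distrib]

theorem divOf_smul (k : ℤ) (a : ι → ℤ) : divOf W (k • a) = divOf W a ^ k := by
  simp only [divOf, Pi.smul_apply, smul_eq_mul, ← Finset.prod_zpow, ← zpow_mul, mul_comm]

theorem divOf_neg (a : ι → ℤ) : divOf W (-a) = (divOf W a)⁻¹ := by
  rw [← zpow_neg_one, ← divOf_smul, neg_one_zsmul]

end divOf

theorem ord_toPrincipalIdeal_eq_zero_iff (v : HeightOneSpectrum (𝓞 K)) (x : Kˣ) :
    ord v (toPrincipalIdeal (𝓞 K) K x) = 0 ↔ v.valuation K (x : K) = 1 := by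
  rw [valuation_eq_exp_neg_count v x.ne_zero, WithZero.exp_eq_one, neg_eq_zero, ord,
    coe_toPrincipalIdeal]

theorem mem_unit_iff_ord {S : Set (HeightOneSpectrum (𝓞 K))} {x : Kˣ} :
    x ∈ S.unit K ↔ ∀ v ∉ S, ord v (toPrincipalIdeal (𝓞 K) K x) = 0 := by
  simp only [ord_toPrincipalIdeal_eq_zero_iff]; rfl

theorem isIntegral_of_toPrincipalIdeal_eq_one {x : Kˣ}
    (hx : toPrincipalIdeal (𝓞 K) K x = 1) : IsIntegral ℤ (x : K) := by
  obtain ⟨y, hy⟩ := HeightOneSpectrum.mem_integers_of_valuation_le_one (R := 𝓞 K) K (x : K)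
    fun v ↦ ((ord_toPrincipalIdeal_eq_zero_iff v x).mp (by rw [hx, ord_one])).le
  rw [← hy]
  exact RingOfIntegers.isIntegral_coe y

theorem toPrincipalIdeal_eq_one_of_pow_eq_one {x : Kˣ} {n : ℕ} (hn : n ≠ 0) (hx : x ^ n = 1) :
    toPrincipalIdeal (𝓞 K) K x = 1 := by
  refine divisors_ext fun v ↦ ?_
  have h : ord v (toPrincipalIdeal (𝓞 K) K x ^ (n : ℤ)) = 0 := by
    rw [zpow_natCast, ← map_pow, hx, map_one, ord_one]
  rw [ord_zpow] at h
  rw [ord_one]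
  exact (mul_eq_zero.mp h).resolve_left (by exact_mod_cast hn)

/-! ### Functoriality of divisors -/

variable (f : K →+* M)

theorem coe_divisorMap (D : Divisors K) : (divisorMap f D : FractionalIdeal (𝓞 M)⁰ M) =
    (D : FractionalIdeal (𝓞 K)⁰ K).extended M
      (nonZeroDivisors_le_comap_nonZeroDivisors_of_injective _ (mapRingHom_injective f)) := rfl

theorem divisorMap_toPrincipalIdeal (x : Kˣ) :
    divisorMap f (toPrincipalIdeal (𝓞 K) K x) =
      toPrincipalIdeal (𝓞 M) M (Units.map f.toMonoidHom x) := by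
  refine Units.ext ?_
  rw [coe_divisorMap, coe_toPrincipalIdeal, coe_toPrincipalIdeal,
    FractionalIdeal.extended_spanSingleton]
  congr 1
  refine DFunLike.congr_fun (IsLocalization.ringHom_ext (𝓞 K)⁰ (k := f) ?_) (x : K)
  ext y
  simp

theorem divisorMap_mk0 (I : (Ideal (𝓞 K))⁰) : divisorMap f (FractionalIdeal.mk0 K I) =
    FractionalIdeal.mk0 M ⟨I.1.map (RingOfIntegers.mapRingHom f),
      map_mem_nonZeroDivisors _ (mapRingHom_injective f) I⟩ :=
  Units.ext (FractionalIdeal.extended_coeIdeal_eq_map _ _ _)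

theorem divisorMap_primeDivisor {v : HeightOneSpectrum (𝓞 K)} {w : HeightOneSpectrum (𝓞 M)}
    {e : ℕ} (h : v.asIdeal.map (RingOfIntegers.mapRingHom f) = w.asIdeal ^ e) :
    divisorMap f (primeDivisor v) = primeDivisor w ^ e := by
  rw [primeDivisor, divisorMap_mk0, primeDivisor, ← map_pow]
  exact congrArg _ (Subtype.ext h)

theorem divisorMap_divOf {ι : Type*} [Fintype ι] {V : ι → HeightOneSpectrum (𝓞 K)}
    {W : ι → HeightOneSpectrum (𝓞 M)} {e : ℕ}
    (h : ∀ i, (V i).asIdeal.map (RingOfIntegers.mapRingHom f) = (W i).asIdeal ^ e) (a : ι → ℤ) :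
    divisorMap f (divOf V a) = divOf W ((e : ℤ) • a) := by
  simp only [divOf, map_prod, map_zpow, divisorMap_primeDivisor f (h _), Pi.smul_apply, smul_eq_mul,
    zpow_mul, zpow_natCast]

/-! ### Divisors and classes -/

theorem classGroupMk_primeDivisor (v : HeightOneSpectrum (𝓞 K)) :
    ClassGroup.mk K (primeDivisor v) =
      ClassGroup.mk0 ⟨v.asIdeal, mem_nonZeroDivisors_iff_ne_zero.mpr v.ne_bot⟩ :=
  ClassGroup.mk_mk0 K _

theorem classGroupMk_eq_one_iff {D : Divisors K} :
    ClassGroup.mk K D = 1 ↔ D ∈ (toPrincipalIdeal (𝓞 K) K).range := by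
  rw [ClassGroup.mk_eq_one_iff, mem_principal_ideals_iff]
  constructor
  · rintro ⟨x, hx⟩
    exact ⟨x, FractionalIdeal.coeToSubmodule_injective
      ((FractionalIdeal.coe_spanSingleton _ _).trans hx.symm)⟩
  · rintro ⟨x, hx⟩
    exact ⟨x, by rw [← hx, FractionalIdeal.coe_spanSingleton]⟩

end Divisors

/-! ### Divisors built on the places above `ℓ` -/

section EllDivisors

variable {ℓ : ℕ} {K : IntermediateField ℚ ℂ} [NumberField K]

theorem mem_ellDivisors_iff (hℓ : ℓ ≠ 0) {D : Divisors K} :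
    D ∈ ellDivisors ℓ K ↔ ∀ v ∉ placesAbove ℓ K, ord v D = 0 := by
  constructor
  · intro hD v hv
    induction hD using Subgroup.closure_induction with
    | mem D hD =>
      obtain ⟨w, hw, hDw⟩ := hD
      rw [show D = primeDivisor w from Units.ext hDw]
      exact ord_primeDivisor_of_ne fun h ↦ hv (h ▸ hw)
    | one => exact ord_one v
    | mul D E _ _ hD hE => rw [ord_mul, hD, hE, add_zero]
    | inv D _ hD => rw [ord_inv, hD, neg_zero]
  · intro hD
    have : Fintype (placesAbove ℓ K) := (finite_placesAbove hℓ K).fintype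
    rw [← divOf_ord (W := fun v : placesAbove ℓ K ↦ v.1) Subtype.val_injective (D := D)
      (by simpa using hD)]
    refine Subgroup.prod_mem (ellDivisors ℓ K) fun v _ ↦ zpow_mem ?_ _
    exact Subgroup.subset_closure ⟨v.1, v.2, rfl⟩

theorem mem_ellDivisors_iff_exists_divOf (hℓ : ℓ ≠ 0) {ι : Type*} [Fintype ι]
    {W : ι → HeightOneSpectrum (𝓞 K)} (hW : Function.Injective W)
    (hr : Set.range W = placesAbove ℓ K) {D : Divisors K} :
    D ∈ ellDivisors ℓ K ↔ ∃ a, D = divOf W a := by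
  rw [mem_ellDivisors_iff hℓ, ← hr]
  exact ⟨fun h ↦ ⟨_, (divOf_ord hW h).symm⟩, fun ⟨a, ha⟩ v hv ↦ ha ▸ ord_divOf_of_notMem a hv⟩

theorem mem_unit_iff_mem_ellDivisors (hℓ : ℓ ≠ 0) {x : Kˣ} :
    x ∈ (placesAbove ℓ K).unit K ↔ toPrincipalIdeal (𝓞 K) K x ∈ ellDivisors ℓ K := by
  rw [mem_ellDivisors_iff hℓ, mem_unit_iff_ord]

end EllDivisors

/-! ### Roots of unity of norm one -/

section RootsOfUnity

variable {G : Type*} [CommGroup G] (σ : G →* G)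

theorem prod_iterate_div (x : G) (k : ℕ) :
    ∏ i ∈ Finset.range k, σ^[i] (σ x / x) = σ^[k] x / x := by
  induction k with
  | zero => simp
  | succ k ih =>
    rw [Finset.prod_range_succ, ih, Function.iterate_succ_apply]
    have h (y z : G) : σ^[k] (y / z) = σ^[k] y / σ^[k] z := by
      simp [iterate_map_div]
    rw [h, div_mul_div_cancel']

/-- As `ℓ` is odd, `∏ τ^i = τ^(ℓ (ℓ - 1) / 2)` is `1` when `τ^ℓ = 1`. -/
theorem prod_iterate_of_map_eq_mul {ℓ : ℕ} (hodd : Odd ℓ) {θ τ : G} (hθ : σ θ = θ * τ)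
    (hτ : σ τ = τ) (hτℓ : τ ^ ℓ = 1) : ∏ i ∈ Finset.range ℓ, σ^[i] θ = θ ^ ℓ := by
  have h (i : ℕ) : σ^[i] θ = θ * τ ^ i := by
    induction i with
    | zero => simp
    | succ i ih => rw [Function.iterate_succ_apply', ih, map_mul, map_pow, hθ, hτ, pow_succ',
        mul_assoc]
  simp only [h, Finset.prod_mul_distrib, Finset.prod_const, Finset.card_range]
  obtain ⟨k, rfl⟩ := hodd
  have : ∑ i ∈ Finset.range (2 * k + 1), i = (2 * k + 1) * k := by
    rw [Finset.sum_range_id]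
    exact Nat.div_eq_of_eq_mul_left two_pos (by simp; ring)
  rw [Finset.prod_pow_eq_pow_sum, this, pow_mul, hτℓ, one_pow, mul_one]

variable {σ} {ℓ N : ℕ} [Fact ℓ.Prime] {ζ ω : G}

/-- In the setting of a step of the cyclotomic tower, `ζ` generates all the roots of unity of order
a power of `ℓ`: a root `ξ` of order `ℓ^(N+1)` would have `ξ^ℓ = ζ^b` with `b` prime to `ℓ`, while
`∏ σ^i (σ ξ / ξ) = 1` computes to `ω^b`. -/
theorem pow_eq_one_of_pow_pow_eq_one (hodd : Odd ℓ) (hN : 2 ≤ N) (hσ : ∀ x, σ^[ℓ] x = x)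
    (hζ : ζ ^ ℓ ^ N = 1) (hζ' : ∀ z : G, z ^ ℓ ^ N = 1 → ∃ i : ℕ, ζ ^ i = z)
    (hω : σ ζ = ζ * ω) (hω1 : ω ≠ 1) (hωℓ : ω ^ ℓ = 1) (hσω : σ ω = ω) {ξ : G} {k : ℕ}
    (hξ : ξ ^ ℓ ^ k = 1) : ξ ^ ℓ ^ N = 1 := by
  have hp : ℓ.Prime := Fact.out
  have hpow (t : ℕ) : σ (ζ ^ t) = ζ ^ t * ω ^ t := by rw [map_pow, hω, mul_pow]
  have key (ξ : G) (hξ : ξ ^ ℓ ^ (N + 1) = 1) : ξ ^ ℓ ^ N = 1 := by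
    obtain ⟨b, hb⟩ := hζ' (ξ ^ ℓ) (by rw [← pow_mul, ← pow_succ', hξ])
    have hθℓ : (σ ξ / ξ) ^ ℓ = ω ^ b := by
      rw [div_pow, ← map_pow, ← hb, hpow, mul_div_cancel_left]
    obtain ⟨t, ht⟩ := hζ' (σ ξ / ξ) (by
      obtain ⟨m, rfl⟩ := Nat.exists_eq_add_of_le hN
      rw [pow_add, pow_two, pow_mul, pow_mul, hθℓ, pow_right_comm ω, hωℓ, one_pow, one_pow])
    have h1 := prod_iterate_div σ ξ ℓ
    rw [prod_iterate_of_map_eq_mul σ hodd (τ := ω ^ t) (by rw [← ht, hpow])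
      (by rw [map_pow, hσω]) (by rw [pow_right_comm, hωℓ, one_pow]), hσ, div_self', hθℓ] at h1
    have h2 : ℓ ∣ b := by
      rw [← orderOf_eq_prime hωℓ hω1]
      exact orderOf_dvd_of_pow_eq_one h1
    obtain ⟨b', rfl⟩ := h2
    obtain ⟨m, rfl⟩ : ∃ m, N = m + 1 := ⟨N - 1, by omega⟩
    rw [pow_succ', pow_mul, ← hb, ← pow_mul, mul_right_comm, ← pow_succ', pow_mul, hζ, one_pow]
  induction k generalizing ξ with
  | zero => rw [pow_zero, pow_one] at hξ; rw [hξ, one_pow]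
  | succ k ih =>
    rcases Nat.lt_or_ge k N with h | h
    · obtain ⟨m, rfl⟩ := Nat.exists_eq_add_of_le (Nat.succ_le_of_lt h)
      rw [pow_add, pow_mul, hξ, one_pow]
    · have h1 := ih (ξ := ξ ^ ℓ) (by rw [← pow_mul, ← pow_succ', hξ])
      exact key ξ (by rw [pow_succ', pow_mul, h1])

/-- A root of unity of norm `1` is `σ η / η` for a root of unity `η`: the cohomology group
`H^{-1}` of the roots of unity vanishes in a step of the cyclotomic tower. -/
theorem exists_map_eq_mul_of_prod_eq_one (hodd : Odd ℓ) (hN : 2 ≤ N) (hσ : ∀ x, σ^[ℓ] x = x)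
    (hζ : ζ ^ ℓ ^ N = 1) (hζ' : ∀ z : G, z ^ ℓ ^ N = 1 → ∃ i : ℕ, ζ ^ i = z)
    (hω : σ ζ = ζ * ω) (hω1 : ω ≠ 1) (hωℓ : ω ^ ℓ = 1) (hσω : σ ω = ω)
    (hω' : ∀ z : G, z ^ ℓ = 1 → ∃ i : ℕ, ω ^ i = z) {ε : G} (hε : IsOfFinOrder ε)
    (hprod : ∏ i ∈ Finset.range ℓ, σ^[i] ε = 1) : ∃ η, IsOfFinOrder η ∧ σ η = ε * η := by
  have hp : ℓ.Prime := Fact.out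
  let T : Subgroup G := CommGroup.torsion G
  let φ : G →* G := σ / MonoidHom.id G
  have hφ (x : G) : φ x = σ x / x := rfl
  let A : Subgroup G := T.map φ
  suffices ε ∈ A by
    obtain ⟨η, hη, h⟩ := this
    exact ⟨η, hη, by rw [← h, hφ, div_mul_cancel]⟩
  have hit (i : ℕ) : σ^[i] ε ∈ T := by
    induction i with
    | zero => exact hε
    | succ i ih => rw [Function.iterate_succ_apply']; exact σ.isOfFinOrder ih
  -- Modulo `A`, all the conjugates of `ε` agree, so that the norm is the `ℓ`-th power.
  have h1 : ε ^ ℓ ∈ A := by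
    have h (i : ℕ) : σ^[i] ε / ε ∈ A := by
      induction i with
      | zero => simp
      | succ i ih =>
        have := mul_mem (Subgroup.mem_map_of_mem φ (hit i)) ih
        rwa [hφ, div_mul_div_cancel, ← Function.iterate_succ_apply' (f := σ)] at this
    have h2 := Subgroup.prod_mem A (t := Finset.range ℓ) fun i _ ↦ h i
    rw [Finset.prod_div_distrib, hprod, Finset.prod_const, Finset.card_range] at h2
    simpa using h2
  obtain ⟨n, hn, hεn⟩ := isOfFinOrder_iff_pow_eq_one.mp hε
  obtain ⟨k, m, hm, rfl⟩ := Nat.exists_eq_pow_mul_and_not_dvd hn.ne' ℓ hp.ne_one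
  -- The part of `ε` of order a power of `ℓ` is a power of `ζ`, and has norm `1` only if it is a
  -- power of `ω = σ ζ / ζ`.
  have h2 : ε ^ m ∈ A := by
    have h3 : (ε ^ m) ^ ℓ ^ k = 1 := by rw [← pow_mul, mul_comm, hεn]
    obtain ⟨t, ht⟩ := hζ' _ (pow_eq_one_of_pow_pow_eq_one hodd hN hσ hζ hζ' hω hω1 hωℓ hσω h3)
    have h4 := prod_iterate_of_map_eq_mul σ hodd (θ := ε ^ m) (τ := ω ^ t)
      (by rw [← ht, map_pow, hω, mul_pow]) (by rw [map_pow, hσω])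
      (by rw [pow_right_comm, hωℓ, one_pow])
    have h5 (i : ℕ) : σ^[i] (ε ^ m) = (σ^[i] ε) ^ m := by
      simp [iterate_map_pow]
    simp only [h5, Finset.prod_pow, hprod, one_pow] at h4
    obtain ⟨j, hj⟩ := hω' _ h4.symm
    refine ⟨ζ ^ j, pow_mem (isOfFinOrder_iff_pow_eq_one.mpr ⟨_, pow_pos hp.pos N, hζ⟩) j, ?_⟩
    rw [hφ, map_pow, hω, mul_pow, mul_div_cancel_left, hj]
  have hcop : IsCoprime (ℓ : ℤ) (m : ℤ) := Nat.isCoprime_iff_coprime.mpr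
    ((Nat.Prime.coprime_iff_not_dvd hp).mpr hm)
  obtain ⟨u, v, huv⟩ := hcop
  have h6 : ε = (ε ^ ℓ) ^ u * (ε ^ m) ^ v := by
    rw [← zpow_natCast, ← zpow_natCast, ← zpow_mul, ← zpow_mul, ← zpow_add, mul_comm _ u,
      mul_comm _ v, huv, zpow_one]
  rw [h6]
  exact mul_mem (zpow_mem h1 u) (zpow_mem h2 v)

end RootsOfUnity

/-! ### Exponents and extension of divisors -/

section OrdExtension

variable {K M : Type*} [Field K] [NumberField K] [Field M] [NumberField M] (f : K →+* M)

theorem ord_mk0_ne_zero_iff {w : HeightOneSpectrum (𝓞 M)} {I : (Ideal (𝓞 M))⁰} :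
    ord w (FractionalIdeal.mk0 M I) ≠ 0 ↔ I.1 ≤ w.asIdeal := by
  classical
  have hI : I.1 ≠ 0 := mem_nonZeroDivisors_iff_ne_zero.mp I.2
  rw [ord, FractionalIdeal.coe_mk0, FractionalIdeal.count_coe M w hI, ← Ideal.dvd_iff_le,
    Nat.cast_ne_zero, ← Associates.count_ne_zero_iff_dvd hI w.irreducible]

theorem finite_ord_ne_zero (D : Divisors K) : {v | ord v D ≠ 0}.Finite :=
  FractionalIdeal.finite_factors (D : FractionalIdeal (𝓞 K)⁰ K)

theorem divisorMap_divisorMap {N : Type*} [Field N] [NumberField N] (g : M →+* N)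
    (D : Divisors K) : divisorMap g (divisorMap f D) = divisorMap (g.comp f) D := by
  refine Units.ext ?_
  exact DFunLike.congr_fun (FractionalIdeal.extendedHom'_comp (A := 𝓞 K) (K := K) M
    (nonZeroDivisors_le_comap_nonZeroDivisors_of_injective _ (mapRingHom_injective f))
    (nonZeroDivisors_le_comap_nonZeroDivisors_of_injective _ (mapRingHom_injective g))) D.1

/-- Extension of divisors multiplies the exponents by ramification indices. -/
theorem exists_ord_divisorMap {v : HeightOneSpectrum (𝓞 K)} {w : HeightOneSpectrum (𝓞 M)}
    (h : w.asIdeal.comap (RingOfIntegers.mapRingHom f) = v.asIdeal) :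
    ∃ e : ℤ, e ≠ 0 ∧ ∀ D, ord w (divisorMap f D) = e * ord v D := by
  have hp (v' : HeightOneSpectrum (𝓞 K)) :
      ord w (divisorMap f (primeDivisor v')) ≠ 0 ↔ v' = v := by
    rw [primeDivisor, divisorMap_mk0, ord_mk0_ne_zero_iff, map_le_iff_of_prime, h]
    exact ⟨fun h ↦ HeightOneSpectrum.ext h.symm, fun h ↦ h ▸ rfl⟩
  refine ⟨ord w (divisorMap f (primeDivisor v)), (hp v).mpr rfl, fun D ↦ ?_⟩
  have : Fintype {v | ord v D ≠ 0} := (finite_ord_ne_zero D).fintype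
  have hD := divOf_ord (W := fun i : {v | ord v D ≠ 0} ↦ i.1) Subtype.val_injective (D := D)
    (by simp)
  conv_lhs => rw [← hD]
  rw [divOf, map_prod, ord_prod]
  simp only [map_zpow, ord_zpow]
  by_cases hv : ord v D = 0
  · rw [hv, mul_zero]
    refine Finset.sum_eq_zero fun i _ ↦ mul_eq_zero_of_right _ ?_
    by_contra hne
    exact i.2 ((hp i.1).mp hne ▸ hv)
  · rw [Finset.sum_eq_single ⟨v, hv⟩, mul_comm]
    · intro i _ hi
      refine mul_eq_zero_of_right _ ?_
      by_contra hne
      exact hi (Subtype.ext ((hp i.1).mp hne))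
    · exact fun h ↦ absurd (Finset.mem_univ _) h

end OrdExtension

/-! ### Imaginary units in a totally ramified Kummer step -/

section Conj

variable {ℓ : ℕ} {K M : IntermediateField ℚ ℂ} [NumberField K] [NumberField M]

theorem divisorMap_mem_ellDivisors_iff (hℓ : ℓ ≠ 0) (f : K →+* M) {D : Divisors K} :
    divisorMap f D ∈ ellDivisors ℓ M ↔ D ∈ ellDivisors ℓ K := by
  rw [mem_ellDivisors_iff hℓ, mem_ellDivisors_iff hℓ]
  constructor
  · intro h v hv
    obtain ⟨w, hw⟩ := exists_comap_eq f v
    obtain ⟨e, he, hord⟩ := exists_ord_divisorMap f hw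
    have := h w fun hw' ↦ hv ((mem_placesAbove_iff_of_comap f hw).mpr hw')
    rw [hord] at this
    exact (mul_eq_zero.mp this).resolve_left he
  · intro h w hw
    obtain ⟨v, hv⟩ := exists_eq_comap f w
    obtain ⟨e, he, hord⟩ := exists_ord_divisorMap f hv
    rw [hord, h v fun hv' ↦ hw ((mem_placesAbove_iff_of_comap f hv).mp hv'), mul_zero]

variable [ConjStable K] [ConjStable M]

theorem mem_imagUnits_iff (hℓ : ℓ ≠ 0) {x : Kˣ} : x ∈ imagUnits ℓ K ↔
    toPrincipalIdeal (𝓞 K) K x ∈ ellDivisors ℓ K ∧ conj K x * x = 1 := by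
  rw [imagUnits, Subgroup.mem_inf, mem_unit_iff_mem_ellDivisors hℓ]
  refine and_congr_right fun _ ↦ ?_
  change Units.map (conj K).toMonoidHom x = x⁻¹ ↔ _
  rw [eq_inv_iff_mul_eq_one, Units.ext_iff]
  rfl

theorem torsion_le_imagUnits (hℓ : ℓ ≠ 0) : CommGroup.torsion Kˣ ≤ imagUnits ℓ K := by
  intro x hx
  obtain ⟨n, hn, hxn⟩ := isOfFinOrder_iff_pow_eq_one.mp hx
  rw [mem_imagUnits_iff hℓ, toPrincipalIdeal_eq_one_of_pow_eq_one hn.ne' hxn]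
  refine ⟨one_mem _, ?_⟩
  rw [conj_apply_of_pow_eq_one hn.ne' (by rw [← Units.val_pow_eq_pow_val, hxn, Units.val_one])]
  exact inv_mul_cancel₀ x.ne_zero

theorem map_mem_imagUnits_iff (hℓ : ℓ ≠ 0) {f : K →+* M}
    (hf : (conj M).comp f = f.comp (conj K)) {x : Kˣ} :
    Units.map f.toMonoidHom x ∈ imagUnits ℓ M ↔ x ∈ imagUnits ℓ K := by
  rw [mem_imagUnits_iff hℓ, mem_imagUnits_iff hℓ, ← divisorMap_toPrincipalIdeal,
    divisorMap_mem_ellDivisors_iff hℓ]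
  refine and_congr_right fun _ ↦ ?_
  change (conj M).comp f x * f x = 1 ↔ _
  rw [hf, ← map_one f, ← f.injective.eq_iff, map_mul]
  rfl

/-- The imaginary `ℓ`-units do not grow, up to roots of unity, in a Kummer step in which the places
above `ℓ` are totally ramified: for such a unit `x`, the quotient `σ x / x` is a unit of absolute
value `1` everywhere, hence a root of unity, and its norm is `1`. -/
theorem exists_torsion_mul_eq_of_step [Fact ℓ.Prime] (hodd : Odd ℓ) {f : K →+* M}
    (hf : (conj M).comp f = f.comp (conj K))
    (hemb : ∀ (φ : M →+* ℂ) (x : M), φ (conj M x) = starRingEnd ℂ (φ x))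
    (hram : ∀ w ∈ placesAbove ℓ M, ∃ (v : HeightOneSpectrum (𝓞 K)) (e : ℕ), e ≠ 0 ∧
      v.asIdeal.map (RingOfIntegers.mapRingHom f) = w.asIdeal ^ e)
    {σ : M ≃+* M} (hσ : σ ^ ℓ = 1) (hσf : ∀ x, σ (f x) = f x)
    (hfix : ∀ x, σ x = x → x ∈ f.range) {N : ℕ} (hN : 2 ≤ N) {ζ : M}
    (hζ : IsPrimitiveRoot ζ (ℓ ^ N)) (hζf : ζ ^ ℓ ∈ f.range) (hζn : ζ ∉ f.range)
    {ω₀ : K} (hω₀ : IsPrimitiveRoot ω₀ ℓ) {x : Mˣ} (hx : x ∈ imagUnits ℓ M) :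
    ∃ η ∈ CommGroup.torsion Mˣ, ∃ y ∈ imagUnits ℓ K, x = η * Units.map f.toMonoidHom y := by
  have hp : ℓ.Prime := Fact.out
  have hℓ := hp.ne_zero
  have : NeZero ℓ := ⟨hℓ⟩
  let s : Mˣ →* Mˣ := Units.map (σ : M →+* M).toMonoidHom
  have hs (z : Mˣ) : ((s z : Mˣ) : M) = σ z := rfl
  have hsi (k : ℕ) (z : Mˣ) : ((s^[k] z : Mˣ) : M) = (σ ^ k) z := by
    induction k with
    | zero => rfl
    | succ k ih => rw [Function.iterate_succ_apply', hs, ih, pow_succ']; rfl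
  have hsℓ (z : Mˣ) : s^[ℓ] z = z := Units.ext (by rw [hsi, hσ]; rfl)
  have hcomp : (σ : M →+* M).comp f = f := RingHom.ext hσf
  have hprimef (z : M) (hz : z ^ ℓ = 1) : z ∈ f.range := by
    obtain ⟨i, -, hi⟩ := (hω₀.map_of_injective f.injective).eq_pow_of_pow_eq_one hz
    exact ⟨ω₀ ^ i, by rw [map_pow, hi]⟩
  -- `σ` fixes the divisors built on the places above `ℓ`.
  have hdiv : ∀ D ∈ ellDivisors ℓ M, divisorMap (σ : M →+* M) D = D := by
    intro D hD
    induction hD using Subgroup.closure_induction with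
    | mem D hD =>
      obtain ⟨w, hw, hDw⟩ := hD
      obtain ⟨v, e, he, hve⟩ := hram w hw
      have h1 := divisorMap_primeDivisor f hve
      rw [show primeDivisor w = D from Units.ext hDw.symm] at h1
      have h2 := congrArg (divisorMap (σ : M →+* M)) h1
      rw [divisorMap_divisorMap, hcomp, h1, map_pow] at h2
      refine divisors_ext fun u ↦ ?_
      have h3 := congrArg (ord u) h2
      rw [← zpow_natCast, ← zpow_natCast, ord_zpow, ord_zpow] at h3
      exact (mul_left_cancel₀ (by exact_mod_cast he) h3).symm
    | one => exact map_one _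
    | mul D E _ _ hD hE => rw [map_mul, hD, hE]
    | inv D _ hD => rw [map_inv, hD]
  obtain ⟨hxD, hxc⟩ := (mem_imagUnits_iff hℓ).mp hx
  have hε : IsOfFinOrder (s x / x) := by
    have h1 : toPrincipalIdeal (𝓞 M) M (s x / x) = 1 := by
      rw [map_div, ← divisorMap_toPrincipalIdeal, hdiv _ hxD, div_self']
    have hnorm (φ : M →+* ℂ) : ‖φ x‖ = 1 := by
      have h2 := congrArg φ hxc
      rw [map_mul, hemb, map_one, Complex.conj_mul'] at h2
      have h3 : ‖φ x‖ ^ 2 = 1 := by exact_mod_cast h2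
      exact (pow_eq_one_iff_of_nonneg (norm_nonneg _) two_ne_zero).mp h3
    obtain ⟨n, hn, hn1⟩ := NumberField.Embeddings.pow_eq_one_of_norm_eq_one M ℂ
      (isIntegral_of_toPrincipalIdeal_eq_one h1) fun φ ↦ by
        rw [Units.val_div_eq_div_val, map_div₀, norm_div, hnorm φ, div_one]
        exact hnorm (φ.comp (σ : M →+* M))
    exact isOfFinOrder_iff_pow_eq_one.mpr ⟨n, hn, Units.ext hn1⟩
  have hprod : ∏ i ∈ Finset.range ℓ, s^[i] (s x / x) = 1 := by
    rw [prod_iterate_div, hsℓ, div_self']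
  -- The root of unity `ζ` and the `ℓ`-th root of unity `σ ζ / ζ`.
  have hζ0 : ζ ≠ 0 := hζ.ne_zero (pow_ne_zero _ hℓ)
  have hζu : (Units.mk0 ζ hζ0) ^ ℓ ^ N = 1 := Units.ext hζ.pow_eq_one
  set u := Units.mk0 ζ hζ0 with hu
  have hωℓ : (s u / u) ^ ℓ = 1 := by
    rw [div_pow, ← map_pow, div_eq_one]
    obtain ⟨a, ha⟩ := hζf
    refine Units.ext ?_
    rw [hs, Units.val_pow_eq_pow_val, Units.val_mk0, ← ha]
    exact hσf a
  have hω1 : s u / u ≠ 1 := by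
    rw [Ne, div_eq_one]
    exact fun h ↦ hζn (hfix ζ (congrArg Units.val h))
  have hωr : IsPrimitiveRoot ((s u / u : Mˣ) : M) ℓ :=
    IsPrimitiveRoot.coe_units_iff.mpr (IsPrimitiveRoot.iff_orderOf.mpr
      (orderOf_eq_prime hωℓ hω1))
  have hσω : s (s u / u) = s u / u := by
    obtain ⟨a, ha⟩ := hprimef _ hωr.pow_eq_one
    refine Units.ext ?_
    rw [hs, ← ha]
    exact hσf a
  have : NeZero (ℓ ^ N) := ⟨pow_ne_zero _ hℓ⟩
  obtain ⟨η, hη, hηx⟩ := exists_map_eq_mul_of_prod_eq_one hodd hN hsℓ hζu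
    (fun z hz ↦ by
      obtain ⟨i, -, hi⟩ := hζ.eq_pow_of_pow_eq_one (show (z : M) ^ ℓ ^ N = 1 by
        rw [← Units.val_pow_eq_pow_val, hz, Units.val_one])
      exact ⟨i, Units.ext hi⟩) (mul_div_cancel u (s u)).symm hω1 hωℓ hσω
    (fun z hz ↦ by
      obtain ⟨i, -, hi⟩ := hωr.eq_pow_of_pow_eq_one (show (z : M) ^ ℓ = 1 by
        rw [← Units.val_pow_eq_pow_val, hz, Units.val_one])
      exact ⟨i, Units.ext (by exact_mod_cast hi)⟩) hε hprod
  -- `x / η` is fixed by `σ`, hence comes from `K`.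
  have hfixed : s (x / η) = x / η := by
    rw [map_div, hηx, ← div_div, div_div_cancel]
  obtain ⟨y, hy⟩ := hfix _ (congrArg Units.val hfixed)
  have hy0 : y ≠ 0 := by
    rintro rfl
    rw [map_zero] at hy
    exact (x / η).ne_zero hy.symm
  have hyx : Units.map f.toMonoidHom (Units.mk0 y hy0) = x / η := Units.ext hy
  refine ⟨η, hη, Units.mk0 y hy0, ?_, by rw [hyx, mul_div_cancel]⟩
  rw [← map_mem_imagUnits_iff hℓ hf, hyx]
  exact div_mem hx (torsion_le_imagUnits hℓ hη)

end Conj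

/-! ### The places above `ℓ` in a totally ramified tower -/

theorem placesAbove_nonempty {ℓ : ℕ} [Fact ℓ.Prime] (K : Type*) [Field K] [NumberField K] :
    (placesAbove ℓ K).Nonempty := by
  have hp : ℓ.Prime := Fact.out
  have hne : Ideal.span {(ℓ : 𝓞 K)} ≠ ⊤ := by
    intro h
    have h1 : Ideal.absNorm (Ideal.span {(ℓ : 𝓞 K)}) = ℓ ^ Module.finrank ℚ K := by
      rw [← RingOfIntegers.rank K]
      exact Ideal.absNorm_span_natCast ℓ
    rw [h, Ideal.absNorm_top] at h1
    exact absurd h1 (Nat.one_lt_pow Module.finrank_pos.ne' hp.one_lt).ne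
  obtain ⟨P, hP, hle⟩ := Ideal.exists_le_maximal _ hne
  have hmem : (ℓ : 𝓞 K) ∈ P := hle (Ideal.mem_span_singleton_self _)
  refine ⟨⟨P, hP.isPrime, ?_⟩, hmem⟩
  rintro rfl
  exact hp.ne_zero (by exact_mod_cast (Ideal.mem_bot.mp hmem))

theorem comap_eq_of_map_eq_pow {K M : Type*} [Field K] [NumberField K] [Field M] [NumberField M]
    {f : K →+* M} {v : HeightOneSpectrum (𝓞 K)} {w : HeightOneSpectrum (𝓞 M)} {e : ℕ}
    (he : e ≠ 0) (h : v.asIdeal.map (RingOfIntegers.mapRingHom f) = w.asIdeal ^ e) :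
    w.asIdeal.comap (RingOfIntegers.mapRingHom f) = v.asIdeal :=
  (map_le_iff_of_prime f).mp (h.trans_le (Ideal.pow_le_self he))

theorem eq_of_comap_of_map_eq_pow {K M : Type*} [Field K] [NumberField K] [Field M] [NumberField M]
    {f : K →+* M} {v : HeightOneSpectrum (𝓞 K)} {w w' : HeightOneSpectrum (𝓞 M)} {e : ℕ}
    (h : v.asIdeal.map (RingOfIntegers.mapRingHom f) = w.asIdeal ^ e)
    (h' : w'.asIdeal.comap (RingOfIntegers.mapRingHom f) = v.asIdeal) : w' = w := by
  have h1 := (map_le_iff_of_prime f).mpr h'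
  rw [h] at h1
  exact HeightOneSpectrum.ext (w.isMaximal.eq_of_le w'.isPrime.ne_top
    (w'.isPrime.le_of_pow_le h1)).symm

theorem pow_right_injective_asIdeal {M : Type*} [Field M] [NumberField M]
    (w : HeightOneSpectrum (𝓞 M)) : Function.Injective (w.asIdeal ^ · : ℕ → Ideal (𝓞 M)) :=
  fun a b h ↦ Nat.pow_right_injective (one_lt_absNorm w) (by
    simpa using congrArg Ideal.absNorm h)

theorem mapRingHom_comp {K M N : Type*} [Field K] [Field M] [Field N] (f : K →+* M) (g : M →+* N) :
    (RingOfIntegers.mapRingHom g).comp (RingOfIntegers.mapRingHom f) =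
      RingOfIntegers.mapRingHom (g.comp f) := rfl

/-- Transport along an involution by direct and by inverse image agree. -/
theorem map_eq_comap_of_involutive {R : Type*} [CommRing R] {g : R →+* R}
    (hg : ∀ x, g (g x) = x) (I : Ideal R) : I.map g = I.comap g := by
  refine le_antisymm (Ideal.map_le_iff_le_comap.mpr fun x hx ↦ ?_) fun x hx ↦ ?_
  · rw [Ideal.mem_comap, Ideal.mem_comap, hg]; exact hx
  · rw [← hg x]; exact Ideal.mem_map_of_mem g hx

theorem mapRingHom_conj_conj {K : IntermediateField ℚ ℂ} [ConjStable K] (x : 𝓞 K) :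
    RingOfIntegers.mapRingHom (conj K) (RingOfIntegers.mapRingHom (conj K) x) = x :=
  RingOfIntegers.ext (conj_conj _)

/-- Complex conjugation on the places above `ℓ`. It is defined by contraction, which for an
involution is the same as extension. -/
noncomputable def placeConj (ℓ : ℕ) (K : IntermediateField ℚ ℂ) [NumberField K] [ConjStable K]
    (v : placesAbove ℓ K) : placesAbove ℓ K :=
  ⟨(exists_eq_comap (conj K) v.1).choose,
    (mem_placesAbove_iff_of_comap (conj K) (exists_eq_comap (conj K) v.1).choose_spec).mpr v.2⟩

theorem comap_conj_eq_placeConj {ℓ : ℕ} {K : IntermediateField ℚ ℂ} [NumberField K] [ConjStable K]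
    (v : placesAbove ℓ K) : v.1.asIdeal.comap (RingOfIntegers.mapRingHom (conj K)) =
      (placeConj ℓ K v).1.asIdeal :=
  (exists_eq_comap (conj K) v.1).choose_spec

theorem placeConj_placeConj {ℓ : ℕ} {K : IntermediateField ℚ ℂ} [NumberField K] [ConjStable K]
    (v : placesAbove ℓ K) : placeConj ℓ K (placeConj ℓ K v) = v := by
  refine Subtype.ext (HeightOneSpectrum.ext ?_)
  rw [← comap_conj_eq_placeConj, ← comap_conj_eq_placeConj, Ideal.comap_comap]
  ext x
  rw [Ideal.mem_comap, RingHom.comp_apply, mapRingHom_conj_conj]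

theorem map_eq_pow_of_comp {K M N : Type*} [Field K] [NumberField K] [Field M] [NumberField M]
    [Field N] [NumberField N] {f : K →+* M} {g : M →+* N} {v : HeightOneSpectrum (𝓞 K)}
    {w : HeightOneSpectrum (𝓞 M)} {u : HeightOneSpectrum (𝓞 N)} {a c : ℕ} (ha : a ≠ 0)
    (h1 : v.asIdeal.map (RingOfIntegers.mapRingHom f) = w.asIdeal ^ a)
    (h2 : v.asIdeal.map (RingOfIntegers.mapRingHom (g.comp f)) = u.asIdeal ^ (c * a)) :
    w.asIdeal.map (RingOfIntegers.mapRingHom g) = u.asIdeal ^ c := by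
  obtain ⟨e, he⟩ := eq_pow_of_forall_dvd (w := u) (map_ne_bot g w.ne_bot) fun u' hu' ↦ by
    rw [map_le_iff_of_prime] at hu'
    refine eq_of_comap_of_map_eq_pow h2 ?_
    rw [← mapRingHom_comp, ← Ideal.comap_comap, hu', comap_eq_of_map_eq_pow ha h1]
  rw [← mapRingHom_comp, ← Ideal.map_map, h1, Ideal.map_pow, he, ← pow_mul] at h2
  rw [he, Nat.eq_of_mul_eq_mul_right (Nat.pos_of_ne_zero ha) (pow_right_injective_asIdeal u h2)]

theorem inclusion_comp_inclusion {K M N : IntermediateField ℚ ℂ} (h : K ≤ M) (h' : M ≤ N) :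
    (IntermediateField.inclusion h').toRingHom.comp (IntermediateField.inclusion h).toRingHom =
      (IntermediateField.inclusion (h.trans h')).toRingHom :=
  RingHom.ext fun _ ↦ Subtype.ext rfl

theorem incl_comp_incl {ℓ : ℕ} {L : IntermediateField ℚ ℂ} {k n m : ℕ} (h : k ≤ n) (h' : n ≤ m) :
    (incl ℓ L h').comp (incl ℓ L h) = incl ℓ L (h.trans h') :=
  inclusion_comp_inclusion (layer_mono ℓ L h) (layer_mono ℓ L h')

section Tower

variable {ℓ : ℕ} [Fact ℓ.Prime] {L : IntermediateField ℚ ℂ} [NumberField L] {n₀ : ℕ}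
  (hram : TotallyRamifiedFrom ℓ L n₀)

/-- The place of `L_n` above a place `v` of `L_{n₀}` dividing `ℓ`. -/
noncomputable def placeAt {n : ℕ} (h : n₀ ≤ n) (v : placesAbove ℓ (layer ℓ L n₀)) :
    HeightOneSpectrum (𝓞 (layer ℓ L n)) := (hram n h v.1 v.2).choose

theorem map_eq_placeAt_pow {n : ℕ} (h : n₀ ≤ n) (v : placesAbove ℓ (layer ℓ L n₀)) :
    v.1.asIdeal.map (RingOfIntegers.mapRingHom (incl ℓ L h)) =
      (placeAt hram h v).asIdeal ^ ℓ ^ (n - n₀) := (hram n h v.1 v.2).choose_spec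

theorem pow_prime_ne_zero (ℓ : ℕ) [Fact ℓ.Prime] (k : ℕ) : ℓ ^ k ≠ 0 :=
  pow_ne_zero k (Fact.out : ℓ.Prime).ne_zero

theorem comap_placeAt {n : ℕ} (h : n₀ ≤ n) (v : placesAbove ℓ (layer ℓ L n₀)) :
    (placeAt hram h v).asIdeal.comap (RingOfIntegers.mapRingHom (incl ℓ L h)) = v.1.asIdeal :=
  comap_eq_of_map_eq_pow (pow_prime_ne_zero ℓ _) (map_eq_placeAt_pow hram h v)

theorem eq_placeAt {n : ℕ} (h : n₀ ≤ n) {v : placesAbove ℓ (layer ℓ L n₀)}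
    {w : HeightOneSpectrum (𝓞 (layer ℓ L n))}
    (hw : w.asIdeal.comap (RingOfIntegers.mapRingHom (incl ℓ L h)) = v.1.asIdeal) :
    w = placeAt hram h v :=
  eq_of_comap_of_map_eq_pow (map_eq_placeAt_pow hram h v) hw

theorem placeAt_injective {n : ℕ} (h : n₀ ≤ n) : Function.Injective (placeAt hram h) :=
  fun v v' hv ↦ Subtype.ext (HeightOneSpectrum.ext (by
    rw [← comap_placeAt hram h, hv, comap_placeAt]))

theorem range_placeAt {n : ℕ} (h : n₀ ≤ n) :
    Set.range (placeAt hram h) = placesAbove ℓ (layer ℓ L n) := by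
  ext w
  constructor
  · rintro ⟨v, rfl⟩
    exact (mem_placesAbove_iff_of_comap _ (comap_placeAt hram h v)).mp v.2
  · intro hw
    obtain ⟨v, hv⟩ := exists_eq_comap (incl ℓ L h) w
    exact ⟨⟨v, (mem_placesAbove_iff_of_comap _ hv).mpr hw⟩, (eq_placeAt hram h hv).symm⟩

theorem map_placeAt {n m : ℕ} (h : n₀ ≤ n) (h' : n ≤ m) (v : placesAbove ℓ (layer ℓ L n₀)) :
    (placeAt hram h v).asIdeal.map (RingOfIntegers.mapRingHom (incl ℓ L h')) =
      (placeAt hram (h.trans h') v).asIdeal ^ ℓ ^ (m - n) := by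
  refine map_eq_pow_of_comp (pow_prime_ne_zero ℓ (n - n₀)) (map_eq_placeAt_pow hram h v) ?_
  rw [← pow_add, Nat.sub_add_sub_cancel h' h, incl_comp_incl]
  exact map_eq_placeAt_pow hram (h.trans h') v

include hram in
/-- The steps of the totally ramified part of the tower are not trivial, as there are places
above `ℓ`. -/
theorem not_surjective_incl {n : ℕ} (h : n₀ ≤ n) :
    ¬ Function.Surjective (incl ℓ L (Nat.le_succ n)) := by
  intro hsurj
  obtain ⟨v, hv⟩ := placesAbove_nonempty (ℓ := ℓ) (layer ℓ L n₀)
  have h1 := map_placeAt hram h (Nat.le_succ n) ⟨v, hv⟩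
  have hs : Function.Surjective (RingOfIntegers.mapRingHom (incl ℓ L (Nat.le_succ n))) := by
    intro y
    obtain ⟨x, hx⟩ := hsurj y
    refine ⟨⟨x, ?_⟩, RingOfIntegers.ext hx⟩
    refine (isIntegral_algHom_iff (incl ℓ L (Nat.le_succ n)).toIntAlgHom
      (incl ℓ L (Nat.le_succ n)).injective).mp ?_
    change IsIntegral ℤ (incl ℓ L (Nat.le_succ n) x)
    rw [hx]
    exact y.2
  have h2 : (placeAt hram h ⟨v, hv⟩).asIdeal.map
      (RingOfIntegers.mapRingHom (incl ℓ L (Nat.le_succ n))) =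
      (placeAt hram (h.trans (Nat.le_succ n)) ⟨v, hv⟩).asIdeal := by
    rw [← comap_eq_of_map_eq_pow (pow_prime_ne_zero ℓ _) h1]
    exact Ideal.map_comap_of_surjective _ hs _
  rw [h1] at h2
  have h3 := pow_right_injective_asIdeal _ (h2.trans (pow_one _).symm)
  rw [Nat.succ_eq_add_one, Nat.add_sub_cancel_left, pow_one] at h3
  exact (Fact.out : ℓ.Prime).ne_one h3

include hram in
theorem finrank_layer_of_totallyRamified (hμ : ∃ ζ : L, IsPrimitiveRoot ζ ℓ) {n m : ℕ}
    (h : n₀ ≤ n) (h' : n ≤ m) : Module.finrank ℚ (layer ℓ L m) =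
      ℓ ^ (m - n) * Module.finrank ℚ (layer ℓ L n) := by
  obtain ⟨k, rfl⟩ := Nat.exists_eq_add_of_le h'
  rw [Nat.add_sub_cancel_left]
  induction k with
  | zero => simp
  | succ k ih =>
    have h1 := ((layer_succ_alternative hμ (n + k)).resolve_left
      (not_surjective_incl hram (h.trans (Nat.le_add_right n k)))).2
    rw [← add_assoc, h1, ih (Nat.le_add_right n k), pow_succ', mul_assoc]

theorem relNorm_map_pow {K M : Type*} [Field K] [NumberField K] [Field M] [NumberField M]
    [Algebra K M] {D : ℕ} (hD : Module.finrank ℚ M = D * Module.finrank ℚ K) (I : Ideal (𝓞 K)) :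
    Ideal.relNorm (𝓞 K) (I.map (algebraMap (𝓞 K) (𝓞 M))) = I ^ D := by
  have h2 : Module.finrank (𝓞 K) (𝓞 M) = D := by
    rw [← IsFractionRing.finrank_eq (𝓞 K) K (𝓞 M) M]
    have := Module.finrank_mul_finrank ℚ K M
    rw [hD, mul_comm] at this
    exact Nat.eq_of_mul_eq_mul_right Module.finrank_pos this
  rw [Ideal.relNorm_algebraMap (𝓞 M) I, h2]

/-- The norm of a totally ramified prime is the prime below, because the residual degree is `1`. -/
theorem relNorm_eq_of_map_eq_pow {K M : Type*} [Field K] [NumberField K] [Field M] [NumberField M]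
    [Algebra K M] {D : ℕ} (hD : Module.finrank ℚ M = D * Module.finrank ℚ K) (hD0 : D ≠ 0)
    {v : HeightOneSpectrum (𝓞 K)} {w : HeightOneSpectrum (𝓞 M)}
    (h : v.asIdeal.map (algebraMap (𝓞 K) (𝓞 M)) = w.asIdeal ^ D) :
    Ideal.relNorm (𝓞 K) w.asIdeal = v.asIdeal := by
  have h1 := relNorm_map_pow hD v.asIdeal
  rw [h, map_pow] at h1
  have hne : Ideal.relNorm (𝓞 K) w.asIdeal ≠ ⊥ := Ideal.relNorm_eq_bot_iff.not.mpr w.ne_bot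
  obtain ⟨e, he⟩ := eq_pow_of_forall_dvd (w := v) hne fun u hu ↦ by
    have h2 := Ideal.pow_right_mono hu D
    rw [h1] at h2
    exact HeightOneSpectrum.ext (v.isMaximal.eq_of_le u.isPrime.ne_top
      (u.isPrime.le_of_pow_le (h2.trans (Ideal.pow_le_self hD0)))).symm
  rw [he, ← pow_mul] at h1
  have h2 := pow_right_injective_asIdeal v h1
  rw [he, (Nat.mul_eq_right hD0).mp h2, pow_one]

theorem comap_conj_placeAt [ConjStable L] {n : ℕ} (h : n₀ ≤ n)
    (v : placesAbove ℓ (layer ℓ L n₀)) : (placeAt hram h v).asIdeal.comap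
      (RingOfIntegers.mapRingHom (conj (layer ℓ L n))) =
        (placeAt hram h (placeConj ℓ _ v)).asIdeal := by
  obtain ⟨w, hw⟩ := exists_eq_comap (conj (layer ℓ L n)) (placeAt hram h v)
  rw [hw, eq_placeAt hram h (v := placeConj ℓ _ v) (w := w)]
  rw [← hw, Ideal.comap_comap, mapRingHom_comp, incl_comp_conj, ← mapRingHom_comp,
    ← Ideal.comap_comap, comap_placeAt, comap_conj_eq_placeConj]

theorem map_conj_placeAt [ConjStable L] {n : ℕ} (h : n₀ ≤ n)
    (v : placesAbove ℓ (layer ℓ L n₀)) : (placeAt hram h v).asIdeal.map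
      (RingOfIntegers.mapRingHom (conj (layer ℓ L n))) =
        (placeAt hram h (placeConj ℓ _ v)).asIdeal :=
  (map_eq_comap_of_involutive mapRingHom_conj_conj _).trans (comap_conj_placeAt hram h v)

end Tower

/-! ### Imaginary units and imaginary principal divisors in the tower -/

theorem units_map_map {A B C : Type*} [Field A] [Field B] [Field C] {f : A →+* B} {g : B →+* C}
    {k : A →+* C} (h : g.comp f = k) (z : Aˣ) :
    Units.map g.toMonoidHom (Units.map f.toMonoidHom z) = Units.map k.toMonoidHom z := by
  subst h; rfl

section Imaginary

variable {ℓ : ℕ} [Fact ℓ.Prime] {L : IntermediateField ℚ ℂ} [NumberField L] [IsCMField L] {n₀ : ℕ}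
  (hram : TotallyRamifiedFrom ℓ L n₀) (hμ : ∃ ζ : L, IsPrimitiveRoot ζ ℓ) (hodd : ℓ ≠ 2)

include hram hμ hodd

theorem exists_torsion_mul_eq_succ {n : ℕ} (h : n₀ ≤ n) {x : (layer ℓ L (n + 1))ˣ}
    (hx : x ∈ imagUnits ℓ (layer ℓ L (n + 1))) :
    ∃ η ∈ CommGroup.torsion (layer ℓ L (n + 1))ˣ, ∃ y ∈ imagUnits ℓ (layer ℓ L n),
      x = η * Units.map (incl ℓ L (Nat.le_succ n)).toMonoidHom y := by
  have hns := not_surjective_incl hram h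
  obtain ⟨⟨σ, hσ, hσf, hfix⟩, -⟩ := (layer_succ_alternative hμ n).resolve_left hns
  obtain ⟨ζ, hζ⟩ := exists_isPrimitiveRoot_layer hμ (n + 1)
  obtain ⟨hζf, htop⟩ := layer_step hμ n hζ
  obtain ⟨ω, hω⟩ := exists_isPrimitiveRoot_prime_layer hμ n
  refine exists_torsion_mul_eq_of_step ((Fact.out : ℓ.Prime).odd_of_ne_two hodd)
    (incl_comp_conj ℓ L (Nat.le_succ n)) (fun φ x ↦ embedding_layer_conj hμ φ x) ?_ hσ hσf hfix
    (by omega) hζ hζf (fun hmem ↦ hns fun y ↦ ?_) hω hx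
  · intro w hw
    rw [← range_placeAt hram (h.trans (Nat.le_succ n))] at hw
    obtain ⟨v, rfl⟩ := hw
    exact ⟨_, _, pow_prime_ne_zero ℓ _, map_placeAt hram h (Nat.le_succ n) v⟩
  · exact (htop _ le_rfl hmem ▸ Subfield.mem_top y : y ∈ (incl ℓ L (Nat.le_succ n)).fieldRange)

theorem exists_torsion_mul_eq {n : ℕ} (h : n₀ ≤ n) {x : (layer ℓ L n)ˣ}
    (hx : x ∈ imagUnits ℓ (layer ℓ L n)) :
    ∃ η ∈ CommGroup.torsion (layer ℓ L n)ˣ, ∃ y ∈ imagUnits ℓ (layer ℓ L n₀),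
      x = η * Units.map (incl ℓ L h).toMonoidHom y := by
  induction n, h using Nat.le_induction with
  | base => exact ⟨1, one_mem _, x, hx, by rw [one_mul]; exact Units.ext rfl⟩
  | succ n h ih =>
    obtain ⟨η, hη, y, hy, rfl⟩ := exists_torsion_mul_eq_succ hram hμ hodd h hx
    obtain ⟨η', hη', z, hz, rfl⟩ := ih hy
    refine ⟨η * Units.map (incl ℓ L (Nat.le_succ n)).toMonoidHom η',
      mul_mem hη (MonoidHom.isOfFinOrder _ hη'), z, hz, ?_⟩
    rw [map_mul, mul_assoc, units_map_map (incl_comp_incl h (Nat.le_succ n))]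

theorem imagUnits_eq {n : ℕ} (h : n₀ ≤ n) : imagUnits ℓ (layer ℓ L n) =
    CommGroup.torsion (layer ℓ L n)ˣ ⊔
      (imagUnits ℓ (layer ℓ L n₀)).map (Units.map (incl ℓ L h).toMonoidHom) := by
  have hℓ := (Fact.out : ℓ.Prime).ne_zero
  refine le_antisymm (fun x hx ↦ ?_) (sup_le (torsion_le_imagUnits hℓ) ?_)
  · obtain ⟨η, hη, y, hy, rfl⟩ := exists_torsion_mul_eq hram hμ hodd h hx
    exact Subgroup.mul_mem_sup hη (Subgroup.mem_map_of_mem _ hy)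
  · rintro _ ⟨y, hy, rfl⟩
    exact (map_mem_imagUnits_iff hℓ (incl_comp_conj ℓ L h)).mpr hy

end Imaginary

section Classes

variable {ℓ : ℕ} [Fact ℓ.Prime] {L : IntermediateField ℚ ℂ} [NumberField L] {n₀ : ℕ}
  (hram : TotallyRamifiedFrom ℓ L n₀)

noncomputable instance fintypePlacesAbove (K : Type*) [Field K] [NumberField K] :
    Fintype (placesAbove ℓ K) :=
  (finite_placesAbove (Fact.out : ℓ.Prime).ne_zero K).fintype

/-- The ideal class of a place. -/
noncomputable def placeClass {K : Type*} [Field K] [NumberField K] (v : HeightOneSpectrum (𝓞 K)) :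
    ClassGroup (𝓞 K) :=
  ClassGroup.mk0 ⟨v.asIdeal, mem_nonZeroDivisors_iff_ne_zero.mpr v.ne_bot⟩

theorem fieldClassMap_placeClass {K M : Type*} [Field K] [NumberField K] [Field M] [NumberField M]
    {f : K →+* M} {v : HeightOneSpectrum (𝓞 K)} {w : HeightOneSpectrum (𝓞 M)} {e : ℕ}
    (h : v.asIdeal.map (RingOfIntegers.mapRingHom f) = w.asIdeal ^ e) :
    fieldClassMap f (placeClass v) = placeClass w ^ e := by
  rw [placeClass, fieldClassMap, classMap_mk0, placeClass, ← map_pow]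
  exact congrArg _ (Subtype.ext h)

theorem fieldClassNorm_placeClass {K M : Type*} [Field K] [NumberField K] [Field M] [NumberField M]
    {f : K →+* M} {v : HeightOneSpectrum (𝓞 K)} {w : HeightOneSpectrum (𝓞 M)} {D : ℕ}
    (hD : Module.finrank ℚ M = D * Module.finrank ℚ K) (hD0 : D ≠ 0)
    (h : v.asIdeal.map (RingOfIntegers.mapRingHom f) = w.asIdeal ^ D) :
    fieldClassNorm f (placeClass w) = placeClass v := by
  let : Algebra K M := f.toAlgebra
  rw [fieldClassNorm, placeClass, classNorm_mk0, placeClass]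
  exact congrArg _ (Subtype.ext (relNorm_eq_of_map_eq_pow hD hD0 h))

/-- The class of a divisor built on the places above `ℓ`, in terms of its exponents. -/
noncomputable def classOf {ι : Type*} [Fintype ι] {K : Type*} [Field K] [NumberField K]
    (W : ι → HeightOneSpectrum (𝓞 K)) (a : ι → ℤ) : ClassGroup (𝓞 K) := ∏ i, placeClass (W i) ^ a i

theorem classOf_eq_one_iff {ι : Type*} [Fintype ι] {K : Type*} [Field K] [NumberField K]
    (W : ι → HeightOneSpectrum (𝓞 K)) (a : ι → ℤ) :
    classOf W a = 1 ↔ divOf W a ∈ (toPrincipalIdeal (𝓞 K) K).range := by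
  rw [← classGroupMk_eq_one_iff, divOf, map_prod]
  simp only [map_zpow, classGroupMk_primeDivisor]
  rfl

theorem classOf_smul {ι : Type*} [Fintype ι] {K : Type*} [Field K] [NumberField K]
    (W : ι → HeightOneSpectrum (𝓞 K)) (k : ℤ) (a : ι → ℤ) :
    classOf W (k • a) = classOf W a ^ k := by
  simp only [classOf, Pi.smul_apply, smul_eq_mul, ← Finset.prod_zpow, ← zpow_mul, mul_comm]

theorem fieldClassNorm_classOf (hμ : ∃ ζ : L, IsPrimitiveRoot ζ ℓ) {n m : ℕ} (h : n₀ ≤ n)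
    (h' : n ≤ m) (a : placesAbove ℓ (layer ℓ L n₀) → ℤ) :
    fieldClassNorm (incl ℓ L h') (classOf (placeAt hram (h.trans h')) a) =
      classOf (placeAt hram h) a := by
  simp only [classOf, map_prod, map_zpow]
  refine Finset.prod_congr rfl fun v _ ↦ ?_
  rw [fieldClassNorm_placeClass (finrank_layer_of_totallyRamified hram hμ h h')
    (pow_prime_ne_zero ℓ _) (map_placeAt hram h h' v)]

theorem divisorMap_incl_divOf {n m : ℕ} (h : n₀ ≤ n) (h' : n ≤ m)
    (a : placesAbove ℓ (layer ℓ L n₀) → ℤ) :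
    divisorMap (incl ℓ L h') (divOf (placeAt hram h) a) =
      divOf (placeAt hram (h.trans h')) (((ℓ ^ (m - n) : ℕ) : ℤ) • a) :=
  divisorMap_divOf _ (map_placeAt hram h h') a

theorem divisorMap_conj_divOf [ConjStable L] {n : ℕ} (h : n₀ ≤ n)
    (a : placesAbove ℓ (layer ℓ L n₀) → ℤ) :
    divisorMap (conj (layer ℓ L n)) (divOf (placeAt hram h) a) =
      divOf (placeAt hram h) (a ∘ placeConj ℓ _) := by
  have hτ : Function.Involutive (placeConj ℓ (layer ℓ L n₀)) := placeConj_placeConj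
  simp only [divOf, map_prod, map_zpow]
  refine Fintype.prod_equiv hτ.toPerm _ _ fun v ↦ ?_
  rw [divisorMap_primeDivisor _ (e := 1) (by rw [map_conj_placeAt hram h, pow_one]), pow_one,
    Function.Involutive.coe_toPerm, Function.comp_apply, hτ]

theorem divOf_placeAt_mem [ConjStable L] {n : ℕ} (h : n₀ ≤ n)
    {a : placesAbove ℓ (layer ℓ L n₀) → ℤ} :
    divOf (placeAt hram h) a ∈ imagPrincipalDivisors ℓ (layer ℓ L n) ↔
      classOf (placeAt hram h) a = 1 ∧ a ∘ placeConj ℓ _ = -a := by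
  have h1 : divOf (placeAt hram h) a ∈ ellDivisors ℓ (layer ℓ L n) :=
    (mem_ellDivisors_iff_exists_divOf (Fact.out : ℓ.Prime).ne_zero (placeAt_injective hram h)
      (range_placeAt hram h)).mpr ⟨a, rfl⟩
  have h2 : divOf (placeAt hram h) a ∈ MonoidHom.eqLocus (divisorMap (conj (layer ℓ L n)))
      (invMonoidHom : Divisors (layer ℓ L n) →* Divisors (layer ℓ L n)) ↔
      a ∘ placeConj ℓ _ = -a := by
    change divisorMap _ _ = (divOf _ _)⁻¹ ↔ _
    rw [divisorMap_conj_divOf, ← divOf_neg, (divOf_injective (placeAt_injective hram h)).eq_iff]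
  rw [imagPrincipalDivisors, Subgroup.mem_inf, Subgroup.mem_inf, h2, classOf_eq_one_iff]
  exact ⟨fun h ↦ ⟨h.1.2, h.2⟩, fun h ↦ ⟨⟨h1, h.1⟩, h.2⟩⟩

/-- An imaginary divisor built on the places above `ℓ` of `L_n` that is principal is the extension
of a principal one of `L_{n₀}`. -/
theorem exists_eq_smul_of_classOf_eq_one [IsCMField L] (hμ : ∃ ζ : L, IsPrimitiveRoot ζ ℓ)
    (hodd : ℓ ≠ 2) {n : ℕ} (h : n₀ ≤ n) {a : placesAbove ℓ (layer ℓ L n₀) → ℤ}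
    (ha : a ∘ placeConj ℓ _ = -a) (hcl : classOf (placeAt hram h) a = 1) :
    ∃ b, b ∘ placeConj ℓ _ = -b ∧ classOf (placeAt hram le_rfl) b = 1 ∧
      a = ((ℓ ^ (n - n₀) : ℕ) : ℤ) • b := by
  have hp : ℓ.Prime := Fact.out
  have hodd' : Odd (ℓ ^ (n - n₀)) := (hp.odd_of_ne_two hodd).pow
  have hinj := divOf_injective (placeAt_injective hram h)
  obtain ⟨x, hx⟩ := (classOf_eq_one_iff _ _).mp hcl
  -- `x / x̄` is an imaginary `ℓ`-unit, with divisor twice that of `x`.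
  set xc : (layer ℓ L n)ˣ := Units.map (conj (layer ℓ L n)).toMonoidHom x with hxc
  have hxcD : toPrincipalIdeal (𝓞 (layer ℓ L n)) (layer ℓ L n) xc =
      divOf (placeAt hram h) (-a) := by
    rw [hxc, ← divisorMap_toPrincipalIdeal, hx, divisorMap_conj_divOf, ha]
  have hyD : toPrincipalIdeal (𝓞 (layer ℓ L n)) (layer ℓ L n) (x / xc) =
      divOf (placeAt hram h) ((2 : ℤ) • a) := by
    rw [map_div, hx, hxcD, divOf_neg, div_inv_eq_mul, ← divOf_add, two_smul]
  have hy : x / xc ∈ imagUnits ℓ (layer ℓ L n) := by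
    rw [mem_imagUnits_iff hp.ne_zero, hyD, mem_ellDivisors_iff_exists_divOf hp.ne_zero
      (placeAt_injective hram h) (range_placeAt hram h)]
    refine ⟨⟨_, rfl⟩, ?_⟩
    have h1 : conj (layer ℓ L n) ((x / xc : (layer ℓ L n)ˣ) : layer ℓ L n) =
        ((xc / x : (layer ℓ L n)ˣ) : layer ℓ L n) := by
      rw [Units.val_div_eq_div_val, Units.val_div_eq_div_val, map_div₀]
      exact congrArg _ (conj_conj _)
    rw [h1, ← Units.val_mul, div_mul_div_cancel, div_self', Units.val_one]
  obtain ⟨η, hη, z, hz, hyz⟩ := exists_torsion_mul_eq hram hμ hodd h hy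
  obtain ⟨k, hk, hηk⟩ := isOfFinOrder_iff_pow_eq_one.mp hη
  obtain ⟨b, hb⟩ := (mem_ellDivisors_iff_exists_divOf hp.ne_zero
    (placeAt_injective hram le_rfl) (range_placeAt hram le_rfl)).mp
      ((mem_imagUnits_iff hp.ne_zero).mp hz).1
  have h2a : (2 : ℤ) • a = ((ℓ ^ (n - n₀) : ℕ) : ℤ) • b := by
    refine hinj ?_
    rw [← hyD, hyz, map_mul, toPrincipalIdeal_eq_one_of_pow_eq_one hk.ne' hηk, one_mul,
      ← divisorMap_toPrincipalIdeal, hb, divisorMap_incl_divOf]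
  -- As `ℓ` is odd, `b` is even.
  have heven (v) : ∃ c, b v = 2 * c := by
    have h1 := congrFun h2a v
    simp only [Pi.smul_apply, smul_eq_mul] at h1
    have h2 : (2 : ℤ) ∣ (ℓ ^ (n - n₀) : ℕ) * b v := ⟨a v, h1.symm⟩
    refine (IsCoprime.dvd_of_dvd_mul_left ?_ h2)
    exact (Nat.isCoprime_iff_coprime (m := 2)).mpr (Nat.coprime_two_left.mpr hodd')
  choose b' hb' using heven
  have hbb : b = (2 : ℤ) • b' := funext hb'
  have hab : a = ((ℓ ^ (n - n₀) : ℕ) : ℤ) • b' := by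
    rw [hbb, smul_comm] at h2a
    exact smul_right_injective _ (two_ne_zero (α := ℤ)) h2a
  have hne : ((ℓ ^ (n - n₀) : ℕ) : ℤ) ≠ 0 := by exact_mod_cast pow_prime_ne_zero ℓ _
  refine ⟨b', ?_, ?_, hab⟩
  · refine smul_right_injective _ hne ?_
    simp only
    rw [smul_neg, ← hab, ← ha, hab]; rfl
  -- The class of `b'` is killed by `2`, as `2 b'` is the divisor of `z`, and by a power of `ℓ`, as
  -- its multiple `a` is principal in `L_n` and hence, by the norm, in `L_{n₀}`.
  · have h1 : classOf (placeAt hram le_rfl) b' ^ (2 : ℤ) = 1 := by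
      rw [← classOf_smul, ← hbb, classOf_eq_one_iff]
      exact ⟨z, hb⟩
    have h2 : classOf (placeAt hram le_rfl) b' ^ ((ℓ ^ (n - n₀) : ℕ) : ℤ) = 1 := by
      rw [← classOf_smul, ← hab, ← fieldClassNorm_classOf hram hμ le_rfl h, hcl, map_one]
    have hcop : IsCoprime (2 : ℤ) ((ℓ ^ (n - n₀) : ℕ) : ℤ) :=
      (Nat.isCoprime_iff_coprime (m := 2)).mpr (Nat.coprime_two_left.mpr hodd')
    obtain ⟨u, w, huw⟩ := hcop
    rw [← zpow_one (classOf _ _), ← huw, zpow_add, mul_comm u, mul_comm w, zpow_mul, zpow_mul, h1,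
      h2, one_zpow, one_zpow, one_mul]

include hram in
theorem imagPrincipalDivisors_eq [IsCMField L] (hμ : ∃ ζ : L, IsPrimitiveRoot ζ ℓ)
    (hodd : ℓ ≠ 2) {n : ℕ} (h : n₀ ≤ n) : imagPrincipalDivisors ℓ (layer ℓ L n) =
      (imagPrincipalDivisors ℓ (layer ℓ L n₀)).map (divisorMap (incl ℓ L h)) := by
  have hℓ : ℓ ≠ 0 := (Fact.out : ℓ.Prime).ne_zero
  refine le_antisymm (fun D hD ↦ ?_) ?_
  · obtain ⟨a, rfl⟩ := (mem_ellDivisors_iff_exists_divOf hℓ (placeAt_injective hram h)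
      (range_placeAt hram h)).mp hD.1.1
    obtain ⟨hcl, ha⟩ := (divOf_placeAt_mem hram h).mp hD
    obtain ⟨b, hb, hbcl, rfl⟩ := exists_eq_smul_of_classOf_eq_one hram hμ hodd h ha hcl
    exact ⟨_, (divOf_placeAt_mem hram le_rfl).mpr ⟨hbcl, hb⟩, divisorMap_incl_divOf hram le_rfl h b⟩
  · rintro _ ⟨D, hD, rfl⟩
    obtain ⟨⟨hD1, x, hx⟩, hD2⟩ := hD
    refine ⟨⟨(divisorMap_mem_ellDivisors_iff hℓ _).mpr hD1,
      ⟨Units.map (incl ℓ L h).toMonoidHom x, ?_⟩⟩, ?_⟩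
    · rw [← divisorMap_toPrincipalIdeal, hx]
    · change divisorMap _ _ = (divisorMap _ D)⁻¹
      rw [divisorMap_divisorMap, incl_comp_conj, ← divisorMap_divisorMap, ← map_inv]
      exact congrArg _ hD2

end Classes

/-! ### Limits of quotients of a free `ℤ_ℓ`-module -/

section PadicModules

variable {ℓ : ℕ} [Fact ℓ.Prime]

theorem mem_maximalIdeal_pow_smul_top_iff {M : Type*} [AddCommGroup M] [Module ℤ_[ℓ] M] {n : ℕ}
    {x : M} : x ∈ (IsLocalRing.maximalIdeal ℤ_[ℓ] ^ n • ⊤ : Submodule ℤ_[ℓ] M) ↔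
      ∃ y, x = (ℓ : ℤ_[ℓ]) ^ n • y := by
  rw [PadicInt.maximalIdeal_eq_span_p, Ideal.span_singleton_pow,
    Submodule.ideal_span_singleton_smul, Submodule.mem_smul_pointwise_iff_exists]
  exact ⟨fun ⟨y, _, hy⟩ ↦ ⟨y, hy.symm⟩, fun ⟨y, hy⟩ ↦ ⟨y, trivial, hy.symm⟩⟩

theorem eq_zero_of_forall_pow_dvd {a : ℤ_[ℓ]} (h : ∀ n : ℕ, (ℓ : ℤ_[ℓ]) ^ n ∣ a) : a = 0 := by
  refine IsHausdorff.haus (I := IsLocalRing.maximalIdeal ℤ_[ℓ]) inferInstance a fun n ↦ ?_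
  rw [SModEq.zero, mem_maximalIdeal_pow_smul_top_iff]
  exact h n

theorem isPrecomplete_pi (ι : Type*) :
    IsPrecomplete (IsLocalRing.maximalIdeal ℤ_[ℓ]) (ι → ℤ_[ℓ]) where
  prec' f hf := by
    have h (i : ι) : ∃ a : ℤ_[ℓ], ∀ n,
        f n i ≡ a [SMOD (IsLocalRing.maximalIdeal ℤ_[ℓ] ^ n • ⊤ : Submodule ℤ_[ℓ] ℤ_[ℓ])] := by
      refine IsPrecomplete.prec inferInstance fun {m n} hmn ↦ ?_
      have := hf hmn
      rw [SModEq.sub_mem, mem_maximalIdeal_pow_smul_top_iff] at this ⊢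
      obtain ⟨y, hy⟩ := this
      exact ⟨y i, congrFun hy i⟩
    choose a ha using h
    refine ⟨a, fun n ↦ ?_⟩
    rw [SModEq.sub_mem, mem_maximalIdeal_pow_smul_top_iff]
    have h2 (i : ι) := ha i n
    simp only [SModEq.sub_mem, mem_maximalIdeal_pow_smul_top_iff] at h2
    choose y hy using h2
    exact ⟨y, funext hy⟩

/-- A finite free module over `ℤ_ℓ` is complete. -/
theorem exists_limit_of_free {M : Type*} [AddCommGroup M] [Module ℤ_[ℓ] M] [Module.Free ℤ_[ℓ] M]
    [Module.Finite ℤ_[ℓ] M] (f : ℕ → M) (hf : ∀ k, ∃ p, f (k + 1) - f k = (ℓ : ℤ_[ℓ]) ^ k • p) :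
    ∃ x, ∀ k, ∃ p, x - f k = (ℓ : ℤ_[ℓ]) ^ k • p := by
  let e := (Module.finBasis ℤ_[ℓ] M).equivFun
  have := isPrecomplete_pi (ℓ := ℓ) (Fin (Module.finrank ℤ_[ℓ] M))
  obtain ⟨x, hx⟩ := this.prec (f := fun k ↦ e (f k)) fun {m n} hmn ↦ by
    rw [SModEq.sub_mem, ← neg_mem_iff, neg_sub]
    induction n, hmn using Nat.le_induction with
    | base => rw [sub_self]; exact zero_mem _
    | succ n hmn ih =>
      obtain ⟨p, hp⟩ := hf n
      rw [← sub_add_sub_cancel _ (e (f n))]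
      refine add_mem (mem_maximalIdeal_pow_smul_top_iff.mpr ⟨(ℓ : ℤ_[ℓ]) ^ (n - m) • e p, ?_⟩) ih
      rw [← map_sub, hp, map_smul, smul_smul, ← pow_add, Nat.add_sub_cancel' hmn]
  refine ⟨e.symm x, fun k ↦ ?_⟩
  have h := hx k
  rw [SModEq.sub_mem, mem_maximalIdeal_pow_smul_top_iff] at h
  obtain ⟨p, hp⟩ := h
  refine ⟨e.symm (-p), e.injective ?_⟩
  rw [map_sub, map_smul, e.apply_symm_apply, e.apply_symm_apply, smul_neg, ← hp, neg_sub]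

theorem zmultiplesHom_one_div_apply_self :
    zmultiplesHom _ (((1 / ℓ : ℚ)) : AddCircle (1 : ℚ)) (ℓ : ℤ) = 0 := by
  have : (ℓ : ℚ) ≠ 0 := by exact_mod_cast (Fact.out : ℓ.Prime).ne_zero
  rw [zmultiplesHom_apply, ← AddCircle.coe_zsmul, AddCircle.coe_eq_zero_iff]
  exact ⟨1, by simp [this]⟩

variable (ℓ) in
/-- The character `a ↦ (a mod ℓ) / ℓ` of `ℤ_ℓ`. -/
noncomputable def modChar : ℤ_[ℓ] →+ AddCircle (1 : ℚ) :=
  (ZMod.lift ℓ ⟨_, zmultiplesHom_one_div_apply_self⟩).comp PadicInt.toZMod.toAddMonoidHom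

theorem modChar_eq_zero_iff {a : ℤ_[ℓ]} : modChar ℓ a = 0 ↔ (ℓ : ℤ_[ℓ]) ∣ a := by
  have hℓ : (ℓ : ℚ) ≠ 0 := by exact_mod_cast (Fact.out : ℓ.Prime).ne_zero
  have h : Function.Injective (ZMod.lift ℓ ⟨_, zmultiplesHom_one_div_apply_self⟩) := by
    rw [ZMod.lift_injective]
    intro m hm
    rw [zmultiplesHom_apply, ← AddCircle.coe_zsmul, AddCircle.coe_eq_zero_iff] at hm
    obtain ⟨k, hk⟩ := hm
    rw [ZMod.intCast_zmod_eq_zero_iff_dvd]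
    refine ⟨k, ?_⟩
    simp only [zsmul_eq_mul, mul_one] at hk
    field_simp at hk
    rw [mul_comm]
    exact_mod_cast hk.symm
  rw [modChar, AddMonoidHom.comp_apply, map_eq_zero_iff _ h, ← Ideal.mem_span_singleton,
    ← PadicInt.maximalIdeal_eq_span_p, ← PadicInt.ker_toZMod]
  rfl

theorem exists_modChar_eq {t : AddCircle (1 : ℚ)} (ht : ℓ • t = 0) :
    ∃ m : ℤ_[ℓ], modChar ℓ m = t := by
  have hℓ : (ℓ : ℚ) ≠ 0 := by exact_mod_cast (Fact.out : ℓ.Prime).ne_zero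
  obtain ⟨q, rfl⟩ := QuotientAddGroup.mk_surjective t
  change ℓ • (q : AddCircle (1 : ℚ)) = 0 at ht
  rw [← AddCircle.coe_nsmul, AddCircle.coe_eq_zero_iff] at ht
  obtain ⟨k, hk⟩ := ht
  refine ⟨(k : ℤ_[ℓ]), ?_⟩
  have : modChar ℓ (1 : ℤ_[ℓ]) = ((1 / ℓ : ℚ) : AddCircle (1 : ℚ)) := by
    have h1 : (1 : ZMod ℓ) = ((1 : ℤ) : ZMod ℓ) := by simp
    change ZMod.lift ℓ ⟨_, zmultiplesHom_one_div_apply_self⟩ (PadicInt.toZMod (1 : ℤ_[ℓ])) = _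
    rw [map_one, h1, ZMod.lift_coe]
    simp
  have h2 : (k : ℤ_[ℓ]) = k • (1 : ℤ_[ℓ]) := by simp
  rw [h2, map_zsmul, this, ← AddCircle.coe_zsmul]
  congr 1
  simp only [zsmul_eq_mul, nsmul_eq_mul, mul_one] at hk ⊢
  rw [hk]; field_simp

theorem exists_nsmul_eq_smul {X : Type*} [AddCommGroup X] [Module ℤ_[ℓ] X] {x : X}
    (hx : (ℓ : ℤ_[ℓ]) • x = 0) (a : ℤ_[ℓ]) : ∃ n : ℕ, a • x = n • x := by
  have h := PadicInt.sub_zmodRepr_mem a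
  rw [PadicInt.maximalIdeal_eq_span_p, Ideal.mem_span_singleton] at h
  obtain ⟨c, hc⟩ := h
  refine ⟨a.zmodRepr, ?_⟩
  rw [← Nat.cast_smul_eq_nsmul ℤ_[ℓ], ← sub_eq_zero, ← sub_smul, hc, mul_comm, mul_smul, hx,
    smul_zero]

/-- The inductive limit of the quotients of a free module `P` by the `ℓ^k P`, the transition maps
being the multiplications by `ℓ`, is divisible of codimension the rank of `P`.

The dual is torsion free and `ℓ`-adically separated, and modulo `ℓ` it is the dual of the
`ℓ`-torsion of the limit, which is `P / ℓ P`; so characters that form there a basis form a basis by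
the topological Nakayama lemma. -/
theorem isDivisibleOfCodim_of_free {P X : Type*} [AddCommGroup P] [Module ℤ_[ℓ] P]
    [Module.Free ℤ_[ℓ] P] [Module.Finite ℤ_[ℓ] P] [AddCommGroup X] [Module ℤ_[ℓ] X]
    (Ψ : ℕ → P →ₗ[ℤ_[ℓ]] X) (hΨ : ∀ k p, Ψ (k + 1) ((ℓ : ℤ_[ℓ]) • p) = Ψ k p)
    (hker : ∀ k p, Ψ k p = 0 ↔ ∃ q, p = (ℓ : ℤ_[ℓ]) ^ k • q) (hsurj : ∀ x, ∃ k p, Ψ k p = x) :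
    IsDivisibleOfCodim ℓ (Module.finrank ℤ_[ℓ] P) X := by
  have hΨ' (k j p) : Ψ (k + j) ((ℓ : ℤ_[ℓ]) ^ j • p) = Ψ k p := by
    induction j with
    | zero => simp
    | succ j ih => rw [pow_succ', mul_smul, ← add_assoc, hΨ, ih]
  have hpow (n : ℕ) (x : X) : ∃ y : X, (ℓ : ℤ_[ℓ]) ^ n • y = x := by
    obtain ⟨k, p, rfl⟩ := hsurj x
    exact ⟨Ψ (k + n) p, by rw [← map_smul, hΨ']⟩
  have hdiv : ∀ a : ℤ_[ℓ], a ≠ 0 → ∀ x : X, ∃ y : X, a • y = x := fun a ha x ↦ by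
    obtain ⟨y, hy⟩ := hpow a.valuation x
    refine ⟨((PadicInt.unitCoeff ha)⁻¹ : ℤ_[ℓ]ˣ) • y, ?_⟩
    have h := PadicInt.unitCoeff_spec ha
    generalize PadicInt.unitCoeff ha = u at h ⊢
    rw [h, mul_comm, mul_smul, ← Units.smul_def, smul_inv_smul, hy]
  refine ⟨hdiv, ?_⟩
  have hℓ0 : (ℓ : ℤ_[ℓ]) ≠ 0 := by exact_mod_cast (Fact.out : ℓ.Prime).ne_zero
  have htors (x : X) (hx : (ℓ : ℤ_[ℓ]) • x = 0) : ∃ p, Ψ 1 p = x := by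
    obtain ⟨k, p, rfl⟩ := hsurj x
    rw [← map_smul, hker] at hx
    obtain ⟨q, hq⟩ := hx
    cases k with
    | zero => exact ⟨0, by rw [map_zero, (hker 0 p).mpr ⟨p, by simp⟩]⟩
    | succ k =>
      rw [pow_succ', mul_smul] at hq
      exact ⟨q, by rw [smul_right_injective P hℓ0 hq, add_comm, hΨ']⟩
  have hΨ1 (p) : (ℓ : ℤ_[ℓ]) • Ψ 1 p = 0 := by
    rw [← map_smul, hker]; exact ⟨p, by rw [pow_one]⟩
  set b := Module.finBasis ℤ_[ℓ] P
  -- The characters dual to the basis `Ψ 1 (b i)` of the `ℓ`-torsion of `X`.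
  have hy (i) : ∃ y : CharacterModule X, ∀ p, y (Ψ 1 p) = modChar ℓ (b.repr p i) := by
    let g : P →+ LinearMap.range (Ψ 1) := (Ψ 1).rangeRestrict.toAddMonoidHom
    have hg : Function.Surjective g := (Ψ 1).surjective_rangeRestrict
    let c : P →+ AddCircle (1 : ℚ) := (modChar ℓ).comp (b.coord i).toAddMonoidHom
    have hc : g.ker ≤ c.ker := fun p hp ↦ by
      have hp' : Ψ 1 p = 0 := congrArg Subtype.val (show g p = 0 from hp)
      obtain ⟨q, rfl⟩ := (hker 1 p).mp hp'
      change modChar ℓ (b.repr _ i) = 0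
      rw [modChar_eq_zero_iff, map_smul, Finsupp.smul_apply, pow_one]
      exact ⟨_, rfl⟩
    obtain ⟨y, hy⟩ := CharacterModule.dual_surjective_of_injective
      (LinearMap.range (Ψ 1)).subtype Subtype.val_injective
      (AddMonoidHom.liftOfSurjective g hg ⟨c, hc⟩ : _ →+ AddCircle (1 : ℚ))
    refine ⟨y, fun p ↦ ?_⟩
    have h := DFunLike.congr_fun hy (g p)
    refine h.trans ?_
    exact AddMonoidHom.liftOfRightInverse_comp_apply g _ _ ⟨c, hc⟩ p
  choose y hy using hy
  let T := Fintype.linearCombination ℤ_[ℓ] y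
  have hT (a p) : T a (Ψ 1 p) = modChar ℓ (∑ i, a i * b.repr p i) := by
    rw [Fintype.linearCombination_apply, map_sum]
    let ev : CharacterModule X →+ AddCircle (1 : ℚ) :=
      { toFun := fun y ↦ y (Ψ 1 p), map_zero' := rfl, map_add' := fun _ _ ↦ rfl }
    change ev (∑ i, a i • y i) = _
    rw [map_sum]
    refine Finset.sum_congr rfl fun i _ ↦ ?_
    change (a i • y i) (Ψ 1 p) = _
    rw [CharacterModule.smul_apply, ← map_smul, hy, map_smul, Finsupp.smul_apply, smul_eq_mul]
  have hYtors (y : CharacterModule X) (h : (ℓ : ℤ_[ℓ]) • y = 0) : y = 0 := by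
    refine DFunLike.ext _ _ fun x ↦ ?_
    obtain ⟨z, rfl⟩ := hdiv _ hℓ0 x
    rw [← CharacterModule.smul_apply, h]
    rfl
  have hTinj : Function.Injective T := by
    rw [injective_iff_map_eq_zero]
    have key (n : ℕ) : ∀ a, T a = 0 → ∃ a', a = (ℓ : ℤ_[ℓ]) ^ n • a' := by
      induction n with
      | zero => exact fun a _ ↦ ⟨a, by simp⟩
      | succ n ih =>
        intro a ha
        have h1 (i) : ∃ c, a i = (ℓ : ℤ_[ℓ]) * c := by
          have := hT a (b i)
          rw [ha] at this
          simp only [Module.Basis.repr_self, Finsupp.single_apply, mul_ite, mul_one, mul_zero,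
            Finset.sum_ite_eq, Finset.mem_univ, if_true] at this
          exact modChar_eq_zero_iff.mp this.symm
        choose c hc using h1
        have hac : a = (ℓ : ℤ_[ℓ]) • c := funext hc
        obtain ⟨c', rfl⟩ := ih c (hYtors _ (by rw [← map_smul, ← hac, ha]))
        exact ⟨c', by rw [hac, smul_smul, pow_succ']⟩
    intro a ha
    refine funext fun i ↦ eq_zero_of_forall_pow_dvd fun n ↦ ?_
    obtain ⟨a', rfl⟩ := key n a ha
    exact ⟨a' i, rfl⟩
  have hTsurj : Function.Surjective T := by
    have h1 := isPrecomplete_pi (ℓ := ℓ) (Fin (Module.finrank ℤ_[ℓ] P))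
    have h2 : IsHausdorff (IsLocalRing.maximalIdeal ℤ_[ℓ]) (CharacterModule X) := by
      refine ⟨fun y hy ↦ DFunLike.ext _ _ fun x ↦ ?_⟩
      obtain ⟨k, p, rfl⟩ := hsurj x
      have h := hy k
      rw [SModEq.zero, mem_maximalIdeal_pow_smul_top_iff] at h
      obtain ⟨z, rfl⟩ := h
      rw [CharacterModule.smul_apply, ← map_smul, (hker _ _).mpr ⟨p, rfl⟩, map_zero]
      rfl
    refine surjective_of_mkQ_comp_surjective (I := IsLocalRing.maximalIdeal ℤ_[ℓ]) ?_
    intro z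
    obtain ⟨z, rfl⟩ := Submodule.mkQ_surjective _ z
    have hm (i) : ∃ m, modChar ℓ m = z (Ψ 1 (b i)) := by
      refine exists_modChar_eq ?_
      rw [← map_nsmul, ← Nat.cast_smul_eq_nsmul ℤ_[ℓ], hΨ1, map_zero]
    choose m hm using hm
    refine ⟨m, ?_⟩
    rw [LinearMap.comp_apply, Submodule.mkQ_apply, Submodule.mkQ_apply, eq_comm,
      Submodule.Quotient.eq]
    -- The difference vanishes on the `ℓ`-torsion of `X`, so it is a multiple of `ℓ`.
    set w := z - T m with hw
    have hw1 (p) : w (Ψ 1 p) = 0 := by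
      rw [← b.sum_repr p, map_sum, map_sum]
      refine Finset.sum_eq_zero fun i _ ↦ ?_
      obtain ⟨n, hn⟩ := exists_nsmul_eq_smul (hΨ1 (b i)) (b.repr p i)
      rw [map_smul, hn, map_nsmul]
      suffices w (Ψ 1 (b i)) = 0 by rw [this, smul_zero]
      change z _ - T m _ = 0
      rw [hT, ← hm]
      simp [Finsupp.single_apply]
    let μ : X →+ X := DistribSMul.toAddMonoidHom X (ℓ : ℤ_[ℓ])
    have hμ : Function.Surjective μ := hdiv _ hℓ0
    have hμw : μ.ker ≤ AddMonoidHom.ker (w : X →+ AddCircle (1 : ℚ)) := fun x hx ↦ by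
      obtain ⟨p, rfl⟩ := htors x hx
      exact hw1 p
    let w' : CharacterModule X := AddMonoidHom.liftOfSurjective μ hμ ⟨w, hμw⟩
    rw [← pow_one (IsLocalRing.maximalIdeal ℤ_[ℓ]), mem_maximalIdeal_pow_smul_top_iff]
    refine ⟨w', DFunLike.ext _ _ fun x ↦ ?_⟩
    rw [pow_one, CharacterModule.smul_apply]
    exact (AddMonoidHom.liftOfRightInverse_comp_apply μ _ _ ⟨w, hμw⟩ x).symm
  let e := LinearEquiv.ofBijective T ⟨hTinj, hTsurj⟩
  exact ⟨Module.Free.of_equiv e, Module.Finite.equiv e, by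
    rw [← e.finrank_eq, Module.finrank_fin_fun]⟩

theorem finrank_eq_of_forall_smul_mem {F : Type*} [AddCommGroup F] [Module ℤ_[ℓ] F]
    [Module.Free ℤ_[ℓ] F] [Module.Finite ℤ_[ℓ] F] {P : Submodule ℤ_[ℓ] F} {N : ℕ}
    (hN : ∀ f, (ℓ : ℤ_[ℓ]) ^ N • f ∈ P) : Module.finrank ℤ_[ℓ] P = Module.finrank ℤ_[ℓ] F := by
  refine le_antisymm (Submodule.finrank_le P) ?_
  have hℓ0 : (ℓ : ℤ_[ℓ]) ^ N ≠ 0 :=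
    pow_ne_zero _ (by exact_mod_cast (Fact.out : ℓ.Prime).ne_zero)
  refine LinearMap.finrank_le_finrank_of_injective
    (f := (LinearMap.lsmul ℤ_[ℓ] F ((ℓ : ℤ_[ℓ]) ^ N)).codRestrict P hN) fun x y h ↦ ?_
  exact smul_right_injective F hℓ0 (congrArg Subtype.val h)

/-- A version of `isDivisibleOfCodim_of_free` for the limit of the quotients of `F` by the `ℓ^k P`,
where `P` is a lattice in `F`. -/
theorem isDivisibleOfCodim_of_lattice {F X : Type*} [AddCommGroup F] [Module ℤ_[ℓ] F]
    [Module.Free ℤ_[ℓ] F] [Module.Finite ℤ_[ℓ] F] [AddCommGroup X] [Module ℤ_[ℓ] X]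
    (P : Submodule ℤ_[ℓ] F) {N : ℕ} (hN : ∀ f, (ℓ : ℤ_[ℓ]) ^ N • f ∈ P)
    (Φ : ℕ → F →ₗ[ℤ_[ℓ]] X) (hΦ : ∀ k f, Φ (k + 1) ((ℓ : ℤ_[ℓ]) • f) = Φ k f)
    (hker : ∀ k f, Φ k f = 0 ↔ ∃ q ∈ P, f = (ℓ : ℤ_[ℓ]) ^ k • q) (hsurj : ∀ x, ∃ k f, Φ k f = x) :
    IsDivisibleOfCodim ℓ (Module.finrank ℤ_[ℓ] F) X := by
  have hΦ' (k j f) : Φ (k + j) ((ℓ : ℤ_[ℓ]) ^ j • f) = Φ k f := by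
    induction j with
    | zero => simp
    | succ j ih => rw [pow_succ', mul_smul, ← add_assoc, hΦ, ih]
  rw [← finrank_eq_of_forall_smul_mem hN]
  refine isDivisibleOfCodim_of_free (fun k ↦ Φ k ∘ₗ P.subtype) (fun k p ↦ hΦ k p)
    (fun k p ↦ (hker k p).trans ⟨fun ⟨q, hq, h⟩ ↦ ⟨⟨q, hq⟩, Subtype.ext h⟩,
      fun ⟨q, h⟩ ↦ ⟨q, q.2, congrArg Subtype.val h⟩⟩) fun x ↦ ?_
  obtain ⟨k, f, rfl⟩ := hsurj x
  exact ⟨k + N, ⟨_, hN f⟩, hΦ' k N f⟩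

/-- The projective limit `Z` of the quotients of a free module `F` by the submodules `ℓ^k P` is `F`,
by completeness of `P`. The quotient by `ℓ^k P` is given as the image of `F` in a module `A k`
under the composite of the comparison map `Λ` and of the component `pr k` of `Z`. -/
theorem isFreeOfRank_of_bijective_limit {F : Type*} [AddCommGroup F] [Module ℤ_[ℓ] F]
    [Module.Free ℤ_[ℓ] F] [Module.Finite ℤ_[ℓ] F] (P : Submodule ℤ_[ℓ] F)
    {Z : Type*} [AddCommGroup Z] [Module ℤ_[ℓ] Z] {A : ℕ → Type*} [∀ k, AddCommGroup (A k)]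
    [∀ k, Module ℤ_[ℓ] (A k)] (Λ : F →ₗ[ℤ_[ℓ]] Z) (pr : ∀ k, Z →ₗ[ℤ_[ℓ]] A k)
    (tr : ∀ k, A (k + 1) →ₗ[ℤ_[ℓ]] A k) (htr : ∀ k z, tr k (pr (k + 1) z) = pr k z)
    (hpr : ∀ z, (∀ k, pr k z = 0) → z = 0)
    (hsurj : ∀ k z, ∃ f, pr k (Λ f) = pr k z)
    (hker : ∀ k f, pr k (Λ f) = 0 ↔ ∃ q ∈ P, f = (ℓ : ℤ_[ℓ]) ^ k • q) :
    IsFreeOfRank ℓ (Module.finrank ℤ_[ℓ] F) Z := by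
  have hinj : Function.Injective Λ := by
    rw [injective_iff_map_eq_zero]
    intro f hf
    let b := Module.finBasis ℤ_[ℓ] F
    refine b.ext_elem fun i ↦ ?_
    rw [map_zero, Finsupp.zero_apply]
    refine eq_zero_of_forall_pow_dvd fun n ↦ ?_
    obtain ⟨q, -, rfl⟩ := (hker n f).mp (by rw [hf, map_zero])
    rw [map_smul]
    exact ⟨b.repr q i, rfl⟩
  have hsur : Function.Surjective Λ := fun z ↦ by
    choose f hf using fun k ↦ hsurj k z
    have hf' (k) : ∃ q ∈ P, f (k + 1) - f k = (ℓ : ℤ_[ℓ]) ^ k • q := by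
      rw [← hker, map_sub, map_sub, ← htr, hf, htr, hf, sub_self]
    have hP (k) : f k - f 0 ∈ P := by
      induction k with
      | zero => rw [sub_self]; exact zero_mem _
      | succ k ih =>
        obtain ⟨q, hq, h⟩ := hf' k
        rw [← sub_add_sub_cancel _ (f k), h]
        exact add_mem (P.smul_mem _ hq) ih
    obtain ⟨x, hx⟩ := exists_limit_of_free (ℓ := ℓ) (fun k ↦ (⟨f k - f 0, hP k⟩ : P)) fun k ↦ by
      obtain ⟨q, hq, h⟩ := hf' k
      refine ⟨⟨q, hq⟩, Subtype.ext ?_⟩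
      change f (k + 1) - f 0 - (f k - f 0) = (ℓ : ℤ_[ℓ]) ^ k • q
      rw [sub_sub_sub_cancel_right, h]
    refine ⟨f 0 + x, sub_eq_zero.mp (hpr _ fun k ↦ ?_)⟩
    rw [map_sub, ← hf k, ← map_sub, ← map_sub, hker]
    obtain ⟨p, hp⟩ := hx k
    refine ⟨p, p.2, ?_⟩
    have h := congrArg Subtype.val hp
    change (x : F) - (f k - f 0) = _ at h
    rw [← Submodule.coe_smul, ← h]; abel
  let e := LinearEquiv.ofBijective Λ ⟨hinj, hsur⟩
  exact ⟨Module.Free.of_equiv e, Module.Finite.equiv e, e.finrank_eq.symm⟩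

end PadicModules

/-! ### Functoriality of the arithmetic norm of classes -/

section EllMap

variable {ℓ : ℕ} [Fact ℓ.Prime] {K M N : Type*} [Field K] [Field M] [Field N]

theorem ellMap_tmul (g : ClassGroup (𝓞 K) →* ClassGroup (𝓞 M)) (a : ℤ_[ℓ])
    (c : Additive (ClassGroup (𝓞 K))) :
    ellMap ℓ g (a ⊗ₜ c) = a ⊗ₜ Additive.ofMul (g c.toMul) := rfl

theorem ellMap_ellMap (g : ClassGroup (𝓞 K) →* ClassGroup (𝓞 M))
    (h : ClassGroup (𝓞 M) →* ClassGroup (𝓞 N)) (c : EllClassGroup ℓ K) :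
    ellMap ℓ h (ellMap ℓ g c) = ellMap ℓ (h.comp g) c := by
  induction c using TensorProduct.induction_on with
  | zero => simp only [map_zero]
  | tmul a c => rfl
  | add x y hx hy => simp only [map_add, hx, hy]

/-- A class dies in `ℤ_ℓ ⊗ Cl` only if its order is prime to `ℓ`, because `ℤ_ℓ` is flat. -/
theorem exists_pow_eq_one_of_tmul_eq_zero {c : ClassGroup (𝓞 K)}
    (h : (1 ⊗ₜ Additive.ofMul c : EllClassGroup ℓ K) = 0) :
    ∃ m : ℕ, ¬ ℓ ∣ m ∧ c ^ m = 1 := by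
  refine ⟨orderOf c, fun hdvd ↦ ?_, pow_orderOf_eq_one c⟩
  -- Tensor with `ℤ_ℓ` the exact sequence `ℤ → ℤ → Cl` given by the order of `c` and by `c`.
  let f : ℤ →ₗ[ℤ] ℤ := LinearMap.lsmul ℤ ℤ (orderOf c)
  let g : ℤ →ₗ[ℤ] Additive (ClassGroup (𝓞 K)) := LinearMap.toSpanSingleton ℤ _ (Additive.ofMul c)
  have hex : Function.Exact f g := fun k ↦ by
    have : g k = 0 ↔ (orderOf c : ℤ) ∣ k := by
      rw [orderOf_dvd_iff_zpow_eq_one]; rfl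
    rw [this]
    exact ⟨fun ⟨r, hr⟩ ↦ ⟨r, hr.symm⟩, fun ⟨r, hr⟩ ↦ ⟨r, hr.symm⟩⟩
  have hex' := Module.Flat.lTensor_exact ℤ_[ℓ] hex
  obtain ⟨t, ht⟩ := (hex' (1 ⊗ₜ 1)).mp (by
    rw [LinearMap.lTensor_tmul, LinearMap.toSpanSingleton_apply, one_smul]; exact h)
  have h2 (t : ℤ_[ℓ] ⊗[ℤ] ℤ) : ∃ r, TensorProduct.rid ℤ ℤ_[ℓ] (f.lTensor ℤ_[ℓ] t) =
      (orderOf c : ℤ_[ℓ]) * r := by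
    induction t using TensorProduct.induction_on with
    | zero => exact ⟨0, by simp⟩
    | tmul a b => exact ⟨b * a, by simp [f, mul_assoc]⟩
    | add x y hx hy =>
      obtain ⟨r, hr⟩ := hx
      obtain ⟨s, hs⟩ := hy
      exact ⟨r + s, by rw [map_add, map_add, hr, hs, mul_add]⟩
  obtain ⟨r, hr⟩ := h2 t
  rw [ht, TensorProduct.rid_tmul, one_smul] at hr
  have hu : IsUnit (orderOf c : ℤ_[ℓ]) := IsUnit.of_mul_eq_one _ hr.symm
  obtain ⟨k, hk⟩ := hdvd
  rw [hk, Nat.cast_mul] at hu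
  exact PadicInt.prime_p.not_isUnit (isUnit_of_mul_isUnit_left hu)

end EllMap

section NormFunctoriality

variable {K M N : Type*} [Field K] [NumberField K] [Field M] [NumberField M] [Field N]
  [NumberField N]

theorem fieldClassNorm_comp (f : K →+* M) (g : M →+* N) :
    (fieldClassNorm f).comp (fieldClassNorm g) = fieldClassNorm (g.comp f) := by
  let : Algebra K M := f.toAlgebra
  let : Algebra M N := g.toAlgebra
  let : Algebra K N := (g.comp f).toAlgebra
  have : IsScalarTower K M N := IsScalarTower.of_algebraMap_eq fun _ ↦ rfl
  ext c
  obtain ⟨I, rfl⟩ := ClassGroup.mk0_surjective c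
  rw [MonoidHom.comp_apply, fieldClassNorm, fieldClassNorm, fieldClassNorm, classNorm_mk0,
    classNorm_mk0, classNorm_mk0]
  exact congrArg _ (Subtype.ext (Ideal.relNorm_relNorm (𝓞 K) (𝓞 M) I.1))

theorem fieldClassNorm_fieldClassMap_of_bijective {f : K →+* M} (hf : Function.Bijective f)
    (c : ClassGroup (𝓞 K)) : fieldClassNorm f (fieldClassMap f c) = c := by
  let : Algebra K M := f.toAlgebra
  obtain ⟨I, rfl⟩ := ClassGroup.mk0_surjective c
  rw [fieldClassNorm, fieldClassMap, classMap_mk0, classNorm_mk0]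
  refine congrArg _ (Subtype.ext ?_)
  have h1 : Module.finrank (𝓞 K) (𝓞 M) = 1 := by
    rw [← IsFractionRing.finrank_eq (𝓞 K) K (𝓞 M) M]
    exact finrank_eq_one_iff'.mpr ⟨1, one_ne_zero, fun w ↦ by
      obtain ⟨c, rfl⟩ := hf.2 w
      exact ⟨c, by rw [Algebra.smul_def, mul_one]; rfl⟩⟩
  have h2 := Ideal.relNorm_algebraMap (S := 𝓞 M) I.1
  rw [h1, pow_one] at h2
  exact h2

theorem fieldClassMap_id (c : ClassGroup (𝓞 K)) : fieldClassMap (RingHom.id K) c = c := by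
  obtain ⟨I, rfl⟩ := ClassGroup.mk0_surjective c
  rw [fieldClassMap, classMap_mk0]
  exact congrArg _ (Subtype.ext (Ideal.map_id _))

variable {ℓ : ℕ} [Fact ℓ.Prime]

theorem ellMap_fieldClassNorm_mem (f : K →+* M) {c : EllClassGroup ℓ M}
    (hc : c ∈ ellClasses ℓ M) : ellMap ℓ (fieldClassNorm f) c ∈ ellClasses ℓ K := by
  induction hc using Submodule.span_induction with
  | mem c hc =>
    obtain ⟨w, hw, rfl⟩ := hc
    obtain ⟨v, hv⟩ := exists_eq_comap f w
    have hv' : v ∈ placesAbove ℓ K := (mem_placesAbove_iff_of_comap f hv).mpr hw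
    let : Algebra K M := f.toAlgebra
    have hlies : w.asIdeal.LiesOver v.asIdeal := ⟨hv.symm⟩
    have hmax := w.isMaximal
    have hmax' := v.isMaximal
    have h := Ideal.relNorm_eq_pow_of_isMaximal w.asIdeal v.asIdeal
    have h2 : fieldClassNorm f (placeClass w) =
        placeClass v ^ w.asIdeal.inertiaDeg (𝓞 K) := by
      rw [fieldClassNorm, placeClass, classNorm_mk0, placeClass, ← map_pow]
      exact congrArg _ (Subtype.ext h)
    change 1 ⊗ₜ Additive.ofMul (fieldClassNorm f (placeClass w)) ∈ _
    rw [h2, ofMul_pow, TensorProduct.tmul_smul]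
    exact nsmul_mem (tmul_place_mem_ellClasses ℓ K v hv') _
  | zero => rw [map_zero]; exact zero_mem _
  | add x y _ _ hx hy => rw [map_add]; exact add_mem hx hy
  | smul a x _ hx => rw [map_smul]; exact Submodule.smul_mem _ a hx

end NormFunctoriality

/-! ### `ℓ`-classes of the places above `ℓ` -/

section ClassHom

variable {ℓ : ℕ} [Fact ℓ.Prime] {K M : Type*} [Field K] [NumberField K] [Field M] [NumberField M]
  {ι : Type*} [Fintype ι]

/-- The `ℓ`-class of a divisor with exponents in `ℤ_ℓ`, built on the places `W i`. -/
noncomputable def classHom (W : ι → HeightOneSpectrum (𝓞 K)) :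
    (ι → ℤ_[ℓ]) →ₗ[ℤ_[ℓ]] EllClassGroup ℓ K :=
  Fintype.linearCombination ℤ_[ℓ] fun i ↦ 1 ⊗ₜ Additive.ofMul (placeClass (W i))

theorem classHom_apply (W : ι → HeightOneSpectrum (𝓞 K)) (f : ι → ℤ_[ℓ]) :
    classHom W f = ∑ i, f i • (1 ⊗ₜ Additive.ofMul (placeClass (W i)) : EllClassGroup ℓ K) := rfl

theorem range_classHom {W : ι → HeightOneSpectrum (𝓞 K)} (hW : Set.range W = placesAbove ℓ K) :
    LinearMap.range (classHom (ℓ := ℓ) W) = ellClasses ℓ K := by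
  rw [classHom, Fintype.range_linearCombination, ellClasses]
  congr 1
  ext c
  constructor
  · rintro ⟨i, rfl⟩
    exact ⟨W i, hW ▸ ⟨i, rfl⟩, rfl⟩
  · rintro ⟨v, hv, rfl⟩
    rw [← hW] at hv
    obtain ⟨i, rfl⟩ := hv
    exact ⟨i, rfl⟩

theorem classHom_intCast (W : ι → HeightOneSpectrum (𝓞 K)) (a : ι → ℤ) :
    classHom (ℓ := ℓ) W (fun i ↦ (a i : ℤ_[ℓ])) = 1 ⊗ₜ Additive.ofMul (classOf W a) := by
  rw [classHom_apply, classOf, ofMul_prod, TensorProduct.tmul_sum]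
  refine Finset.sum_congr rfl fun i _ ↦ ?_
  rw [ofMul_zpow, TensorProduct.tmul_smul, Int.cast_smul_eq_zsmul]

theorem ellMap_classHom {g : ClassGroup (𝓞 K) →* ClassGroup (𝓞 M)}
    {W : ι → HeightOneSpectrum (𝓞 K)} {W' : ι → HeightOneSpectrum (𝓞 M)} {e : ℕ}
    (h : ∀ i, g (placeClass (W i)) = placeClass (W' i) ^ e) (f : ι → ℤ_[ℓ]) :
    ellMap ℓ g (classHom W f) = classHom W' ((e : ℤ_[ℓ]) • f) := by
  rw [classHom_apply, map_sum, classHom_apply]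
  refine Finset.sum_congr rfl fun i _ ↦ ?_
  rw [map_smul, ellMap_tmul, toMul_ofMul, h, ofMul_pow, TensorProduct.tmul_smul, Pi.smul_apply,
    smul_eq_mul, mul_comm, mul_smul, Nat.cast_smul_eq_nsmul]

/-- As the class group is finite, a power of `ℓ` kills its `ℓ`-part. -/
theorem exists_pow_smul_eq_zero (K : Type*) [Field K] [NumberField K] :
    ∃ s : ℕ, ∀ c : EllClassGroup ℓ K, (ℓ : ℤ_[ℓ]) ^ s • c = 0 := by
  set h := Fintype.card (ClassGroup (𝓞 K)) with hh
  have hne : (h : ℤ_[ℓ]) ≠ 0 := by exact_mod_cast Fintype.card_ne_zero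
  have hkill (c : EllClassGroup ℓ K) : (h : ℤ_[ℓ]) • c = 0 := by
    induction c using TensorProduct.induction_on with
    | zero => rw [smul_zero]
    | tmul a c =>
      rw [Nat.cast_smul_eq_nsmul, ← TensorProduct.tmul_smul]
      have : h • c = 0 := pow_card_eq_one (x := c.toMul)
      rw [this, TensorProduct.tmul_zero]
    | add x y hx hy => rw [smul_add, hx, hy, add_zero]
  refine ⟨(h : ℤ_[ℓ]).valuation, fun c ↦ ?_⟩
  have h1 := hkill c
  rw [PadicInt.unitCoeff_spec hne, mul_smul, ← Units.smul_def, smul_eq_zero_iff_eq] at h1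
  exact h1

end ClassHom

/-! ### Relations between the imaginary classes of the places above `ℓ` -/

section Antisymmetric

variable {ℓ : ℕ} [Fact ℓ.Prime]

theorem isUnit_natCast_of_not_dvd {m : ℕ} (h : ¬ ℓ ∣ m) : IsUnit (m : ℤ_[ℓ]) := by
  rw [PadicInt.isUnit_iff]
  refine le_antisymm (PadicInt.norm_le_one _) (not_lt.mp fun hlt ↦ h ?_)
  have := (PadicInt.norm_int_lt_one_iff_dvd (p := ℓ) m).mp (by exact_mod_cast hlt)
  exact_mod_cast this

theorem exists_half (hodd : ℓ ≠ 2) : ∃ u : ℤ_[ℓ], u * 2 = 1 := by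
  have h := isUnit_natCast_of_not_dvd (ℓ := ℓ) (m := 2) fun h ↦
    hodd ((Nat.prime_dvd_prime_iff_eq Fact.out Nat.prime_two).mp h)
  obtain ⟨u, hu⟩ := h.exists_left_inv
  exact ⟨u, by exact_mod_cast hu⟩

variable {ι : Type*}

variable (ℓ) in
/-- The functions with values in `ℤ_ℓ` that the involution `τ` maps to their opposites. -/
noncomputable def antiSub (τ : ι → ι) : Submodule ℤ_[ℓ] (ι → ℤ_[ℓ]) :=
  LinearMap.eqLocus (LinearMap.funLeft ℤ_[ℓ] ℤ_[ℓ] τ) (-LinearMap.id)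

theorem mem_antiSub {τ : ι → ι} {f : ι → ℤ_[ℓ]} : f ∈ antiSub ℓ τ ↔ f ∘ τ = -f := Iff.rfl

theorem sub_comp_mem_antiSub {τ : ι → ι} (hτ : Function.Involutive τ) (f : ι → ℤ_[ℓ]) :
    f - f ∘ τ ∈ antiSub ℓ τ := by
  rw [mem_antiSub]
  funext i
  simp only [Function.comp_apply, Pi.sub_apply, Pi.neg_apply, hτ i, neg_sub]

/-- An antisymmetric function is approximated by antisymmetric functions with values in `ℤ`. -/
theorem exists_int_approx {τ : ι → ι} (hτ : Function.Involutive τ) (hodd : ℓ ≠ 2)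
    {f : ι → ℤ_[ℓ]} (hf : f ∈ antiSub ℓ τ) (N : ℕ) : ∃ a : ι → ℤ, a ∘ τ = -a ∧
      ∃ g ∈ antiSub ℓ τ, f = (fun i ↦ (a i : ℤ_[ℓ])) + (ℓ : ℤ_[ℓ]) ^ N • g := by
  -- Antisymmetrize an approximation of `f / 2`.
  obtain ⟨u, hu⟩ := exists_half hodd
  have h (i) : ∃ c, u * f i - ((u * f i).appr N : ℤ_[ℓ]) = (ℓ : ℤ_[ℓ]) ^ N * c := by
    have := PadicInt.appr_spec N (u * f i)
    rwa [Ideal.mem_span_singleton] at this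
  choose c hc using h
  refine ⟨fun i ↦ (u * f i).appr N - (u * f (τ i)).appr N, ?_, c - c ∘ τ,
    sub_comp_mem_antiSub hτ c, ?_⟩
  · funext i
    simp only [Function.comp_apply, Pi.neg_apply, hτ i, neg_sub]
  · funext i
    have h1 := hc i
    have h2 := hc (τ i)
    have h3 : f (τ i) = -f i := congrFun hf i
    simp only [Pi.add_apply, Pi.smul_apply, Pi.sub_apply, Function.comp_apply, smul_eq_mul,
      Int.cast_sub, Int.cast_natCast, mul_sub]
    rw [← h1, ← h2, h3]
    linear_combination (-f i) * hu

end Antisymmetric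

section Kernel

variable {ℓ : ℕ} [Fact ℓ.Prime] {L : IntermediateField ℚ ℂ} [NumberField L] {n₀ : ℕ}
  (hram : TotallyRamifiedFrom ℓ L n₀)

theorem ellMap_incl_classHom {n m : ℕ} (h : n₀ ≤ n) (h' : n ≤ m)
    (f : placesAbove ℓ (layer ℓ L n₀) → ℤ_[ℓ]) :
    ellMap ℓ (fieldClassMap (incl ℓ L h')) (classHom (placeAt hram h) f) =
      classHom (placeAt hram (h.trans h')) ((ℓ : ℤ_[ℓ]) ^ (m - n) • f) := by
  rw [← Nat.cast_pow]
  exact ellMap_classHom (fun v ↦ fieldClassMap_placeClass (map_placeAt hram h h' v)) f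

theorem ellMap_fieldClassNorm_classHom (hμ : ∃ ζ : L, IsPrimitiveRoot ζ ℓ) {n m : ℕ} (h : n₀ ≤ n)
    (h' : n ≤ m) (f : placesAbove ℓ (layer ℓ L n₀) → ℤ_[ℓ]) :
    ellMap ℓ (fieldClassNorm (incl ℓ L h')) (classHom (placeAt hram (h.trans h')) f) =
      classHom (placeAt hram h) f := by
  rw [ellMap_classHom (W' := placeAt hram h) (e := 1) fun v ↦ ?_, Nat.cast_one, one_smul]
  rw [fieldClassNorm_placeClass (finrank_layer_of_totallyRamified hram hμ h h')
    (pow_prime_ne_zero ℓ _) (map_placeAt hram h h' v), pow_one]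

theorem ellMap_conj_classHom [ConjStable L] {n : ℕ} (h : n₀ ≤ n)
    (f : placesAbove ℓ (layer ℓ L n₀) → ℤ_[ℓ]) :
    ellMap ℓ (fieldClassMap (conj (layer ℓ L n))) (classHom (placeAt hram h) f) =
      classHom (placeAt hram h) (f ∘ placeConj ℓ _) := by
  have hτ : Function.Involutive (placeConj ℓ (layer ℓ L n₀)) := placeConj_placeConj
  rw [ellMap_classHom (W' := fun v ↦ placeAt hram h (placeConj ℓ _ v)) (e := 1) fun v ↦ ?_,
    Nat.cast_one, one_smul, classHom_apply, classHom_apply]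
  · refine Fintype.sum_equiv hτ.toPerm _ _ fun v ↦ ?_
    rw [Function.Involutive.coe_toPerm, Function.comp_apply, hτ]
  · exact fieldClassMap_placeClass (by rw [map_conj_placeAt hram h, pow_one])

/-- The relations between the imaginary classes of the places above `ℓ` of `L_n` are the multiples
by `ℓ^(n - n₀)` of those of `L_{n₀}`. -/
theorem classHom_eq_zero_iff [IsCMField L] (hμ : ∃ ζ : L, IsPrimitiveRoot ζ ℓ) (hodd : ℓ ≠ 2)
    {n : ℕ} (h : n₀ ≤ n) {f : placesAbove ℓ (layer ℓ L n₀) → ℤ_[ℓ]}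
    (hf : f ∈ antiSub ℓ (placeConj ℓ (layer ℓ L n₀))) :
    classHom (placeAt hram h) f = 0 ↔ ∃ q ∈ antiSub ℓ (placeConj ℓ (layer ℓ L n₀)),
      classHom (placeAt hram le_rfl) q = 0 ∧ f = (ℓ : ℤ_[ℓ]) ^ (n - n₀) • q := by
  refine ⟨fun h0 ↦ ?_, ?_⟩
  · have hτ : Function.Involutive (placeConj ℓ (layer ℓ L n₀)) := placeConj_placeConj
    obtain ⟨s, hs⟩ := exists_pow_smul_eq_zero (ℓ := ℓ) (layer ℓ L n)
    obtain ⟨s₀, hs₀⟩ := exists_pow_smul_eq_zero (ℓ := ℓ) (layer ℓ L n₀)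
    -- The exponent is chosen so that the error term dies in both class groups.
    obtain ⟨a, ha, g, hg, rfl⟩ := exists_int_approx hτ hodd hf (s₀ + (n - n₀) + s)
    rw [map_add, map_smul, pow_add, mul_smul, hs, smul_zero, add_zero, classHom_intCast] at h0
    obtain ⟨m, hm, hcl⟩ := exists_pow_eq_one_of_tmul_eq_zero h0
    obtain ⟨b, hb, hbcl, hab⟩ := exists_eq_smul_of_classOf_eq_one hram hμ hodd h
      (a := (m : ℤ) • a) (by rw [← smul_neg, ← ha]; rfl) (by rw [classOf_smul, zpow_natCast, hcl])
    obtain ⟨u, hu⟩ := (isUnit_natCast_of_not_dvd hm).exists_left_inv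
    have hb' : (fun v ↦ (b v : ℤ_[ℓ])) ∈ antiSub ℓ (placeConj ℓ (layer ℓ L n₀)) := by
      rw [mem_antiSub]
      funext v
      have := congrFun hb v
      simp only [Function.comp_apply, Pi.neg_apply] at this ⊢
      rw [this, Int.cast_neg]
    refine ⟨u • (fun v ↦ (b v : ℤ_[ℓ])) + (ℓ : ℤ_[ℓ]) ^ (s₀ + s) • g,
      add_mem (Submodule.smul_mem _ _ hb') (Submodule.smul_mem _ _ hg), ?_, ?_⟩
    · rw [map_add, map_smul, map_smul, pow_add, mul_smul, hs₀, add_zero, classHom_intCast, hbcl,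
        ofMul_one, TensorProduct.tmul_zero, smul_zero]
    · funext v
      have h1 := congrArg (Int.cast : ℤ → ℤ_[ℓ]) (congrFun hab v)
      simp only [Pi.smul_apply, Pi.add_apply, smul_eq_mul, Int.cast_mul, Int.cast_natCast]
        at h1 ⊢
      push_cast at h1
      rw [show s₀ + (n - n₀) + s = (n - n₀) + (s₀ + s) by ring, pow_add]
      linear_combination (-(a v : ℤ_[ℓ])) * hu + u * h1
  · rintro ⟨q, -, hq, rfl⟩
    rw [← ellMap_incl_classHom hram le_rfl h, hq, map_zero]

/-- The imaginary classes are the images of the antisymmetric functions. -/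
theorem exists_classHom_of_conj_eq_neg [ConjStable L] (hodd : ℓ ≠ 2) {n : ℕ} (h : n₀ ≤ n)
    {c : EllClassGroup ℓ (layer ℓ L n)} (hc : c ∈ ellClasses ℓ (layer ℓ L n))
    (hconj : ellMap ℓ (fieldClassMap (conj (layer ℓ L n))) c = -c) :
    ∃ f ∈ antiSub ℓ (placeConj ℓ (layer ℓ L n₀)), classHom (placeAt hram h) f = c := by
  rw [← range_classHom (range_placeAt hram h)] at hc
  obtain ⟨f, rfl⟩ := hc
  obtain ⟨u, hu⟩ := exists_half hodd
  refine ⟨u • (f - f ∘ placeConj ℓ _),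
    Submodule.smul_mem _ _ (sub_comp_mem_antiSub placeConj_placeConj f), ?_⟩
  rw [map_smul, map_sub, ← ellMap_conj_classHom, hconj, sub_neg_eq_add, ← two_smul ℤ_[ℓ],
    smul_smul, hu, one_smul]

end Kernel

/-! ### The imaginary components of the limits -/

theorem incl_self {ℓ : ℕ} {L : IntermediateField ℚ ℂ} (n : ℕ) :
    incl ℓ L (le_refl n) = RingHom.id _ := RingHom.ext fun _ ↦ rfl

section Limits

variable {ℓ : ℕ} [Fact ℓ.Prime] {L : IntermediateField ℚ ℂ} [NumberField L] {n₀ : ℕ}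

instance directedSystem_ellClasses : DirectedSystem (fun n ↦ ellClasses ℓ (layer ℓ L n))
    (fun _ _ h ↦ ellClassesMap ℓ (incl ℓ L h)) where
  map_self n c := by
    refine Subtype.ext ?_
    change ellMap ℓ (fieldClassMap (incl ℓ L (le_refl n))) c.1 = c.1
    have h : fieldClassMap (incl ℓ L (le_refl n)) = MonoidHom.id _ := by
      rw [incl_self]; exact MonoidHom.ext fieldClassMap_id
    rw [h]
    exact LinearMap.congr_fun LinearMap.baseChange_id c.1
  map_map k j i hij hjk c := by
    rw [← incl_comp_incl hij hjk, ← ellClassesMap_comp]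
    rfl

variable (hram : TotallyRamifiedFrom ℓ L n₀)

/-- `classHom`, with values in the submodule generated by the classes of the places above `ℓ`. -/
noncomputable def ellClassHom {n : ℕ} (h : n₀ ≤ n) :
    (placesAbove ℓ (layer ℓ L n₀) → ℤ_[ℓ]) →ₗ[ℤ_[ℓ]] ellClasses ℓ (layer ℓ L n) :=
  (classHom (placeAt hram h)).codRestrict _ fun f ↦
    range_classHom (range_placeAt hram h) ▸ LinearMap.mem_range_self _ f

theorem ellClassHom_surjective {n : ℕ} (h : n₀ ≤ n) :
    Function.Surjective (ellClassHom hram h) := fun ⟨c, hc⟩ ↦ by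
  rw [← range_classHom (range_placeAt hram h)] at hc
  obtain ⟨f, rfl⟩ := hc
  exact ⟨f, rfl⟩

theorem ellClassesMap_incl_ellClassHom {n m : ℕ} (h : n₀ ≤ n) (h' : n ≤ m)
    (f : placesAbove ℓ (layer ℓ L n₀) → ℤ_[ℓ]) :
    ellClassesMap ℓ (incl ℓ L h') (ellClassHom hram h f) =
      ellClassHom hram (h.trans h') ((ℓ : ℤ_[ℓ]) ^ (m - n) • f) :=
  Subtype.ext (ellMap_incl_classHom hram h h' f)

/-- The relations between the imaginary classes of the places above `ℓ` of `L_{n₀}`. -/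
noncomputable def imagRelations [ConjStable L] :
    Submodule ℤ_[ℓ] (antiSub ℓ (placeConj ℓ (layer ℓ L n₀))) :=
  LinearMap.ker (classHom (placeAt hram le_rfl) ∘ₗ
    (antiSub ℓ (placeConj ℓ (layer ℓ L n₀))).subtype)

theorem classHom_eq_zero_iff_imagRelations [IsCMField L] (hμ : ∃ ζ : L, IsPrimitiveRoot ζ ℓ)
    (hodd : ℓ ≠ 2) {n k : ℕ} (h : n₀ ≤ n) (hk : n - n₀ = k)
    (f : antiSub ℓ (placeConj ℓ (layer ℓ L n₀))) :
    classHom (placeAt hram h) f.1 = 0 ↔ ∃ q ∈ imagRelations hram, f = (ℓ : ℤ_[ℓ]) ^ k • q := by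
  rw [classHom_eq_zero_iff hram hμ hodd h f.2, hk]
  exact ⟨fun ⟨q, hq, hq0, h⟩ ↦ ⟨⟨q, hq⟩, hq0, Subtype.ext h⟩,
    fun ⟨q, hq, h⟩ ↦ ⟨q, q.2, hq, congrArg Subtype.val h⟩⟩

variable (ℓ L) in
/-- The canonical map to the inductive limit. -/
noncomputable def indOf (n : ℕ) : ellClasses ℓ (layer ℓ L n) →ₗ[ℤ_[ℓ]] IndLimit ℓ L :=
  Module.DirectLimit.of ℤ_[ℓ] ℕ (fun n ↦ ellClasses ℓ (layer ℓ L n))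
    (fun _ _ h ↦ ellClassesMap ℓ (incl ℓ L h)) n

theorem indOf_ellClassesMap {n m : ℕ} (h : n ≤ m) (c : ellClasses ℓ (layer ℓ L n)) :
    indOf ℓ L m (ellClassesMap ℓ (incl ℓ L h) c) = indOf ℓ L n c :=
  Module.DirectLimit.of_f

/-- The class in the inductive limit of a divisor of `L_n` with exponents in `ℤ_ℓ`. -/
noncomputable def indClass {n : ℕ} (h : n₀ ≤ n) :
    (placesAbove ℓ (layer ℓ L n₀) → ℤ_[ℓ]) →ₗ[ℤ_[ℓ]] IndLimit ℓ L :=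
  indOf ℓ L n ∘ₗ ellClassHom hram h

theorem indClass_pow_smul {n m : ℕ} (h : n₀ ≤ n) (h' : n ≤ m)
    (f : placesAbove ℓ (layer ℓ L n₀) → ℤ_[ℓ]) :
    indClass hram (h.trans h') ((ℓ : ℤ_[ℓ]) ^ (m - n) • f) = indClass hram h f := by
  rw [indClass, LinearMap.comp_apply, ← ellClassesMap_incl_ellClassHom hram h h',
    indOf_ellClassesMap]
  rfl

theorem exists_indClass_eq (x : IndLimit ℓ L) :
    ∃ (k : ℕ) (f : _), indClass hram (Nat.le_add_right n₀ k) f = x := by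
  obtain ⟨n, c, rfl⟩ := Module.DirectLimit.exists_of x
  obtain ⟨f, hf⟩ := ellClassHom_surjective hram (Nat.le_add_right n₀ n)
    (ellClassesMap ℓ (incl ℓ L (Nat.le_add_left n n₀)) c)
  refine ⟨n, f, ?_⟩
  rw [indClass, LinearMap.comp_apply, hf]
  exact indOf_ellClassesMap _ c

theorem indLimitConj_indClass [ConjStable L] {n : ℕ} (h : n₀ ≤ n)
    (f : placesAbove ℓ (layer ℓ L n₀) → ℤ_[ℓ]) :
    indLimitConj ℓ L (indClass hram h f) = indClass hram h (f ∘ placeConj ℓ _) := by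
  have h1 : ellClassesMap ℓ (conj (layer ℓ L n)) (ellClassHom hram h f) =
      ellClassHom hram h (f ∘ placeConj ℓ _) := Subtype.ext (ellMap_conj_classHom hram h f)
  change _ = indOf ℓ L n (ellClassHom hram _ _)
  rw [← h1]
  exact Module.DirectLimit.map_apply_of _ _ _

theorem indClass_eq_zero_iff [IsCMField L] (hμ : ∃ ζ : L, IsPrimitiveRoot ζ ℓ) (hodd : ℓ ≠ 2)
    {n k : ℕ} (h : n₀ ≤ n) (hk : n - n₀ = k) (f : antiSub ℓ (placeConj ℓ (layer ℓ L n₀))) :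
    indClass hram h f.1 = 0 ↔ ∃ q ∈ imagRelations hram, f = (ℓ : ℤ_[ℓ]) ^ k • q := by
  have hℓ0 : (ℓ : ℤ_[ℓ]) ≠ 0 := by exact_mod_cast (Fact.out : ℓ.Prime).ne_zero
  rw [← classHom_eq_zero_iff_imagRelations hram hμ hodd h hk]
  refine ⟨fun h0 ↦ ?_, fun h0 ↦ ?_⟩
  · obtain ⟨m, h', hm⟩ := Module.DirectLimit.of.zero_exact h0
    rw [ellClassesMap_incl_ellClassHom] at hm
    have hm' : classHom (placeAt hram (h.trans h')) ((ℓ : ℤ_[ℓ]) ^ (m - n) • f).1 = 0 :=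
      congrArg Subtype.val hm
    rw [classHom_eq_zero_iff_imagRelations hram hμ hodd _ rfl,
      show m - n₀ = (m - n) + (n - n₀) by omega] at hm'
    obtain ⟨q, hq, hq'⟩ := hm'
    rw [classHom_eq_zero_iff_imagRelations hram hμ hodd h rfl]
    refine ⟨q, hq, ?_⟩
    rw [pow_add, mul_smul] at hq'
    exact smul_right_injective _ (pow_ne_zero _ hℓ0) hq'
  · have h1 : ellClassHom hram h f.1 = 0 := Subtype.ext h0
    rw [indClass, LinearMap.comp_apply, h1, map_zero]

theorem indClass_mem_imagIndLimit [ConjStable L] {n : ℕ} (h : n₀ ≤ n)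
    (f : antiSub ℓ (placeConj ℓ (layer ℓ L n₀))) : indClass hram h f.1 ∈ imagIndLimit ℓ L := by
  change indLimitConj ℓ L (indClass hram h f.1) = -indClass hram h f.1
  rw [indLimitConj_indClass, mem_antiSub.mp f.2, map_neg]

theorem exists_pow_smul_mem_imagRelations [ConjStable L] : ∃ N : ℕ,
    ∀ f : antiSub ℓ (placeConj ℓ (layer ℓ L n₀)), (ℓ : ℤ_[ℓ]) ^ N • f ∈ imagRelations hram := by
  obtain ⟨N, hN⟩ := exists_pow_smul_eq_zero (ℓ := ℓ) (layer ℓ L n₀)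
  exact ⟨N, fun f ↦ by rw [imagRelations, LinearMap.mem_ker, map_smul, hN]⟩

include hram in
theorem isDivisibleOfCodim_imagIndLimit [IsCMField L] (hμ : ∃ ζ : L, IsPrimitiveRoot ζ ℓ)
    (hodd : ℓ ≠ 2) : IsDivisibleOfCodim ℓ
      (Module.finrank ℤ_[ℓ] (antiSub ℓ (placeConj ℓ (layer ℓ L n₀)))) (imagIndLimit ℓ L) := by
  obtain ⟨N, hN⟩ := exists_pow_smul_mem_imagRelations hram
  refine isDivisibleOfCodim_of_lattice (imagRelations hram) hN
    (fun k ↦ (indClass hram (Nat.le_add_right n₀ k) ∘ₗ Submodule.subtype _).codRestrict _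
      fun f ↦ indClass_mem_imagIndLimit hram _ f) (fun k f ↦ Subtype.ext ?_) (fun k f ↦ ?_)
      fun ⟨x, hx⟩ ↦ ?_
  · have h1 := indClass_pow_smul hram (Nat.le_add_right n₀ k) (Nat.le_succ (n₀ + k)) f.1
    have h2 : (n₀ + k).succ - (n₀ + k) = 1 := by omega
    simp only [h2, pow_one] at h1
    exact h1
  · rw [← indClass_eq_zero_iff hram hμ hodd (Nat.le_add_right n₀ k) (by omega)]
    exact Subtype.ext_iff
  · obtain ⟨k, f, rfl⟩ := exists_indClass_eq hram x
    obtain ⟨u, hu⟩ := exists_half hodd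
    have hx' : indClass hram (Nat.le_add_right n₀ k) (f ∘ placeConj ℓ _) =
        -indClass hram (Nat.le_add_right n₀ k) f := by
      rw [← indLimitConj_indClass]; exact hx
    refine ⟨k, ⟨u • (f - f ∘ placeConj ℓ _),
      Submodule.smul_mem _ _ (sub_comp_mem_antiSub placeConj_placeConj f)⟩, Subtype.ext ?_⟩
    change indClass hram _ (u • (f - f ∘ placeConj ℓ _)) = indClass hram _ f
    rw [map_smul, map_sub, hx', sub_neg_eq_add, ← two_smul ℤ_[ℓ], smul_smul, hu, one_smul]

/-- The compatible system of classes defined by a divisor of `L_{n₀}` with exponents in `ℤ_ℓ`: as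
the arithmetic norm maps the places above `ℓ` to each other from `L_{n₀}` on, its component in `L_n`
is the norm of the class in `L_m` of the divisor with the same exponents, for any `m` large
enough. -/
noncomputable def projClass (n : ℕ) :
    (placesAbove ℓ (layer ℓ L n₀) → ℤ_[ℓ]) →ₗ[ℤ_[ℓ]] EllClassGroup ℓ (layer ℓ L n) :=
  ellMap ℓ (fieldClassNorm (incl ℓ L (le_max_left n n₀))) ∘ₗ
    classHom (placeAt hram (le_max_right n n₀))

theorem ellMap_fieldClassNorm_incl_incl {n m k : ℕ} (h : n ≤ m) (h' : m ≤ k)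
    (c : EllClassGroup ℓ (layer ℓ L k)) :
    ellMap ℓ (fieldClassNorm (incl ℓ L h)) (ellMap ℓ (fieldClassNorm (incl ℓ L h')) c) =
      ellMap ℓ (fieldClassNorm (incl ℓ L (h.trans h'))) c := by
  rw [ellMap_ellMap, fieldClassNorm_comp, incl_comp_incl]

theorem projClass_eq (hμ : ∃ ζ : L, IsPrimitiveRoot ζ ℓ) {n m : ℕ} (h : n ≤ m) (h' : n₀ ≤ m)
    (f : placesAbove ℓ (layer ℓ L n₀) → ℤ_[ℓ]) : projClass hram n f =
      ellMap ℓ (fieldClassNorm (incl ℓ L h)) (classHom (placeAt hram h') f) := by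
  rw [projClass, LinearMap.comp_apply,
    ← ellMap_fieldClassNorm_classHom hram hμ (le_max_right n n₀) (max_le h h'),
    ellMap_fieldClassNorm_incl_incl]

theorem projClass_of_le (hμ : ∃ ζ : L, IsPrimitiveRoot ζ ℓ) {n : ℕ} (h : n₀ ≤ n)
    (f : placesAbove ℓ (layer ℓ L n₀) → ℤ_[ℓ]) :
    projClass hram n f = classHom (placeAt hram h) f := by
  rw [projClass_eq hram hμ le_rfl h, ellMap_fieldClassNorm_classHom hram hμ h le_rfl]

theorem ellMap_fieldClassNorm_projClass (hμ : ∃ ζ : L, IsPrimitiveRoot ζ ℓ) {n m : ℕ} (h : n ≤ m)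
    (f : placesAbove ℓ (layer ℓ L n₀) → ℤ_[ℓ]) :
    ellMap ℓ (fieldClassNorm (incl ℓ L h)) (projClass hram m f) = projClass hram n f := by
  rw [projClass, LinearMap.comp_apply, ellMap_fieldClassNorm_incl_incl,
    ← projClass_eq hram hμ (h.trans (le_max_left m n₀)) (le_max_right m n₀)]

theorem fieldClassNorm_conj [ConjStable L] (n : ℕ) :
    fieldClassNorm (conj (layer ℓ L n)) = fieldClassMap (conj (layer ℓ L n)) := by
  have hinv : Function.Involutive (conj (layer ℓ L n)) := conj_conj
  have h : (conj (layer ℓ L n)).comp (conj (layer ℓ L n)) = RingHom.id _ := RingHom.ext hinv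
  ext c
  have h1 := fieldClassNorm_fieldClassMap_of_bijective hinv.bijective
    (fieldClassMap (conj (layer ℓ L n)) c)
  rwa [← MonoidHom.comp_apply (fieldClassMap _), fieldClassMap_comp, h, fieldClassMap_id] at h1

theorem ellMap_conj_projClass [ConjStable L] (n : ℕ)
    (f : placesAbove ℓ (layer ℓ L n₀) → ℤ_[ℓ]) :
    ellMap ℓ (fieldClassMap (conj (layer ℓ L n))) (projClass hram n f) =
      projClass hram n (f ∘ placeConj ℓ _) := by
  rw [projClass, LinearMap.comp_apply, ← fieldClassNorm_conj, ellMap_ellMap, fieldClassNorm_comp,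
    ← incl_comp_conj, ← fieldClassNorm_comp, ← ellMap_ellMap, fieldClassNorm_conj,
    ellMap_conj_classHom]
  rfl

theorem projClass_mem_imagProjLimit [ConjStable L] (hμ : ∃ ζ : L, IsPrimitiveRoot ζ ℓ)
    (f : antiSub ℓ (placeConj ℓ (layer ℓ L n₀))) :
    (fun n ↦ projClass hram n f.1) ∈ imagProjLimit ℓ L := by
  refine ⟨⟨fun n ↦ ?_, fun n m h ↦ ellMap_fieldClassNorm_projClass hram hμ h f.1⟩, ?_⟩
  · refine ellMap_fieldClassNorm_mem _ ?_
    rw [← range_classHom (range_placeAt hram (le_max_right n n₀))]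
    exact LinearMap.mem_range_self _ _
  · refine funext fun n ↦ ?_
    change ellMap ℓ (fieldClassMap (conj (layer ℓ L n))) (projClass hram n f.1) =
      -projClass hram n f.1
    rw [ellMap_conj_projClass, mem_antiSub.mp f.2, map_neg]

include hram in
theorem isFreeOfRank_imagProjLimit [IsCMField L] (hμ : ∃ ζ : L, IsPrimitiveRoot ζ ℓ)
    (hodd : ℓ ≠ 2) : IsFreeOfRank ℓ
      (Module.finrank ℤ_[ℓ] (antiSub ℓ (placeConj ℓ (layer ℓ L n₀)))) (imagProjLimit ℓ L) := by
  refine isFreeOfRank_of_bijective_limit (imagRelations hram)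
    (A := fun k ↦ EllClassGroup ℓ (layer ℓ L (n₀ + k)))
    ((LinearMap.pi fun n ↦ projClass hram n ∘ₗ Submodule.subtype _).codRestrict _
      (projClass_mem_imagProjLimit hram hμ))
    (fun k ↦ LinearMap.proj (n₀ + k) ∘ₗ Submodule.subtype _)
    (fun k ↦ ellMap ℓ (fieldClassNorm (incl ℓ L (Nat.le_succ (n₀ + k)))))
    (fun k z ↦ z.2.1.2 _ _ _) (fun z hz ↦ Subtype.ext (funext fun n ↦ ?_)) (fun k z ↦ ?_)
    (fun k f ↦ ?_)
  · rw [← z.2.1.2 n (n₀ + n) (Nat.le_add_left n n₀)]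
    have h1 : z.1 (n₀ + n) = 0 := hz n
    rw [h1, map_zero]
    rfl
  · obtain ⟨f, hf, h1⟩ := exists_classHom_of_conj_eq_neg hram hodd (Nat.le_add_right n₀ k)
      (z.2.1.1 (n₀ + k)) (congrFun z.2.2 (n₀ + k))
    exact ⟨⟨f, hf⟩, (projClass_of_le hram hμ (Nat.le_add_right n₀ k) f).trans h1⟩
  · rw [← classHom_eq_zero_iff_imagRelations hram hμ hodd (Nat.le_add_right n₀ k) (by omega),
      ← projClass_of_le hram hμ (Nat.le_add_right n₀ k)]
    rfl

end Limits

/-! ### The decomposed places of the maximal real subfield -/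

section Orbits

/-- The functions antisymmetric under an involution `τ` form a module of rank the number of its
orbits with two elements. -/
theorem finrank_antiSub {ℓ : ℕ} [Fact ℓ.Prime] (hodd : ℓ ≠ 2) {ι β : Type*} [Finite ι] {τ : ι → ι}
    (hτ : Function.Involutive τ) {f : ι → β} (hf : ∀ i j, f i = f j ↔ j = i ∨ j = τ i) :
    Module.finrank ℤ_[ℓ] (antiSub ℓ τ) = (f '' {i | τ i ≠ i}).ncard := by
  classical
  set T := f '' {i | τ i ≠ i}
  have : Finite T := Set.toFinite T
  have := Fintype.ofFinite T
  choose r hr hfr using fun t : T ↦ t.2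
  have hτr (i) (hi : τ i ≠ i) (t : T) (ht : f i = t) : i = r t ∨ i = τ (r t) :=
    (hf _ _).mp ((hfr t).trans ht.symm)
  obtain ⟨u, hu⟩ := exists_half hodd
  -- An antisymmetric function is determined by its values on representatives `r` of the orbits
  -- with two elements: it vanishes at the fixed points, as `2` is not a zero divisor.
  let e : antiSub ℓ τ →ₗ[ℤ_[ℓ]] (T → ℤ_[ℓ]) :=
    LinearMap.funLeft ℤ_[ℓ] ℤ_[ℓ] r ∘ₗ (antiSub ℓ τ).subtype
  have he (g : antiSub ℓ τ) (t : T) : e g t = g.1 (r t) := rfl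
  have hinj : Function.Injective e := by
    rw [injective_iff_map_eq_zero]
    refine fun g hg ↦ Subtype.ext (funext fun i ↦ ?_)
    have hgi (i) : g.1 (τ i) = -g.1 i := congrFun g.2 i
    change g.1 i = 0
    by_cases hi : τ i = i
    · have h1 := hgi i
      rw [hi] at h1
      linear_combination u * h1 - g.1 i * hu
    · have h0 : g.1 (r ⟨f i, i, hi, rfl⟩) = 0 := congrFun hg ⟨f i, i, hi, rfl⟩
      obtain h1 | h1 := hτr i hi ⟨f i, i, hi, rfl⟩ rfl
      · rw [h1, h0]
      · rw [h1, hgi, h0, neg_zero]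
  have hsurj : Function.Surjective e := fun h ↦ by
    let g : ι → ℤ_[ℓ] := fun i ↦ if hi : τ i ≠ i then
      if i = r ⟨f i, i, hi, rfl⟩ then h ⟨f i, i, hi, rfl⟩ else -h ⟨f i, i, hi, rfl⟩ else 0
    have hg1 (t : T) : g (r t) = h t := by
      have ht : (⟨f (r t), r t, hr t, rfl⟩ : T) = t := Subtype.ext (hfr t)
      refine (dif_pos (show τ (r t) ≠ r t from hr t)).trans ?_
      rw [ht, if_pos rfl]
    have hg2 (t : T) : g (τ (r t)) = -h t := by
      have h1 : τ (τ (r t)) ≠ τ (r t) := fun h ↦ hr t (hτ.injective h)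
      have ht : (⟨f (τ (r t)), τ (r t), h1, rfl⟩ : T) = t :=
        Subtype.ext (((hf _ _).mpr (Or.inr (hτ _).symm)).trans (hfr t))
      refine (dif_pos h1).trans ?_
      rw [ht, if_neg (hr t)]
    refine ⟨⟨g, mem_antiSub.mpr (funext fun i ↦ ?_)⟩, funext hg1⟩
    change g (τ i) = -g i
    by_cases hi : τ i = i
    · have h1 : g i = 0 := dif_neg (not_not.mpr hi)
      rw [hi, h1, neg_zero]
    · obtain h1 | h1 := hτr i hi ⟨f i, i, hi, rfl⟩ rfl
      · rw [h1, hg1, hg2]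
      · rw [h1, hτ, hg1, hg2, neg_neg]
  rw [(LinearEquiv.ofBijective e ⟨hinj, hsurj⟩).finrank_eq, Module.finrank_fintype_fun_eq_card,
    ← Nat.card_eq_fintype_card]
  rfl

/-- Of two primes with the same contraction to the ring fixed by an involution `σ`, one is contained
in the other or in its conjugate: for `x` in the first, the other contains `x * σ x`. -/
theorem le_or_le_comap_of_comap_eq {A B : Type*} [CommRing A] [CommRing B] {i : A →+* B}
    {σ : B →+* B} (hσ : ∀ x, σ (σ x) = x) (hfix : ∀ x, σ x = x → ∃ a, i a = x) {Q Q' : Ideal B}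
    [hQ' : Q'.IsPrime] (h : Q.comap i = Q'.comap i) : Q ≤ Q' ∨ Q ≤ Q'.comap σ := by
  refine Ideal.subset_union.mp fun x hx ↦ ?_
  obtain ⟨a, ha⟩ := hfix (x * σ x) (by rw [map_mul, hσ, mul_comm])
  have h1 : a ∈ Q'.comap i := h ▸ (Ideal.mem_comap.mpr (ha ▸ Q.mul_mem_right _ hx))
  rw [Ideal.mem_comap, ha] at h1
  exact hQ'.mem_or_mem h1

end Orbits

section Top

variable {ℓ : ℕ} {L : IntermediateField ℚ ℂ}

theorem natCast_mem_of_comap_eq {K M : Type*} [Field K] [NumberField K] [Field M] {f : K →+* M}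
    {Q : Ideal (𝓞 M)} {v : placesAbove ℓ K}
    (h : Q.comap (RingOfIntegers.mapRingHom f) = v.1.asIdeal) : (ℓ : 𝓞 M) ∈ Q := by
  have h1 : (ℓ : 𝓞 K) ∈ Q.comap (RingOfIntegers.mapRingHom f) := h ▸ v.2
  rwa [Ideal.mem_comap, map_natCast] at h1

theorem comap_comap_mapRingHom {K M N : Type*} [Field K] [Field M] [Field N] {f : K →+* M}
    {g : M →+* N} {k : K →+* N} (hk : g.comp f = k) (Q : Ideal (𝓞 N)) :
    (Q.comap (RingOfIntegers.mapRingHom g)).comap (RingOfIntegers.mapRingHom f) =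
      Q.comap (RingOfIntegers.mapRingHom k) := by
  rw [Ideal.comap_comap, mapRingHom_comp, hk]

theorem layer_le_cyclotomicExtension (n : ℕ) : layer ℓ L n ≤ cyclotomicExtension ℓ L :=
  fun _ hx ↦ mem_cyclotomicExtension_iff.mpr ⟨n, hx⟩

variable (ℓ L) in
/-- The inclusion of `L_n` in `L_∞`. -/
noncomputable def inclTop (n : ℕ) : layer ℓ L n →+* cyclotomicExtension ℓ L :=
  (IntermediateField.inclusion (layer_le_cyclotomicExtension n)).toRingHom

/-- An integer of `L_∞` comes from a layer, of index as large as desired. -/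
theorem exists_inclTop_eq (n₀ : ℕ) (x : 𝓞 (cyclotomicExtension ℓ L)) :
    ∃ n, n₀ ≤ n ∧ ∃ y, RingOfIntegers.mapRingHom (inclTop ℓ L n) y = x := by
  obtain ⟨n, hn⟩ := mem_cyclotomicExtension_iff.mp x.1.2
  refine ⟨max n₀ n, le_max_left _ _, ?_⟩
  let y : layer ℓ L (max n₀ n) := ⟨x.1.1, layer_mono ℓ L (le_max_right n₀ n) hn⟩
  have hy : inclTop ℓ L _ y = x.1 := Subtype.ext rfl
  have hinj : Function.Injective (inclTop ℓ L (max n₀ n)).toIntAlgHom :=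
    (inclTop ℓ L (max n₀ n)).injective
  have hint : IsIntegral ℤ y := (isIntegral_algHom_iff _ hinj).mp (by
    change IsIntegral ℤ (inclTop ℓ L _ y)
    rw [hy]; exact x.2)
  exact ⟨⟨y, hint⟩, RingOfIntegers.ext hy⟩

instance conjStable_cyclotomicExtension [ConjStable L] : ConjStable (cyclotomicExtension ℓ L) where
  conj_mem x hx := by
    obtain ⟨n, hn⟩ := mem_cyclotomicExtension_iff.mp hx
    exact mem_cyclotomicExtension_iff.mpr ⟨n, ConjStable.conj_mem x hn⟩

theorem inclTop_comp_conj [ConjStable L] (n : ℕ) :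
    (conj (cyclotomicExtension ℓ L)).comp (inclTop ℓ L n) =
      (inclTop ℓ L n).comp (conj (layer ℓ L n)) :=
  inclusion_comp_conj (layer_le_cyclotomicExtension n)

theorem inclTop_comp_incl {n m : ℕ} (h : n ≤ m) :
    (inclTop ℓ L m).comp (incl ℓ L h) = inclTop ℓ L n :=
  inclusion_comp_inclusion (layer_mono ℓ L h) (layer_le_cyclotomicExtension m)

variable [Fact ℓ.Prime] [NumberField L]

/-- The field `L_∞` is a CM field: its maximal real subfield is fixed by complex conjugation. -/
theorem mem_maximalRealSubfield_cyclotomicExtension_iff [IsCMField L]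
    (hμ : ∃ ζ : L, IsPrimitiveRoot ζ ℓ) {x : cyclotomicExtension ℓ L} :
    x ∈ maximalRealSubfield (cyclotomicExtension ℓ L) ↔ conj _ x = x := by
  rw [mem_maximalRealSubfield_iff]
  refine ⟨fun h ↦ Subtype.ext (h (cyclotomicExtension ℓ L).val.toRingHom), fun h φ ↦ ?_⟩
  obtain ⟨n, hn⟩ := mem_cyclotomicExtension_iff.mp x.2
  have h1 := embedding_layer_conj hμ (φ.comp (inclTop ℓ L n)) ⟨x.1, hn⟩
  have h2 : inclTop ℓ L n (conj _ ⟨x.1, hn⟩) = conj _ (inclTop ℓ L n ⟨x.1, hn⟩) :=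
    (RingHom.congr_fun (inclTop_comp_conj n) _).symm
  have h3 : inclTop ℓ L n ⟨x.1, hn⟩ = x := Subtype.ext rfl
  rw [RingHom.comp_apply, RingHom.comp_apply, h2, h3, h] at h1
  exact h1.symm

theorem exists_algebraMap_eq_of_conj_eq [IsCMField L] (hμ : ∃ ζ : L, IsPrimitiveRoot ζ ℓ)
    {x : 𝓞 (cyclotomicExtension ℓ L)} (hx : RingOfIntegers.mapRingHom (conj _) x = x) :
    ∃ a : 𝓞 (maximalRealSubfield (cyclotomicExtension ℓ L)),
      algebraMap _ (𝓞 (cyclotomicExtension ℓ L)) a = x := by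
  have h1 : x.1 ∈ maximalRealSubfield (cyclotomicExtension ℓ L) :=
    (mem_maximalRealSubfield_cyclotomicExtension_iff hμ).mpr (congrArg Subtype.val hx)
  have hint : IsIntegral ℤ (⟨x.1, h1⟩ : maximalRealSubfield (cyclotomicExtension ℓ L)) :=
    (isIntegral_algHom_iff
      (maximalRealSubfield (cyclotomicExtension ℓ L)).subtype.toIntAlgHom
      Subtype.val_injective).mp x.2
  exact ⟨⟨_, hint⟩, RingOfIntegers.ext rfl⟩

variable {n₀ : ℕ}

theorem exists_comap_eq_of_mem {K M : Type*} [Field K] [NumberField K] [Field M] [CharZero M]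
    (f : K →+* M) {Q : Ideal (𝓞 M)} (hQ : Q.IsPrime) (hℓ : (ℓ : 𝓞 M) ∈ Q) :
    ∃ v : placesAbove ℓ K, Q.comap (RingOfIntegers.mapRingHom f) = v.1.asIdeal := by
  have h : (ℓ : 𝓞 K) ∈ Q.comap (RingOfIntegers.mapRingHom f) := by
    rw [Ideal.mem_comap, map_natCast]; exact hℓ
  have h0 : (ℓ : 𝓞 K) ≠ 0 := by exact_mod_cast (Fact.out : ℓ.Prime).ne_zero
  exact ⟨⟨⟨_, Ideal.IsPrime.comap _, fun hb ↦ h0 (by rwa [hb] at h)⟩, h⟩, rfl⟩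

theorem exists_prime_comap_eq {K M : Type*} [Field K] [NumberField K] [Field M] [CharZero M]
    (f : K →+* M) (v : HeightOneSpectrum (𝓞 K)) : ∃ Q : Ideal (𝓞 M), Q.IsPrime ∧
      Q.comap (RingOfIntegers.mapRingHom f) = v.asIdeal := by
  let : Algebra (𝓞 K) (𝓞 M) := (RingOfIntegers.mapRingHom f).toAlgebra
  have : Algebra.IsIntegral (𝓞 K) (𝓞 M) := Algebra.IsIntegral.tower_top ℤ
  have hv := v.isPrime
  obtain ⟨Q, -, hQ, h⟩ := Ideal.exists_ideal_over_prime_of_isIntegral v.asIdeal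
    (⊥ : Ideal (𝓞 M)) (by
    change Ideal.comap (RingOfIntegers.mapRingHom f) ⊥ ≤ _
    rw [Ideal.comap_bot_of_injective _ (mapRingHom_injective f)]
    exact bot_le)
  exact ⟨Q, hQ, h⟩

theorem comap_inclTop_eq_placeAt (hram : TotallyRamifiedFrom ℓ L n₀)
    {Q : Ideal (𝓞 (cyclotomicExtension ℓ L))} (hQ : Q.IsPrime)
    {v : placesAbove ℓ (layer ℓ L n₀)}
    (h : Q.comap (RingOfIntegers.mapRingHom (inclTop ℓ L n₀)) = v.1.asIdeal) {n : ℕ}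
    (hn : n₀ ≤ n) : Q.comap (RingOfIntegers.mapRingHom (inclTop ℓ L n)) =
      (placeAt hram hn v).asIdeal := by
  obtain ⟨w, hw⟩ := exists_comap_eq_of_mem (inclTop ℓ L n) hQ (natCast_mem_of_comap_eq h)
  have h2 : w.1.asIdeal.comap (RingOfIntegers.mapRingHom (incl ℓ L hn)) = v.1.asIdeal := by
    rw [← hw, comap_comap_mapRingHom (inclTop_comp_incl hn), h]
  rw [hw, eq_placeAt hram hn h2]

/-- As the places above `ℓ` are totally ramified in `L_∞ / L_{n₀}`, a prime of `L_∞` above `ℓ` is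
determined by its contraction to `L_{n₀}`. -/
theorem le_of_comap_inclTop_eq (hram : TotallyRamifiedFrom ℓ L n₀)
    {Q Q' : Ideal (𝓞 (cyclotomicExtension ℓ L))} (hQ : Q.IsPrime) (hQ' : Q'.IsPrime)
    {v : placesAbove ℓ (layer ℓ L n₀)}
    (h : Q.comap (RingOfIntegers.mapRingHom (inclTop ℓ L n₀)) = v.1.asIdeal)
    (h' : Q'.comap (RingOfIntegers.mapRingHom (inclTop ℓ L n₀)) = v.1.asIdeal) : Q ≤ Q' := by
  intro x hx
  obtain ⟨n, hn, y, rfl⟩ := exists_inclTop_eq n₀ x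
  have h1 : Q.comap (RingOfIntegers.mapRingHom (inclTop ℓ L n)) =
      Q'.comap (RingOfIntegers.mapRingHom (inclTop ℓ L n)) :=
    (comap_inclTop_eq_placeAt hram hQ h hn).trans (comap_inclTop_eq_placeAt hram hQ' h' hn).symm
  exact Ideal.mem_comap.mp (h1 ▸ Ideal.mem_comap.mpr hx)

/-- The rank of the module of antisymmetric functions on the places of `L_{n₀}` above `ℓ` is the
number of places of `L_∞⁺` above `ℓ` that are decomposed in `L_∞`. -/
theorem finrank_antiSub_placeConj [IsCMField L] (hμ : ∃ ζ : L, IsPrimitiveRoot ζ ℓ) (hodd : ℓ ≠ 2)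
    (hram : TotallyRamifiedFrom ℓ L n₀) :
    Module.finrank ℤ_[ℓ] (antiSub ℓ (placeConj ℓ (layer ℓ L n₀))) =
      numSplitPlaces ℓ (cyclotomicExtension ℓ L) := by
  have hτ : Function.Involutive (placeConj ℓ (layer ℓ L n₀)) := placeConj_placeConj
  choose Q hQ hQv using fun v : placesAbove ℓ (layer ℓ L n₀) ↦
    exists_prime_comap_eq (inclTop ℓ L n₀) v.1
  have hQeq {P : Ideal (𝓞 (cyclotomicExtension ℓ L))} (hP : P.IsPrime)
      {v : placesAbove ℓ (layer ℓ L n₀)}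
      (h : P.comap (RingOfIntegers.mapRingHom (inclTop ℓ L n₀)) = v.1.asIdeal) : P = Q v :=
    le_antisymm (le_of_comap_inclTop_eq hram hP (hQ v) h (hQv v))
      (le_of_comap_inclTop_eq hram (hQ v) hP (hQv v) h)
  have hℓQ (v) : (ℓ : 𝓞 (cyclotomicExtension ℓ L)) ∈ Q v := natCast_mem_of_comap_eq (hQv v)
  have hle {v w} (h : Q v ≤ Q w) : w = v := by
    have h1 := Ideal.comap_mono (f := RingOfIntegers.mapRingHom (inclTop ℓ L n₀)) h
    rw [hQv, hQv] at h1
    exact Subtype.ext (HeightOneSpectrum.ext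
      (v.1.isMaximal.eq_of_le w.1.isPrime.ne_top h1).symm)
  have hconj (v) : (Q v).comap (RingOfIntegers.mapRingHom (conj (cyclotomicExtension ℓ L))) =
      Q (placeConj ℓ _ v) := by
    refine hQeq (Ideal.IsPrime.comap _ (hK := hQ v)) ?_
    rw [comap_comap_mapRingHom (inclTop_comp_conj n₀), ← comap_comap_mapRingHom rfl, hQv,
      comap_conj_eq_placeConj]
  let i : 𝓞 (maximalRealSubfield (cyclotomicExtension ℓ L)) →+* 𝓞 (cyclotomicExtension ℓ L) :=
    algebraMap _ _
  have hconji : (RingOfIntegers.mapRingHom (conj (cyclotomicExtension ℓ L))).comp i = i :=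
    RingHom.ext fun a ↦ RingOfIntegers.ext
      ((mem_maximalRealSubfield_cyclotomicExtension_iff hμ).mp a.1.2)
  have hf (v w) : (Q v).comap i = (Q w).comap i ↔ w = v ∨ w = placeConj ℓ _ v := by
    constructor
    · intro h
      have := hQ w
      obtain h1 | h1 := le_or_le_comap_of_comap_eq mapRingHom_conj_conj
        (fun x hx ↦ exists_algebraMap_eq_of_conj_eq hμ hx) h
      · exact Or.inl (hle h1)
      · rw [hconj] at h1
        exact Or.inr (hτ.eq_iff.mp (hle h1))
    · rintro (rfl | rfl)
      · rfl
      · rw [← hconj, Ideal.comap_comap, hconji]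
  rw [finrank_antiSub hodd hτ hf, numSplitPlaces]
  congr 1
  ext p
  constructor
  · rintro ⟨v, hv, rfl⟩
    have := hQ v
    refine ⟨Ideal.IsPrime.comap _, ?_, Q v, ⟨hQ v, ⟨rfl⟩⟩, Q (placeConj ℓ _ v), ⟨hQ _, ⟨?_⟩⟩,
      fun h ↦ hv (hle h.le)⟩
    · rw [Ideal.mem_comap, map_natCast]
      exact hℓQ v
    · exact (hf v _).mpr (Or.inr rfl)
  · rintro ⟨-, hℓ, P, hP, P', hP', hne⟩
    have hmem {P : Ideal (𝓞 (cyclotomicExtension ℓ L))} (hP : P.LiesOver p) :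
        (ℓ : 𝓞 (cyclotomicExtension ℓ L)) ∈ P := by
      have h1 := hℓ
      rw [hP.over, Ideal.mem_comap, map_natCast] at h1
      exact h1
    obtain ⟨v, hv⟩ := exists_comap_eq_of_mem (inclTop ℓ L n₀) hP.1 (hmem hP.2)
    obtain ⟨w, hw⟩ := exists_comap_eq_of_mem (inclTop ℓ L n₀) hP'.1 (hmem hP'.2)
    have h1 : p = (Q v).comap i := hQeq hP.1 hv ▸ hP.2.over
    have h2 : p = (Q w).comap i := hQeq hP'.1 hw ▸ hP'.2.over
    refine ⟨v, fun hvv ↦ hne ?_, h1.symm⟩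
    rw [hQeq hP.1 hv, hQeq hP'.1 hw]
    obtain h3 | h3 := (hf v w).mp (h1.symm.trans h2)
    · rw [h3]
    · rw [h3, hvv]

end Top

end CyclotomicTower

open CyclotomicTower in
theorem proposition7 (ℓ : ℕ) [Fact ℓ.Prime] (hodd : ℓ ≠ 2)
    (L : IntermediateField ℚ ℂ) [NumberField L] [IsCMField L]
    (hμ : ∃ ζ : L, IsPrimitiveRoot ζ ℓ) :
    (∃ n₀, TotallyRamifiedFrom ℓ L n₀) ∧
    (∀ n₀, TotallyRamifiedFrom ℓ L n₀ → ∀ n (h : n₀ ≤ n),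
      imagUnits ℓ (layer ℓ L n) =
        CommGroup.torsion (layer ℓ L n)ˣ ⊔
          (imagUnits ℓ (layer ℓ L n₀)).map (Units.map (incl ℓ L h).toMonoidHom) ∧
      imagPrincipalDivisors ℓ (layer ℓ L n) =
        (imagPrincipalDivisors ℓ (layer ℓ L n₀)).map (divisorMap (incl ℓ L h))) ∧
    IsDivisibleOfCodim ℓ (numSplitPlaces ℓ (cyclotomicExtension ℓ L)) (imagIndLimit ℓ L) ∧
    IsFreeOfRank ℓ (numSplitPlaces ℓ (cyclotomicExtension ℓ L)) (imagProjLimit ℓ L) := by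
  obtain ⟨n₀, hram⟩ := exists_totallyRamifiedFrom hμ
  have hrank := finrank_antiSub_placeConj hμ hodd hram
  exact ⟨⟨n₀, hram⟩, fun n₀ hram n h ↦ ⟨imagUnits_eq hram hμ hodd h,
    imagPrincipalDivisors_eq hram hμ hodd h⟩, hrank ▸ isDivisibleOfCodim_imagIndLimit hram hμ hodd,
    hrank ▸ isFreeOfRank_imagProjLimit hram hμ hodd⟩
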